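/- **Definitions.** Let $V$ be a finite-dimensional real vector space and $\mathrm{AGr}^m(V)$ the space of its affine subspaces of codimension $m$. An *$m$-density* on $V$ is a continuous real function $\delta$ on the set of decomposable $m$-vectors of $V$ with $\delta(t\xi)=|t|\,\delta(\xi)$ for $t\in\mathbb R$; an $m$-density on a manifold is an $m$-density on each tangent space, depending continuously on the point. A *normal measure* on $\mathrm{AGr}^m(V)$ is a translation invariant signed Borel measure that is finite on compact sets (i.e. a difference of two such nonnegative measures); $\mathfrak m_m(V)$ is the space of these. For $\mu\in\mathfrak m_p(V)$, $\nu\in\mathfrak m_q(V)$ the product $\mu\cdot\nu\in\mathfrak m_{p+q}(V)$ is $(\mu\cdot\nu)(D)=(\mu\times\nu)\{(G,H): \operatorname{codim}(G\cap H)=p+q,\ G\cap H\in D\}$. Put $\chi_m(\mu)(\xi_1\wedge\dots\wedge\xi_m)=\mu\{H\in \mathrm{AGr}^m(V): H\cap\Pi_\xi\neq\emptyset\}$, where $\Pi_\xi$ is the parallelotope generated by $\xi_1,\dots,\xi_m$. The *normal densities* on $V$ are the elements of $\mathfrak n_m(V)=\chi_m(\mathfrak m_m(V))$; the graded ring structure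 of $\mathfrak n(V)=\bigoplus_m\mathfrak n_m(V)$ is given by $\chi_p(\mu)\cdot\chi_q(\nu)=\chi_{p+q}(\mu\cdot\nu)$. A *normal $m$-density* on a manifold $Y$ is an $m$-density on $Y$ whose value at each $y\in Y$ lies in $\mathfrak n_m(T_yY)$; with the pointwise product the normal densities form the ring $\mathfrak n(Y)$. A *double fibration* $Y\xleftarrow{\,p\,}X\xrightarrow{\,q\,}\Gamma$ consists of smooth manifolds $X,Y,\Gamma$ and projection maps $p,q$ of smooth locally trivial fibre bundles, the fibre of $p$ being compact, of dimension $k$. For an $m$-density $\Phi$ on $\Gamma$ with $m\ge k$, its *Gelfand transform* is the $(m-k)$-density $p_*q^*\Phi$ on $Y$. Here $q^*$ is the pull-back, $(q^*\Phi)_x(v_1,\dots,v_m)=\Phi_{q(x)}(dq_x v_1,\dots,dq_x v_m)$, and $p_*$ is integration over the fibres: $(p_*\delta)_y(\eta_1\wedge\dots\wedge\eta_{m-k})$ is the integral over $x\in p^{-1}(y)$ of the $k$-density $f_1\wedge\dots\wedge f_k\mapsto\delta_x(\xi_1\wedge\dots\wedge\xi_{m-k}\wedge f_1\wedge\dots\wedge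 f_k)$, where $\xi_j\in T_xX$ is any vector with $dp_x(\xi_j)=\eta_j$. **Theorem.** For $i=1,\dots,n$ let $Y_i\xleftarrow{\,p_i\,}X_i\xrightarrow{\,q_i\,}\Gamma_i$ be a double fibration, let $k_i$ be the dimension of the fibre of $p_i$, and assume $k_i\le\dim\Gamma_i$. Let $\Phi_i$ be a density of top order $\dim\Gamma_i$ on $\Gamma_i$ and $\Omega_i=p_{i*}q_i^*\Phi_i$ its Gelfand transform on $Y_i$. Consider the product double fibration $$Y=Y_1\times\dots\times Y_n\xleftarrow{\,p\,}X=X_1\times\dots\times X_n\xrightarrow{\,q\,}\Gamma=\Gamma_1\times\dots\times\Gamma_n,$$ where $p=p_1\times\dots\times p_n$ and $q=q_1\times\dots\times q_n$. Let $\Phi=\Phi_1\cdots\Phi_n$ be the product, in $\mathfrak n(\Gamma)$, of the densities $\Phi_i$ lifted to $\Gamma$ by the projections $\Gamma\to\Gamma_i$, a density of top order on $\Gamma$, and let $\Omega=p_*q^*\Phi$ be its Gelfand transform on $Y$. Then $\Omega$ is a normal density on $Y$, each $\Omega_i$ is a normal density on $Y_i$, and $$\Omega=\Omega_1\cdots\Omega_n$$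 in the ring $\mathfrak n(Y)$, where on the right-hand side $\Omega_i$ is lifted to $Y$ by the projection $Y\to Y_i$. -/

import Mathlib

open Set MeasureTheory Module
open scoped Manifold ContDiff Pointwise

noncomputable section

namespace NormalDensity

/-! ### Densities, affine Grassmannians and normal measures on a real vector space

Throughout, `V` is a finite-dimensional real vector space with its canonical topology. -/

section Linear

variable {V : Type*} [AddCommGroup V] [Module ℝ V] [TopologicalSpace V]

/-- An `m`-density on `V`: a continuous real function `δ` of decomposable `m`-vectors such that
`δ (t ξ) = |t| δ ξ` for all real `t`.  It is written as a function of the tuple `(v₁, …, vₘ)`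
representing `ξ = v₁ ∧ … ∧ vₘ`; the case `t = 1` of `map_smul` says that it depends on `ξ` only. -/
structure IsDensity {m : ℕ} (δ : (Fin m → V) → ℝ) : Prop where
  continuous : Continuous δ
  map_smul : ∀ (t : ℝ) (v w : Fin m → V),
    exteriorPower.ιMulti ℝ m w = t • exteriorPower.ιMulti ℝ m v → δ w = |t| * δ v

variable (V) in
/-- The affine Grassmannian `AGr^m(V)` of affine subspaces of codimension `m` in `V`. -/
def AGr (m : ℕ) : Type _ :=
  {A : AffineSubspace ℝ V // (A : Set V).Nonempty ∧ finrank ℝ (V ⧸ A.direction) = m}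

theorem codim_mk' {m : ℕ} (v : V) (f : V →L[ℝ] (Fin m → ℝ)) (hf : Function.Surjective f) :
    finrank ℝ (V ⧸ (AffineSubspace.mk' v (LinearMap.ker (f : V →ₗ[ℝ] (Fin m → ℝ)))).direction)
      = m := by
  rw [AffineSubspace.direction_mk',
    ((f : V →ₗ[ℝ] (Fin m → ℝ)).quotKerEquivOfSurjective hf).finrank_eq]
  simp

/-- The affine subspace `v + ker f` of codimension `m`, for a surjective linear `f : V → ℝ^m`.
Every element of `AGr V m` has this form. -/
def AGr.ofKer {m : ℕ} (z : {f : V →L[ℝ] (Fin m → ℝ) // Function.Surjective f} × V) : AGr V m :=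
  ⟨AffineSubspace.mk' z.2 (LinearMap.ker (z.1.1 : V →ₗ[ℝ] (Fin m → ℝ))),
    AffineSubspace.mk'_nonempty _ _, codim_mk' z.2 z.1.1 z.1.2⟩

/-- The usual topology of the affine Grassmannian, as a quotient of the space of pairs `(f, v)`,
where `f : V → ℝ^m` is a surjective linear map and `v ∈ V`. -/
instance (m : ℕ) [IsTopologicalAddGroup V] [ContinuousSMul ℝ V] : TopologicalSpace (AGr V m) :=
  TopologicalSpace.coinduced AGr.ofKer inferInstance

/-- The Borel `σ`-algebra of the affine Grassmannian. -/
instance (m : ℕ) [IsTopologicalAddGroup V] [ContinuousSMul ℝ V] : MeasurableSpace (AGr V m) :=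
  borel _

/-- The translate `v + A` of an affine subspace `A`. -/
def AGr.translate {m : ℕ} (v : V) (A : AGr V m) : AGr V m :=
  ⟨v +ᵥ A.1, by
    obtain ⟨x, hx⟩ := A.2.1
    exact ⟨v +ᵥ x, AffineSubspace.vadd_mem_pointwise_vadd_iff.2 hx⟩,
    by rw [AffineSubspace.pointwise_vadd_direction]; exact A.2.2⟩

/-- The set `J_{m,D}` of affine subspaces of codimension `m` that meet `D`. -/
def hitting (m : ℕ) (D : Set V) : Set (AGr V m) :=
  {A | ((A.1 : Set V) ∩ D).Nonempty}

variable [IsTopologicalAddGroup V] [ContinuousSMul ℝ V]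

/-- A nonnegative normal measure on `AGr^m(V)`: a translation invariant Borel measure which is
finite on compact sets. -/
structure IsNormalMeasure {m : ℕ} (μ : Measure (AGr V m)) : Prop where
  finite_on_compacts : ∀ K : Set (AGr V m), IsCompact K → μ K < ⊤
  translation_invariant : ∀ (v : V) (D : Set (AGr V m)), MeasurableSet D →
    μ (AGr.translate v ⁻¹' D) = μ D

variable (V) in
/-- A normal measure on `AGr^m(V)`, that is, a translation invariant signed Borel measure which is
finite on compact sets, written as a difference `pos - neg` of two nonnegative ones (for instance
by its Jordan decomposition); its value on a bounded Borel set `D` is `pos D - neg D`.  The two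
parts may both be infinite on the whole space, so it is not a `SignedMeasure`. -/
structure NormalMeasure (m : ℕ) where
  pos : Measure (AGr V m)
  neg : Measure (AGr V m)
  isNormal_pos : IsNormalMeasure pos
  isNormal_neg : IsNormalMeasure neg

/-- `χ_m` for a nonnegative measure: `χ_m(μ)(ξ₁ ∧ … ∧ ξₘ)` is the measure of the set of affine
subspaces of codimension `m` meeting the parallelotope generated by `ξ₁, …, ξₘ`. -/
def chi {m : ℕ} (μ : Measure (AGr V m)) (ξ : Fin m → V) : ℝ :=
  (μ (hitting m (parallelepiped ξ))).toReal

/-- `χ_m(μ)` for a (signed) normal measure `μ`. -/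
def NormalMeasure.chi {m : ℕ} (μ : NormalMeasure V m) (ξ : Fin m → V) : ℝ :=
  NormalDensity.chi μ.pos ξ - NormalDensity.chi μ.neg ξ

/-- Normal `m`-densities on `V`: the elements of `𝔫_m(V) = χ_m(𝔪_m(V))`. -/
def IsNormal {m : ℕ} (δ : (Fin m → V) → ℝ) : Prop :=
  ∃ μ : NormalMeasure V m, δ = μ.chi

variable (V) in
/-- The pairs `(G, H) ∈ AGr^p(V) × AGr^q(V)` such that `G ∩ H` has codimension `m`
(where `m = p + q`). -/
def Transversal (p q m : ℕ) : Type _ :=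
  {x : AGr V p × AGr V q // ((x.1.1 ⊓ x.2.1 : AffineSubspace ℝ V) : Set V).Nonempty ∧
    finrank ℝ (V ⧸ (x.1.1 ⊓ x.2.1).direction) = m}

instance (p q m : ℕ) : MeasurableSpace (Transversal V p q m) :=
  inferInstanceAs (MeasurableSpace (Subtype _))

/-- The intersection map `P_{p,q} : (G, H) ↦ G ∩ H`. -/
def Transversal.inter {p q m : ℕ} (x : Transversal V p q m) : AGr V m :=
  ⟨x.1.1.1 ⊓ x.1.2.1, x.2⟩

/-- The product of two nonnegative measures: `(μ · ν)(D) = (μ × ν)(P_{p,q}⁻¹(D))`, a measure on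
`AGr^m(V)` with `m = p + q`. -/
def mulMeasure {p q : ℕ} (μ : Measure (AGr V p)) (ν : Measure (AGr V q)) (m : ℕ) :
    Measure (AGr V m) :=
  ((μ.prod ν).comap (Subtype.val : Transversal V p q m → AGr V p × AGr V q)).map
    Transversal.inter

/-- `χ_m(μ · ν)` for (signed) normal measures `μ` and `ν`, the product of measures being extended
bilinearly. -/
def NormalMeasure.chiMul {p q : ℕ} (μ : NormalMeasure V p) (ν : NormalMeasure V q) (m : ℕ)
    (ξ : Fin m → V) : ℝ :=
  (NormalDensity.chi (mulMeasure μ.pos ν.pos m) ξ + NormalDensity.chi (mulMeasure μ.neg ν.neg m) ξ)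
    - (NormalDensity.chi (mulMeasure μ.pos ν.neg m) ξ
      + NormalDensity.chi (mulMeasure μ.neg ν.pos m) ξ)

open Classical in
/-- The product of normal densities `δ ∈ 𝔫_p(V)` and `ε ∈ 𝔫_q(V)` in the graded ring `𝔫(V)`, an
element of `𝔫_m(V)` with `m = p + q`: it is `χ(μ · ν)` where `δ = χ(μ)` and `ε = χ(ν)`.  As `𝔫(V)`
is the quotient of the ring of normal measures by the ideal `Ker χ`, it does not matter which
representing measures are taken. -/
def mulDensity {p q : ℕ} (δ : (Fin p → V) → ℝ) (ε : (Fin q → V) → ℝ) (m : ℕ) :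
    (Fin m → V) → ℝ :=
  if h : IsNormal δ ∧ IsNormal ε then h.1.choose.chiMul h.2.choose m else 0

/-- The product `δ₁ · … · δₙ` in `𝔫(V)` of normal densities of degrees `d₁, …, dₙ`; the empty
product is the unit, the `0`-density `1`. -/
def prodDensity : ∀ {n : ℕ} {d : Fin n → ℕ} (_δ : ∀ i, (Fin (d i) → V) → ℝ),
    (Fin (∑ i, d i) → V) → ℝ
  | 0, _, _ => fun _ => 1
  | _ + 1, _, δ => mulDensity (δ 0) (prodDensity fun i => δ i.succ) _

end Linear

/-! ### Densities on manifolds -/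

section Manifold

variable {E : Type*} [NormedAddCommGroup E] [NormedSpace ℝ E] {H : Type*} [TopologicalSpace H]
  (I : ModelWithCorners ℝ E H)
  {E' : Type*} [NormedAddCommGroup E'] [NormedSpace ℝ E'] {H' : Type*} [TopologicalSpace H']
  (J : ModelWithCorners ℝ E' H')
  {X : Type*} [TopologicalSpace X] [ChartedSpace H X]
  {Y : Type*} [TopologicalSpace Y] [ChartedSpace H' Y]

/-- A family of functions of `m` tangent vectors on a manifold `X`. -/
abbrev DensityFamily (X : Type*) [TopologicalSpace X] [ChartedSpace H X] (m : ℕ) : Type _ :=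
  ∀ x : X, (Fin m → TangentSpace I x) → ℝ

/-- An `m`-density on a manifold: an `m`-density on each tangent space, depending continuously on
the point; the latter means that the expression of `δ` in each chart is continuous. -/
structure IsDensityOn {m : ℕ} (δ : DensityFamily I X m) : Prop where
  isDensity : ∀ x, IsDensity (δ x)
  continuous : ∀ x₀ : X, ContinuousOn
    (fun z : E × (Fin m → E) => δ ((extChartAt I x₀).symm z.1)
      (fun i => mfderiv 𝓘(ℝ, E) I (extChartAt I x₀).symm z.1 (z.2 i)))
    ((extChartAt I x₀).target ×ˢ univ)

/-- A normal `m`-density on a manifold `X`: a continuous function `x ↦ δ_x ∈ 𝔫_m(T_x X)`. -/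
structure IsNormalOn {m : ℕ} (δ : DensityFamily I X m) : Prop where
  isDensityOn : IsDensityOn I δ
  isNormal : ∀ x, IsNormal (δ x)

/-- The pointwise product of normal densities on a manifold `X`, in the ring `𝔫(X)`. -/
def prodOn {n : ℕ} {d : Fin n → ℕ} (δ : ∀ i, DensityFamily I X (d i)) :
    DensityFamily I X (∑ i, d i) :=
  fun x => prodDensity fun i => δ i x

/-- The pull-back `f^* δ` of a density under a map `f : X → Y`. -/
def pullback (f : X → Y) {m : ℕ} (δ : DensityFamily J Y m) : DensityFamily I X m :=
  fun x v => δ (f x) (fun i => mfderiv I J f x (v i))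

/-- A finite decomposition of a `k`-dimensional submanifold `S` of `X` into disjoint measurable
pieces, each of which is contained in the domain of a smooth local parametrization of `S`
(equivalently, of a chart of `S`). -/
structure ParamDecomposition (S : Set X) (k : ℕ) where
  N : ℕ
  dom : Fin N → Set (Fin k → ℝ)
  piece : Fin N → Set (Fin k → ℝ)
  param : Fin N → (Fin k → ℝ) → X
  isOpen_dom : ∀ j, IsOpen (dom j)
  piece_subset : ∀ j, piece j ⊆ dom j
  measurableSet_piece : ∀ j, MeasurableSet (piece j)
  contMDiffOn : ∀ j, ContMDiffOn 𝓘(ℝ, Fin k → ℝ) I ∞ (param j) (dom j)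
  injOn : ∀ j, InjOn (param j) (dom j)
  immersion : ∀ j, ∀ u ∈ dom j, Function.Injective (mfderiv 𝓘(ℝ, Fin k → ℝ) I (param j) u)
  mapsTo : ∀ j, MapsTo (param j) (dom j) S
  disjoint : ∀ i j, i ≠ j → Disjoint (param i '' piece i) (param j '' piece j)
  cover : ⋃ j, param j '' piece j = S

/-- The integral of a `k`-density `ρ` along a `k`-dimensional submanifold, computed in the
parametrizations of a given decomposition. -/
def ParamDecomposition.integral {S : Set X} {k : ℕ} (P : ParamDecomposition I S k)
    (ρ : DensityFamily I X k) : ℝ :=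
  ∑ j, ∫ u in P.piece j, ρ (P.param j u)
    (fun i => mfderiv 𝓘(ℝ, Fin k → ℝ) I (P.param j) u (Pi.single i (1 : ℝ)))

open Classical in
/-- The integral `∫_S ρ` of a continuous `k`-density over a compact `k`-dimensional submanifold `S`
of `X`; only the values of `ρ` on vectors tangent to `S` matter.  By the change of variables
formula it does not depend on the decomposition. -/
def integralOver (S : Set X) {k : ℕ} (ρ : DensityFamily I X k) : ℝ :=
  if h : Nonempty (ParamDecomposition I S k) then h.some.integral I ρ else 0

/-- The push-forward `p_* δ` of an `m`-density under a fibration `p : X → Y` with compact fibres of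
dimension `k`, where `m = d + k`; it is a `d`-density.  For `η₁, …, η_d ∈ T_y Y` its value is the
integral over `F_y = p⁻¹(y)` of the `k`-density `(f₁, …, f_k) ↦ δ(ξ₁, …, ξ_d, f₁, …, f_k)`, where
`ξ_j ∈ T_x X` is a lift of `η_j`, that is, `dp_x(ξ_j) = η_j`. -/
def pushforward (p : X → Y) {m d k : ℕ} (h : d + k = m) (δ : DensityFamily I X m) :
    DensityFamily J Y d :=
  fun y η => integralOver I (p ⁻¹' {y}) (k := k) fun x f =>
    δ x (Fin.append (fun j => Function.invFun (mfderiv I J p x) (η j)) f ∘ Fin.cast h.symm)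

variable {E'' : Type*} [NormedAddCommGroup E''] [NormedSpace ℝ E'']
  {H'' : Type*} [TopologicalSpace H''] (K : ModelWithCorners ℝ E'' H'')
  {Γ : Type*} [TopologicalSpace Γ] [ChartedSpace H'' Γ]

/-- The Gelfand transform `p_* q^* Φ` of an `m`-density `Φ` on `Γ`, for a double fibration
`Y ← X → Γ` such that the fibre of `p : X → Y` has dimension `k`; it is a density of degree
`d = m - k`. -/
def gelfandTransform (p : X → Y) (q : X → Γ) {m d k : ℕ} (h : d + k = m)
    (Φ : DensityFamily K Γ m) : DensityFamily J Y d :=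
  pushforward I J p h (pullback I K q Φ)

/-- `p : X → Y` is the projection map of a smooth locally trivial fibre bundle with fibre `F`. -/
def IsSmoothFiberBundle (F : Type*) [TopologicalSpace F] [ChartedSpace H'' F] (p : X → Y) : Prop :=
  ∀ y : Y, ∃ e : Bundle.Trivialization F p, y ∈ e.baseSet ∧
    ContMDiffOn I (J.prod K) ∞ e e.source ∧
    ContMDiffOn (J.prod K) I ∞ e.toOpenPartialHomeomorph.symm e.target

end Manifold

theorem sum_degrees {n : ℕ} {d k m : Fin n → ℕ} (h : ∀ i, d i + k i = m i) :
    ∑ i, d i + ∑ i, k i = ∑ i, m i := by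
  rw [← Finset.sum_add_distrib]
  exact Finset.sum_congr rfl fun i _ => h i

/-- A double fibration `Y ← X → Γ`: the maps `p : X → Y` and `q : X → Γ` are projections of smooth
locally trivial fibre bundles, with fibres `F` and `G` respectively, and `F` is compact. -/
structure IsDoubleFibration
    (EX : Type*) [NormedAddCommGroup EX] [NormedSpace ℝ EX]
    (EY : Type*) [NormedAddCommGroup EY] [NormedSpace ℝ EY]
    (EΓ : Type*) [NormedAddCommGroup EΓ] [NormedSpace ℝ EΓ]
    (EF : Type*) [NormedAddCommGroup EF] [NormedSpace ℝ EF]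
    (EG : Type*) [NormedAddCommGroup EG] [NormedSpace ℝ EG]
    {X : Type*} [TopologicalSpace X] [ChartedSpace EX X]
    {Y : Type*} [TopologicalSpace Y] [ChartedSpace EY Y]
    {Γ : Type*} [TopologicalSpace Γ] [ChartedSpace EΓ Γ]
    (F : Type*) [TopologicalSpace F] [ChartedSpace EF F]
    (G : Type*) [TopologicalSpace G] [ChartedSpace EG G]
    (p : X → Y) (q : X → Γ) : Prop where
  fiberBundle_left : IsSmoothFiberBundle 𝓘(ℝ, EX) 𝓘(ℝ, EY) 𝓘(ℝ, EF) F p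
  fiberBundle_right : IsSmoothFiberBundle 𝓘(ℝ, EX) 𝓘(ℝ, EΓ) 𝓘(ℝ, EG) G q
  compact_fiber : CompactSpace F

section Product

variable {n : ℕ} {E : Fin n → Type*} [∀ i, NormedAddCommGroup (E i)] [∀ i, NormedSpace ℝ (E i)]
  {M : Fin n → Type*} [∀ i, TopologicalSpace (M i)] [∀ i, ChartedSpace (E i) (M i)]

variable (E) in
/-- The model with corners of a product `M₁ × … × Mₙ` of manifolds without boundary. -/
abbrev modelPi : ModelWithCorners ℝ (∀ i, E i) (ModelPi E) :=
  ModelWithCorners.pi fun i => 𝓘(ℝ, E i)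

/-- The product `δ₁ · … · δₙ` of densities on the factors of `M = M₁ × … × Mₙ`: the densities are
lifted to `M` (pulled back under the projections `M → M_i`) and multiplied in `𝔫(M)`. -/
def externalProd {d : Fin n → ℕ} (δ : ∀ i, DensityFamily 𝓘(ℝ, E i) (M i) (d i)) :
    DensityFamily (modelPi E) (∀ i, M i) (∑ i, d i) :=
  prodOn (modelPi E) fun i => pullback (modelPi E) 𝓘(ℝ, E i) (fun y : ∀ i, M i => y i) (δ i)

end Product

end NormalDensity

end

set_option linter.unusedSectionVars false

/-! In charts a top density on Γ is a scalar times |det|. Hence Ω_y(η) is the integral over the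
fibre of p of c·|det(Aη₁, …, Aη_d, Fe₁, …, Fe_k)|, where A and F are the derivatives of q in the
base and fibre directions. Eliminating the k fibre columns by a Schur complement (`absDet_append`)
turns the integrand into a weight times |det(Bη₁, …, Bη_d)| with B : T_yY → ℝ^d linear. So Ω_y(η) =
∫ g(s) |det T_s(η)| ds for a bounded measurable family T_s, which is a `CosineData.density`.

Such a density is normal. For g ≥ 0, push g(s) ds × Lebesgue forward under (s, r) ↦ T_s⁻¹(r). The
result is translation invariant, and T_s⁻¹(r) meets the parallelotope of η exactly when r lies in
the image of the parallelotope, which has volume |det T_s(η)|. A signed g is split into its positive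
and negative parts. Since T⁻¹(r) ∩ T'⁻¹(r') = (T, T')⁻¹(r, r'), Fubini shows that the product of two
such densities belongs to the family of joined maps (T_s, T'_s') with multiplied weights
(`CosineData.mulDensity_density`).

This computation uses particular representing measures, whereas the product in 𝔫(V) takes arbitrary
ones, so Ker χ must be an ideal (`mulDensity_chi`). For ν-almost every H, the G such that G ∩ H
meets a parallelotope P are, up to a null set, the G that meet H ∩ P. That set lies in a flat of
dimension at most p, and on p-flats a normal measure is Lebesgue measure times a value of its
density χ(μ) (`IsNormalMeasure.hitting_flat`). Similarly, the fibre integral is defined by an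
arbitrary decomposition, and `IsParam.integralOver_eq` removes that choice.

For the product fibration the fibre is the product of the fibres and the maps are stacked. The fibre
columns are then block diagonal over the factors, so the elimination is carried out factor by factor
(`absDet_stackMap_append`). Hence Ω_y is the density of the product family, which is also Ω₁⋯Ωₙ at y
(`LocalData.exists_pi_density_eq`). -/

noncomputable section

namespace NormalDensity

open Topology Filter

/-! ### Topology of the affine Grassmannian in the coordinates (f, r) ↦ f⁻¹(r). -/

section AffineGrassmannian

variable {V : Type*} [NormedAddCommGroup V] [NormedSpace ℝ V] {m p q : ℕ}

variable (V) in
/-- The surjective continuous linear maps `V → ℝ^m`. -/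
abbrev Surj (m : ℕ) := {f : V →L[ℝ] (Fin m → ℝ) // Function.Surjective f}

/-- The affine subspace `f⁻¹(r)`. -/
def fiber (z : Surj V m × (Fin m → ℝ)) : AGr V m := AGr.ofKer (z.1, (z.1.2 z.2).choose)

theorem mem_ofKer {z : Surj V m × V} {x : V} : x ∈ (AGr.ofKer z).1 ↔ z.1.1 x = z.1.1 z.2 := by
  simp [AGr.ofKer, AffineSubspace.mem_mk', sub_eq_zero]

theorem mem_fiber {z : Surj V m × (Fin m → ℝ)} {x : V} : x ∈ (fiber z).1 ↔ z.1.1 x = z.2 := by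
  rw [fiber, mem_ofKer, (z.1.2 z.2).choose_spec]

theorem AGr.ext {G H : AGr V m} (h : ∀ x, x ∈ G.1 ↔ x ∈ H.1) : G = H :=
  Subtype.ext (AffineSubspace.ext h)

theorem ofKer_eq_fiber (z : Surj V m × V) : AGr.ofKer z = fiber (z.1, z.1.1 z.2) :=
  AGr.ext fun x => by rw [mem_ofKer, mem_fiber]

theorem direction_fiber (z : Surj V m × (Fin m → ℝ)) :
    (fiber z).1.direction = LinearMap.ker (z.1.1 : V →ₗ[ℝ] (Fin m → ℝ)) := by
  rw [fiber, AGr.ofKer, AffineSubspace.direction_mk']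

theorem Surj.exists_rightInverse (f : Surj V m) :
    ∃ R : (Fin m → ℝ) →L[ℝ] V, ∀ r, f.1 (R r) = r := by
  obtain ⟨R, hR⟩ := (f.1 : V →ₗ[ℝ] (Fin m → ℝ)).exists_rightInverse_of_surjective
    (LinearMap.range_eq_top.2 f.2)
  exact ⟨LinearMap.toContinuousLinearMap R, fun r => by simpa using LinearMap.congr_fun hR r⟩

theorem surjective_ofKer [FiniteDimensional ℝ V] : Function.Surjective (AGr.ofKer (V := V) (m := m)) := by
  rintro ⟨A, ⟨a, ha⟩, hA⟩
  have e : (V ⧸ A.direction) ≃ₗ[ℝ] (Fin m → ℝ) := LinearEquiv.ofFinrankEq _ _ (by simp [hA])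
  let f : V →ₗ[ℝ] (Fin m → ℝ) := e.toLinearMap ∘ₗ A.direction.mkQ
  have hf : Function.Surjective f := e.surjective.comp A.direction.mkQ_surjective
  refine ⟨(⟨LinearMap.toContinuousLinearMap f, hf⟩, a), AGr.ext fun x => ?_⟩
  rw [mem_ofKer]
  change f x = f a ↔ x ∈ A
  rw [← sub_eq_zero, ← map_sub]
  simp only [f, LinearMap.comp_apply, LinearEquiv.coe_coe, e.map_eq_zero_iff, Submodule.mkQ_apply,
    Submodule.Quotient.mk_eq_zero]
  rw [← vsub_eq_sub, AffineSubspace.vsub_right_mem_direction_iff_mem ha]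

theorem surjective_fiber [FiniteDimensional ℝ V] :
    Function.Surjective (fiber (V := V) (m := m)) := fun G => by
  obtain ⟨z, rfl⟩ := surjective_ofKer G
  exact ⟨_, (ofKer_eq_fiber z).symm⟩

/-- With R a right inverse of f₀, the map fR is invertible for f near f₀, so x₀ + R(fR)⁻¹(r − f x₀)
solves f x = r and depends continuously on (f, r). -/
theorem exists_section (f₀ : Surj V m) (x₀ : V) : ∃ s : Surj V m × (Fin m → ℝ) → V,
    ContinuousAt s (f₀, f₀.1 x₀) ∧ s (f₀, f₀.1 x₀) = x₀ ∧
      ∀ᶠ z in 𝓝 (f₀, f₀.1 x₀), z.1.1 (s z) = z.2 := by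
  obtain ⟨R, hR⟩ := f₀.exists_rightInverse
  let g : Surj V m × (Fin m → ℝ) → ((Fin m → ℝ) →L[ℝ] (Fin m → ℝ)) := fun z => z.1.1 ∘L R
  have hg : Continuous g := by fun_prop
  have hg₀ : g (f₀, f₀.1 x₀) = 1 := by ext1 r; exact hR r
  refine ⟨fun z => x₀ + R (Ring.inverse (g z) (z.2 - z.1.1 x₀)), ?_, by simp, ?_⟩
  · have h1 : ContinuousAt (fun z => Ring.inverse (g z)) (f₀, f₀.1 x₀) := by
      refine ContinuousAt.comp (g := Ring.inverse) ?_ hg.continuousAt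
      rw [hg₀]
      exact NormedRing.inverse_continuousAt 1
    have h2 : Continuous fun z : Surj V m × (Fin m → ℝ) => z.2 - z.1.1 x₀ := by fun_prop
    exact continuousAt_const.add (R.continuous.continuousAt.comp (h1.clm_apply h2.continuousAt))
  · have : {u | IsUnit u} ∈ 𝓝 (g (f₀, f₀.1 x₀)) :=
      Units.isOpen.mem_nhds (by rw [hg₀]; exact isUnit_one)
    filter_upwards [hg.continuousAt this] with z hz
    have : g z (Ring.inverse (g z) (z.2 - z.1.1 x₀)) = z.2 - z.1.1 x₀ := by
      rw [← mul_apply_eq_comp, Ring.mul_inverse_cancel _ hz]; rfl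
    rw [map_add]
    change _ + g z _ = _
    rw [this]; abel

theorem continuous_ofKer : Continuous (AGr.ofKer (V := V) (m := m)) := continuous_coinduced_rng

/-- The base point in `fiber` is an arbitrary choice, so continuity is not visible from the
definition. It follows because the local section gives the same subspace. -/
theorem continuous_fiber : Continuous (fiber (V := V) (m := m)) := by
  rw [continuous_iff_continuousAt]
  rintro ⟨f₀, r₀⟩
  obtain ⟨x₀, rfl⟩ := f₀.2 r₀
  obtain ⟨s, hs, hs₀, hev⟩ := exists_section f₀ x₀
  have : ContinuousAt (fun z => AGr.ofKer (z.1, s z)) (f₀, f₀.1 x₀) :=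
    continuous_ofKer.continuousAt.comp (continuousAt_fst.prodMk hs)
  refine this.congr (hev.mono fun z hz => ?_)
  simp only [ofKer_eq_fiber, hz]

/-- The classes identified by `fiber` are the GL_m-orbits: equal fibres have equal kernels, so one
map factors through the other. -/
theorem exists_equiv_of_fiber_eq {z w : Surj V m × (Fin m → ℝ)} (h : fiber z = fiber w) :
    ∃ A : (Fin m → ℝ) →L[ℝ] (Fin m → ℝ), Function.Surjective A ∧ w.1.1 = A ∘L z.1.1 ∧
      w.2 = A z.2 := by
  have hker : ∀ x, z.1.1 x = 0 → w.1.1 x = 0 := fun x hx => by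
    have : x ∈ (fiber z).1.direction := by rw [direction_fiber]; exact hx
    rw [h, direction_fiber] at this
    exact this
  obtain ⟨R, hR⟩ := z.1.exists_rightInverse
  have hA : w.1.1 = (w.1.1 ∘L R) ∘L z.1.1 := by
    ext1 x
    have := hker (x - R (z.1.1 x)) (by rw [map_sub, hR, sub_self])
    rw [map_sub, sub_eq_zero] at this
    exact this
  refine ⟨w.1.1 ∘L R, fun r => ?_, hA, ?_⟩
  · obtain ⟨x, rfl⟩ := w.1.2 r
    exact ⟨z.1.1 x, (DFunLike.congr_fun hA x).symm⟩
  · obtain ⟨x, hx⟩ := z.1.2 z.2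
    have h1 : x ∈ (fiber w).1 := by rw [← h]; exact mem_fiber.2 hx
    rw [← mem_fiber.1 h1, ← hx]
    exact DFunLike.congr_fun hA x

/-- Openness holds because the saturation of an open set is the union of its preimages under the
GL_m-action. Open quotient maps are stable under products, so topological questions on AGr^p × AGr^q
can also be checked in coordinates. -/
theorem isOpenQuotientMap_fiber [FiniteDimensional ℝ V] :
    IsOpenQuotientMap (fiber (V := V) (m := m)) := by
  refine ⟨surjective_fiber, continuous_fiber, fun U hU => ?_⟩
  have hquot : ∀ D : Set (AGr V m), IsOpen (fiber ⁻¹' D) → IsOpen D := fun D hD => by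
    change IsOpen (AGr.ofKer ⁻¹' D)
    have : AGr.ofKer ⁻¹' D =
        (fun z : Surj V m × V => (z.1, z.1.1 z.2)) ⁻¹' (fiber (V := V) ⁻¹' D) := by
      ext z; simp only [mem_preimage, ofKer_eq_fiber]
    rw [this]
    exact hD.preimage (by fun_prop)
  refine hquot _ ?_
  let Θ : {A : (Fin m → ℝ) →L[ℝ] (Fin m → ℝ) // Function.Surjective A} →
      Surj V m × (Fin m → ℝ) → Surj V m × (Fin m → ℝ) :=
    fun A z => (⟨A.1 ∘L z.1.1, A.2.comp z.1.2⟩, A.1 z.2)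
  have hΘ : ∀ A, Continuous (Θ A) := fun A => by
    refine Continuous.prodMk (Continuous.subtype_mk ?_ _) (by fun_prop)
    exact (continuous_const.clm_comp (continuous_subtype_val.comp continuous_fst))
  have hfib : ∀ A z, fiber (Θ A z) = fiber z := fun A z => AGr.ext fun x => by
    have hinj : Function.Injective A.1 :=
      (LinearMap.injective_iff_surjective (f := (A.1 : (Fin m → ℝ) →ₗ[ℝ] (Fin m → ℝ)))).2 A.2
    rw [mem_fiber, mem_fiber]
    exact hinj.eq_iff
  have : fiber ⁻¹' (fiber '' U) = ⋃ A, Θ A ⁻¹' U := by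
    ext z
    simp only [mem_preimage, mem_image, mem_iUnion]
    constructor
    · rintro ⟨w, hw, h⟩
      obtain ⟨A, hA, h1, h2⟩ := exists_equiv_of_fiber_eq h.symm
      refine ⟨⟨A, hA⟩, ?_⟩
      convert hw
      exact Prod.ext (Subtype.ext h1.symm) h2.symm
    · rintro ⟨A, hA⟩
      exact ⟨_, hA, hfib A z⟩
  rw [this]
  exact isOpen_iUnion fun A => hU.preimage (hΘ A)

instance [FiniteDimensional ℝ V] : SecondCountableTopology (AGr V m) := by
  have : ProperSpace (V →L[ℝ] (Fin m → ℝ)) := FiniteDimensional.proper ℝ _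
  have h := isOpenQuotientMap_fiber (V := V) (m := m)
  exact h.isQuotientMap.secondCountableTopology h.isOpenMap

instance : BorelSpace (AGr V m) := ⟨rfl⟩

theorem isOpen_surjective : IsOpen {f : V →L[ℝ] (Fin m → ℝ) | Function.Surjective f} := by
  rw [isOpen_iff_mem_nhds]
  intro f₀ hf₀
  obtain ⟨R, hR⟩ := Surj.exists_rightInverse ⟨f₀, hf₀⟩
  let g : (V →L[ℝ] (Fin m → ℝ)) → ((Fin m → ℝ) →L[ℝ] (Fin m → ℝ)) := fun f => f ∘L R
  have hg : Continuous g := by fun_prop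
  have hg₀ : g f₀ = 1 := by ext1 r; exact hR r
  have : {u | IsUnit u} ∈ 𝓝 (g f₀) := Units.isOpen.mem_nhds (by rw [hg₀]; exact isUnit_one)
  filter_upwards [hg.continuousAt this] with f hf r
  refine ⟨R (Ring.inverse (g f) r), ?_⟩
  change g f _ = _
  rw [← mul_apply_eq_comp, Ring.mul_inverse_cancel _ hf]; rfl

theorem mem_hitting_fiber {z : Surj V m × (Fin m → ℝ)} {D : Set V} :
    fiber z ∈ hitting m D ↔ z.2 ∈ z.1.1 '' D := by
  simp only [hitting, mem_ofPred_eq, Set.Nonempty, mem_inter_iff, SetLike.mem_coe, mem_fiber,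
    mem_image]
  exact ⟨fun ⟨x, h1, h2⟩ => ⟨x, h2, h1⟩, fun ⟨x, h1, h2⟩ => ⟨x, h2, h1⟩⟩

theorem hitting_mono {C D : Set V} (h : C ⊆ D) : hitting m C ⊆ hitting m D :=
  fun _ hG => hG.mono (inter_subset_inter_right _ h)

theorem isOpen_hitting [FiniteDimensional ℝ V] {U : Set V} (hU : IsOpen U) :
    IsOpen (hitting m U) := by
  rw [← isOpenQuotientMap_fiber.isQuotientMap.isOpen_preimage, isOpen_iff_mem_nhds]
  rintro ⟨f₀, r₀⟩ h
  obtain ⟨x₀, hx₀, hr⟩ := mem_hitting_fiber.1 h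
  obtain rfl : f₀.1 x₀ = r₀ := hr
  obtain ⟨s, hs, hs₀, hev⟩ := exists_section f₀ x₀
  have : U ∈ 𝓝 (s (f₀, f₀.1 x₀)) := by rw [hs₀]; exact hU.mem_nhds hx₀
  filter_upwards [hev, hs this] with z hz hzU
  exact mem_hitting_fiber.2 ⟨_, hzU, hz⟩

theorem isClosed_setOf_exists {Z K : Type*} [TopologicalSpace Z] [TopologicalSpace K]
    [CompactSpace K] {P : Z → K → Prop} (h : IsClosed {z : Z × K | P z.1 z.2}) :
    IsClosed {z | ∃ k, P z k} := by
  convert! isClosedMap_fst_of_compactSpace _ h using 1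
  ext z; simp

theorem isClosed_hitting [FiniteDimensional ℝ V] {K : Set V} (hK : IsCompact K) :
    IsClosed (hitting m K) := by
  rw [← isOpenQuotientMap_fiber.isQuotientMap.isClosed_preimage]
  have : CompactSpace K := isCompact_iff_compactSpace.1 hK
  convert! isClosed_setOf_exists (Z := Surj V m × (Fin m → ℝ)) (K := K)
    (P := fun z k => z.1.1 k = z.2) (isClosed_eq (by fun_prop) (by fun_prop)) using 1
  ext z
  rw [mem_preimage, mem_hitting_fiber]
  simp

/-- In Euclidean coordinates every G is a level set of a coisometry, namely the orthogonal
projection onto the complement of its direction. These maps lie in a compact family, and the base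
point can be taken in K. -/
theorem isCompact_hitting [FiniteDimensional ℝ V] {K : Set V} (hK : IsCompact K) :
    IsCompact (hitting m K) := by
  let n := finrank ℝ V
  let E := EuclideanSpace ℝ (Fin n)
  let e : V ≃L[ℝ] E := ContinuousLinearEquiv.ofFinrankEq (by simp [E, n])
  let N := EuclideanSpace ℝ (Fin m)
  let ε : N ≃L[ℝ] (Fin m → ℝ) := EuclideanSpace.equiv (Fin m) ℝ
  have : ProperSpace (E →L[ℝ] N) := FiniteDimensional.proper ℝ _
  have : ProperSpace (N →L[ℝ] E) := FiniteDimensional.proper ℝ _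
  -- Surjectivity alone is not a closed condition. Carrying along a right inverse of norm at most 1
  -- makes it closed, and hence C compact.
  let C : Set ((E →L[ℝ] N) × (N →L[ℝ] E)) :=
    (Metric.closedBall 0 1 ×ˢ Metric.closedBall 0 1) ∩ {g | g.1 ∘L g.2 = ContinuousLinearMap.id ℝ N}
  have hC : IsCompact C := by
    refine ((isCompact_closedBall _ _).prod (isCompact_closedBall _ _)).inter_right ?_
    exact isClosed_eq (continuous_fst.clm_comp continuous_snd) continuous_const
  let L : (E →L[ℝ] N) × (N →L[ℝ] E) → (V →L[ℝ] (Fin m → ℝ)) := fun g =>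
    (ε : N →L[ℝ] (Fin m → ℝ)) ∘L g.1 ∘L (e : V →L[ℝ] E)
  have hL : Continuous L :=
    continuous_const.clm_comp (continuous_fst.clm_comp continuous_const)
  have hsurj : ∀ g ∈ C, Function.Surjective (L g) := fun g hg r => by
    refine ⟨e.symm (g.2 (ε.symm r)), ?_⟩
    have := DFunLike.congr_fun hg.2 (ε.symm r)
    simp only [ContinuousLinearMap.comp_apply, ContinuousLinearMap.id_apply] at this
    simp [L, this]
  have hcomp : IsCompact {f : Surj V m | f.1 ∈ L '' C} := by
    refine Topology.IsInducing.subtypeVal.isCompact_iff.2 ?_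
    convert! hC.image hL using 1
    ext f
    constructor
    · rintro ⟨f, h, rfl⟩; exact h
    · rintro ⟨g, hg, rfl⟩; exact ⟨⟨L g, hsurj g hg⟩, ⟨g, hg, rfl⟩, rfl⟩
  have himg := (hcomp.prod hK).image (continuous_ofKer (V := V) (m := m))
  convert! himg using 1
  ext G
  constructor
  · rintro ⟨x, hxG, hxK⟩
    obtain ⟨⟨f, v⟩, rfl⟩ := surjective_ofKer G
    let W : Submodule ℝ E := (LinearMap.ker (f.1 : V →ₗ[ℝ] (Fin m → ℝ))).map (e : V →ₗ[ℝ] E)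
    have hW : finrank ℝ Wᗮ = m := by
      have h1 := W.finrank_add_finrank_orthogonal
      have h2 : finrank ℝ W = finrank ℝ (LinearMap.ker (f.1 : V →ₗ[ℝ] (Fin m → ℝ))) :=
        LinearEquiv.finrank_map_eq e.toLinearEquiv _
      have h3 := (f.1 : V →ₗ[ℝ] (Fin m → ℝ)).finrank_range_add_finrank_ker
      rw [LinearMap.range_eq_top.2 f.2, finrank_top] at h3
      have h4 : finrank ℝ E = finrank ℝ V := e.toLinearEquiv.finrank_eq.symm
      rw [h2, h4] at h1
      rw [finrank_fin_fun] at h3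
      omega
    let b : OrthonormalBasis (Fin m) ℝ Wᗮ := (stdOrthonormalBasis ℝ Wᗮ).reindex (finCongr hW)
    let g1 : E →L[ℝ] N :=
      (b.repr.toContinuousLinearEquiv : Wᗮ →L[ℝ] N) ∘L Wᗮ.orthogonalProjectionOnto
    let g2 : N →L[ℝ] E := Wᗮ.subtypeL ∘L (b.repr.symm.toContinuousLinearEquiv : N →L[ℝ] Wᗮ)
    have hg : (g1, g2) ∈ C := by
      refine ⟨⟨?_, ?_⟩, ?_⟩
      · rw [mem_closedBall_zero_iff]
        refine ContinuousLinearMap.opNorm_le_bound _ zero_le_one fun x => ?_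
        have : ‖g1 x‖ = ‖Wᗮ.orthogonalProjectionOnto x‖ := b.repr.norm_map _
        rw [this, one_mul]
        exact Wᗮ.norm_orthogonalProjectionOnto_apply_le x
      · rw [mem_closedBall_zero_iff]
        refine ContinuousLinearMap.opNorm_le_bound _ zero_le_one fun x => ?_
        have : ‖g2 x‖ = ‖x‖ := b.repr.symm.norm_map _
        rw [this, one_mul]
      · ext1 x
        simp [g1, g2]
    refine ⟨(⟨L (g1, g2), hsurj _ hg⟩, x), ⟨⟨_, hg, rfl⟩, hxK⟩, ?_⟩
    have hker : ∀ y : V, L (g1, g2) y = 0 ↔ f.1 y = 0 := fun y => by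
      have : L (g1, g2) y = 0 ↔ Wᗮ.orthogonalProjectionOnto (e y) = 0 := by
        simp [L, g1]
      rw [this, Submodule.orthogonalProjectionOnto_eq_zero_iff, Submodule.orthogonal_orthogonal]
      constructor
      · rintro ⟨y', hy', h⟩
        have : y' = y := e.injective h
        rw [← this]; exact hy'
      · intro h; exact ⟨y, h, rfl⟩
    refine AGr.ext fun y => ?_
    rw [mem_ofKer, mem_ofKer, ← sub_eq_zero, ← map_sub]
    have hx := mem_ofKer.1 hxG
    change L (g1, g2) (y - x) = 0 ↔ _
    rw [hker, map_sub, sub_eq_zero, hx]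
  · rintro ⟨⟨f, x⟩, ⟨_, hx⟩, rfl⟩
    exact ⟨x, mem_ofKer.2 rfl, hx⟩

end AffineGrassmannian

/-! ### Intersection of affine subspaces and measurability of the product. -/

section Transversality

variable {V : Type*} [NormedAddCommGroup V] [NormedSpace ℝ V] {m p q : ℕ}

/-- The identification `ℝ^p × ℝ^q ≃ ℝ^m` for `p + q = m`. -/
def joinL (h : p + q = m) : ((Fin p → ℝ) × (Fin q → ℝ)) ≃L[ℝ] (Fin m → ℝ) :=
  ((LinearEquiv.sumArrowLequivProdArrow (Fin p) (Fin q) ℝ ℝ).symm ≪≫ₗ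
    LinearEquiv.funCongrLeft ℝ ℝ (finSumFinEquiv.trans (finCongr h)).symm).toContinuousLinearEquiv

theorem joinL_apply (h : p + q = m) (x : (Fin p → ℝ) × (Fin q → ℝ)) (a : Fin p ⊕ Fin q) :
    joinL h x (finSumFinEquiv.trans (finCongr h) a) = Sum.elim x.1 x.2 a := by
  have : joinL h x (finSumFinEquiv.trans (finCongr h) a) = Sum.elim x.1 x.2
      ((finSumFinEquiv.trans (finCongr h)).symm (finSumFinEquiv.trans (finCongr h) a)) := rfl
  rw [this, Equiv.symm_apply_apply]

theorem measurePreserving_joinL (h : p + q = m) :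
    MeasurePreserving (joinL h) (volume.prod volume) volume := by
  have h1 := (volume_measurePreserving_sumPiEquivProdPi (fun _ : Fin p ⊕ Fin q => ℝ)).symm
  have h2 := volume_measurePreserving_piCongrLeft (fun _ : Fin m => ℝ)
    (finSumFinEquiv.trans (finCongr h))
  convert! h2.comp h1 using 1
  ext x b
  obtain ⟨a, rfl⟩ := (finSumFinEquiv.trans (finCongr h)).surjective b
  rw [joinL_apply, Function.comp_apply, MeasurableEquiv.coe_piCongrLeft,
    Equiv.piCongrLeft_apply_apply]
  rcases a with a | a <;> rfl

/-- The map `(T, T') : V → ℝ^p × ℝ^q ≃ ℝ^m`. -/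
def joinMap (h : p + q = m) (T : V →L[ℝ] (Fin p → ℝ)) (T' : V →L[ℝ] (Fin q → ℝ)) :
    V →L[ℝ] (Fin m → ℝ) :=
  (joinL h : ((Fin p → ℝ) × (Fin q → ℝ)) →L[ℝ] (Fin m → ℝ)) ∘L T.prod T'

theorem continuous_joinMap (h : p + q = m) :
    Continuous fun x : (V →L[ℝ] (Fin p → ℝ)) × (V →L[ℝ] (Fin q → ℝ)) => joinMap h x.1 x.2 := by
  have : Continuous fun x : (V →L[ℝ] (Fin p → ℝ)) × (V →L[ℝ] (Fin q → ℝ)) => x.1.prod x.2 :=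
    (ContinuousLinearMap.prodₗᵢ ℝ : _ ≃ₗᵢ[ℝ] (V →L[ℝ] (Fin p → ℝ) × (Fin q → ℝ))).continuous
  exact continuous_const.clm_comp this

theorem joinMap_surjective_iff (h : p + q = m) {T : V →L[ℝ] (Fin p → ℝ)}
    {T' : V →L[ℝ] (Fin q → ℝ)} :
    Function.Surjective (joinMap h T T') ↔ Function.Surjective (T.prod T') := by
  rw [joinMap, ContinuousLinearMap.coe_comp]
  exact Function.Surjective.of_comp_iff' (joinL h).bijective _

theorem continuous_joinMap_val (h : p + q = m) :
    Continuous fun x : (Surj V p × (Fin p → ℝ)) × (Surj V q × (Fin q → ℝ)) =>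
      joinMap h x.1.1.1 x.2.1.1 := by
  have h1 : Continuous fun x : (Surj V p × (Fin p → ℝ)) × (Surj V q × (Fin q → ℝ)) =>
      (x.1.1.1, x.2.1.1) := by fun_prop
  exact (continuous_joinMap h).comp h1

/-- `G ∩ H` is nonempty of codimension `m`. -/
def IsTransversal (m : ℕ) (x : AGr V p × AGr V q) : Prop :=
  ((x.1.1 ⊓ x.2.1 : AffineSubspace ℝ V) : Set V).Nonempty ∧
    finrank ℝ (V ⧸ (x.1.1 ⊓ x.2.1).direction) = m

theorem mem_inf_fiber {z : Surj V p × (Fin p → ℝ)} {w : Surj V q × (Fin q → ℝ)} {x : V} :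
    x ∈ (fiber z).1 ⊓ (fiber w).1 ↔ z.1.1.prod w.1.1 x = (z.2, w.2) := by
  rw [AffineSubspace.mem_inf_iff, mem_fiber, mem_fiber, ContinuousLinearMap.prod_apply,
    Prod.mk.injEq]

theorem direction_inf_fiber {z : Surj V p × (Fin p → ℝ)} {w : Surj V q × (Fin q → ℝ)} {x : V}
    (h : x ∈ (fiber z).1 ⊓ (fiber w).1) : ((fiber z).1 ⊓ (fiber w).1).direction =
      LinearMap.ker (z.1.1.prod w.1.1 : V →ₗ[ℝ] (Fin p → ℝ) × (Fin q → ℝ)) := by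
  rw [AffineSubspace.direction_inf_of_mem h.1 h.2, direction_fiber, direction_fiber]
  ext y; simp

/-- The intersection has direction ker(f, f'), whose codimension is the rank of (f, f'). Full rank
also forces the intersection to be nonempty, so the levels r, r' play no role. -/
theorem isTransversal_fiber_iff (h : p + q = m) {z : Surj V p × (Fin p → ℝ)}
    {w : Surj V q × (Fin q → ℝ)} :
    IsTransversal m (fiber z, fiber w) ↔ Function.Surjective (joinMap h z.1.1 w.1.1) := by
  rw [joinMap_surjective_iff]
  let L : V →ₗ[ℝ] (Fin p → ℝ) × (Fin q → ℝ) := (z.1.1.prod w.1.1 : V →L[ℝ] _)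
  have hfin : finrank ℝ ((Fin p → ℝ) × (Fin q → ℝ)) = m := by simp [h]
  constructor
  · rintro ⟨⟨x, hx⟩, hf⟩
    rw [direction_inf_fiber hx, (LinearMap.quotKerEquivRange L).finrank_eq, ← hfin] at hf
    exact LinearMap.range_eq_top.1 (Submodule.eq_top_of_finrank_eq hf)
  · intro hs
    obtain ⟨x, hx⟩ := hs (z.2, w.2)
    have hx' : x ∈ (fiber z).1 ⊓ (fiber w).1 := mem_inf_fiber.2 hx
    refine ⟨⟨x, hx'⟩, ?_⟩
    change finrank ℝ (V ⧸ ((fiber z).1 ⊓ (fiber w).1).direction) = m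
    rw [direction_inf_fiber hx', (LinearMap.quotKerEquivOfSurjective L hs).finrank_eq, hfin]

variable [FiniteDimensional ℝ V]

theorem isOpenQuotientMap_fiber_prod : IsOpenQuotientMap
    (Prod.map (fiber (V := V) (m := p)) (fiber (V := V) (m := q))) :=
  isOpenQuotientMap_fiber.prodMap isOpenQuotientMap_fiber

theorem isOpen_isTransversal (h : p + q = m) :
    IsOpen {x : AGr V p × AGr V q | IsTransversal m x} := by
  rw [← isOpenQuotientMap_fiber_prod.isQuotientMap.isOpen_preimage]
  convert! isOpen_surjective.preimage (continuous_joinMap_val (V := V) h) using 1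
  ext x
  exact isTransversal_fiber_iff h

theorem measurableEmbedding_transversal (h : p + q = m) :
    MeasurableEmbedding (Subtype.val : Transversal V p q m → AGr V p × AGr V q) :=
  MeasurableEmbedding.subtype_coe (isOpen_isTransversal h).measurableSet

/-- `Measure.map` along a map that is not a.e. measurable is zero by default, so `mulMeasure` has
its intended meaning only through this fact. In coordinates the intersection is a fibre of the
joined map, which varies continuously on the open transversal set. -/
theorem measurable_inter (h : p + q = m) :
    Measurable (Transversal.inter : Transversal V p q m → AGr V m) := by
  refine measurable_of_isOpen fun U hU => ?_
  have hopen : IsOpen ((Subtype.val : Transversal V p q m → AGr V p × AGr V q) ''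
      (Transversal.inter ⁻¹' U)) := by
    rw [← isOpenQuotientMap_fiber_prod.isQuotientMap.isOpen_preimage]
    let P : Set ((Surj V p × (Fin p → ℝ)) × (Surj V q × (Fin q → ℝ))) :=
      {x | Function.Surjective (joinMap h x.1.1.1 x.2.1.1)}
    have hP : IsOpen P := isOpen_surjective.preimage (continuous_joinMap_val h)
    let J : P → AGr V m := fun x =>
      fiber (⟨joinMap h x.1.1.1.1 x.1.2.1.1, x.2⟩, joinL h (x.1.1.2, x.1.2.2))
    have hJ : Continuous J := by
      refine continuous_fiber.comp (Continuous.prodMk (Continuous.subtype_mk ?_ _) (by fun_prop))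
      exact (continuous_joinMap_val h).comp continuous_subtype_val
    have hJU := hP.isOpenMap_subtype_val _ (hU.preimage hJ)
    convert! hJU using 1
    have key : ∀ (z : Surj V p × (Fin p → ℝ)) (w : Surj V q × (Fin q → ℝ))
        (ht : IsTransversal m (fiber z, fiber w)) (hs : (z, w) ∈ P),
        Transversal.inter (⟨(fiber z, fiber w), ht⟩ : Transversal V p q m) = J ⟨(z, w), hs⟩ := by
      intro z w ht hs
      refine AGr.ext fun x => ?_
      change x ∈ (fiber z).1 ⊓ (fiber w).1 ↔ _
      rw [mem_inf_fiber, mem_fiber]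
      exact (joinL h).injective.eq_iff.symm
    ext ⟨z, w⟩
    constructor
    · rintro ⟨⟨x, hx⟩, hxU, rfl⟩
      have hs := (isTransversal_fiber_iff h).1 hx
      exact ⟨⟨(z, w), hs⟩, by rw [mem_preimage, ← key z w hx hs]; exact hxU, rfl⟩
    · rintro ⟨⟨_, hs⟩, hxU, rfl⟩
      have hx := (isTransversal_fiber_iff h).2 hs
      exact ⟨⟨(fiber z, fiber w), hx⟩, by
        change Transversal.inter _ ∈ U
        exact (key z w hx hs).symm ▸ hxU, rfl⟩
  exact ((measurableEmbedding_transversal h).measurableSet_image).1 hopen.measurableSet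

theorem mulMeasure_hitting (h : p + q = m) (μ : Measure (AGr V p)) (ν : Measure (AGr V q))
    {K : Set V} (hK : IsCompact K) : mulMeasure μ ν m (hitting m K) =
      μ.prod ν {x | IsTransversal m x ∧ (((x.1.1 : Set V) ∩ x.2.1) ∩ K).Nonempty} := by
  refine (Measure.map_apply (measurable_inter h) (isClosed_hitting hK).measurableSet).trans ?_
  refine ((measurableEmbedding_transversal h).comap_apply _ _).trans ?_
  congr 1
  ext x
  constructor
  · rintro ⟨⟨x, hx⟩, hxU, rfl⟩; exact ⟨hx, hxU⟩
  · rintro ⟨hx, hxU⟩; exact ⟨⟨x, hx⟩, hxU, rfl⟩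

theorem isClosed_setOf_meet {K : Set V} (hK : IsCompact K) :
    IsClosed {x : AGr V p × AGr V q | (((x.1.1 : Set V) ∩ x.2.1) ∩ K).Nonempty} := by
  rw [← isOpenQuotientMap_fiber_prod.isQuotientMap.isClosed_preimage]
  have : CompactSpace K := isCompact_iff_compactSpace.1 hK
  convert! isClosed_setOf_exists
    (Z := (Surj V p × (Fin p → ℝ)) × (Surj V q × (Fin q → ℝ))) (K := K)
    (P := fun z k => z.1.1.1 k = z.1.2 ∧ z.2.1.1 k = z.2.2)
    ((isClosed_eq (by fun_prop) (by fun_prop)).inter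
      (isClosed_eq (by fun_prop) (by fun_prop))) using 1
  ext ⟨z, w⟩
  simp only [mem_preimage, Prod.map_apply, Set.Nonempty, mem_ofPred_eq, mem_inter_iff,
    SetLike.mem_coe, mem_fiber, Subtype.exists, exists_prop]
  exact ⟨fun ⟨x, h1, h2⟩ => ⟨x, h2, h1⟩, fun ⟨x, h1, h2⟩ => ⟨x, h2, h1⟩⟩

theorem measurableSet_transversal_meet (h : p + q = m) {K : Set V} (hK : IsCompact K) :
    MeasurableSet {x : AGr V p × AGr V q |
      IsTransversal m x ∧ (((x.1.1 : Set V) ∩ x.2.1) ∩ K).Nonempty} :=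
  (isOpen_isTransversal h).measurableSet.inter (isClosed_setOf_meet hK).measurableSet

end Transversality

/-! ### Normal measures on flats: transversality almost everywhere and proportionality to Lebesgue
measure. -/

section NormalMeasures

variable {V : Type*} [NormedAddCommGroup V] [NormedSpace ℝ V] {m p q : ℕ}

theorem mem_translate {v : V} {G : AGr V m} {x : V} :
    x ∈ (AGr.translate v G).1 ↔ x - v ∈ G.1 := by
  have h : x = v +ᵥ (x - v) := by rw [vadd_eq_add]; abel
  conv_lhs => rw [h]
  exact AffineSubspace.vadd_mem_pointwise_vadd_iff (v := v) (s := G.1) (p := x - v)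

theorem direction_translate (v : V) (G : AGr V m) :
    (AGr.translate v G).1.direction = G.1.direction :=
  AffineSubspace.pointwise_vadd_direction v G.1

theorem translate_mem_hitting {v : V} {G : AGr V m} {D : Set V} :
    AGr.translate v G ∈ hitting m D ↔ G ∈ hitting m (-v +ᵥ D) := by
  constructor
  · rintro ⟨x, hx, hxD⟩
    refine ⟨x - v, mem_translate.1 hx, ?_⟩
    rw [mem_vadd_set_iff_neg_vadd_mem]
    simpa using hxD
  · rintro ⟨x, hx, hxD⟩
    refine ⟨x + v, mem_translate.2 (by simpa using hx), ?_⟩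
    rw [mem_vadd_set_iff_neg_vadd_mem] at hxD
    simpa [add_comm] using hxD

theorem translate_fiber (v : V) (z : Surj V m × (Fin m → ℝ)) :
    AGr.translate v (fiber z) = fiber (z.1, z.2 + z.1.1 v) :=
  AGr.ext fun x => by
    rw [mem_translate, mem_fiber, mem_fiber, map_sub, sub_eq_iff_eq_add]

theorem exists_mem_hitting_ball (G : AGr V m) : ∃ n : ℕ, G ∈ hitting m (Metric.ball (0 : V) n) := by
  obtain ⟨x, hx⟩ := G.2.1
  obtain ⟨n, hn⟩ := exists_nat_gt ‖x‖
  exact ⟨n, x, hx, by simpa using hn⟩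

theorem isCompact_parallelepiped {ι : Type*} [Fintype ι] (ξ : ι → V) :
    IsCompact (parallelepiped ξ) :=
  isCompact_Icc.image (by fun_prop)

theorem parallelepiped_comp_single (ψ : (Fin p → ℝ) →L[ℝ] V) :
    parallelepiped (fun i => ψ (Pi.single i 1)) = ψ '' Icc 0 1 := by
  refine image_congr fun t _ => ?_
  conv_rhs => rw [pi_eq_sum_univ' t, map_sum]
  simp only [map_smul]

theorem sup_eq_top_iff {z : Surj V m × (Fin m → ℝ)} {W : Submodule ℝ V} :
    (fiber z).1.direction ⊔ W = ⊤ ↔ Function.Surjective (z.1.1 ∘L W.subtypeL) := by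
  rw [direction_fiber, sup_comm, ← codisjoint_iff]
  exact (LinearMap.surjective_domRestrict_iff
    (f := (z.1.1 : V →ₗ[ℝ] (Fin m → ℝ))) (S := W) z.1.2).symm

variable [FiniteDimensional ℝ V]

theorem finrank_direction_add (G : AGr V m) : finrank ℝ G.1.direction + m = finrank ℝ V := by
  have := Submodule.finrank_quotient_add_finrank G.1.direction
  rw [G.2.2] at this
  omega

theorem IsNormalMeasure.hitting_lt_top {μ : Measure (AGr V m)} (hμ : IsNormalMeasure μ)
    {K : Set V} (hK : IsCompact K) : μ (hitting m K) < ⊤ :=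
  hμ.finite_on_compacts _ (isCompact_hitting hK)

theorem IsNormalMeasure.sigmaFinite {μ : Measure (AGr V m)} (hμ : IsNormalMeasure μ) :
    SigmaFinite μ := by
  have : ProperSpace V := FiniteDimensional.proper_real V
  have : IsLocallyFiniteMeasure μ := ⟨fun G => by
    obtain ⟨n, hn⟩ := exists_mem_hitting_ball G
    refine ⟨_, (isOpen_hitting Metric.isOpen_ball).mem_nhds hn, ?_⟩
    exact (measure_mono (hitting_mono Metric.ball_subset_closedBall)).trans_lt
      (hμ.hitting_lt_top (isCompact_closedBall (0 : V) n))⟩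
  infer_instance

theorem isOpen_sup_eq_top (W : Submodule ℝ V) :
    IsOpen {G : AGr V m | G.1.direction ⊔ W = ⊤} := by
  rw [← isOpenQuotientMap_fiber.isQuotientMap.isOpen_preimage]
  have h : Continuous fun z : Surj V m × (Fin m → ℝ) => z.1.1 ∘L W.subtypeL :=
    (continuous_subtype_val.comp continuous_fst).clm_comp continuous_const
  convert! isOpen_surjective.preimage h using 1
  ext z
  exact sup_eq_top_iff

theorem isClosed_setOf_vadd_hitting {U : Type*} [NormedAddCommGroup U] [NormedSpace ℝ U]
    (φ : U →L[ℝ] V) {K : Set V} (hK : IsCompact K) :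
    IsClosed {x : U × AGr V m | x.2 ∈ hitting m (φ x.1 +ᵥ K)} := by
  have hq : IsOpenQuotientMap (Prod.map (id : U → U) (fiber (V := V) (m := m))) :=
    IsOpenQuotientMap.id.prodMap isOpenQuotientMap_fiber
  rw [← hq.isQuotientMap.isClosed_preimage]
  have : CompactSpace K := isCompact_iff_compactSpace.1 hK
  convert! isClosed_setOf_exists (Z := U × (Surj V m × (Fin m → ℝ))) (K := K)
    (P := fun z k => z.2.1.1 (φ z.1 + k) = z.2.2) (isClosed_eq (by fun_prop) (by fun_prop)) using 1
  ext ⟨v, z⟩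
  simp only [mem_preimage, Prod.map_apply, id_eq, mem_ofPred_eq, mem_hitting_fiber, mem_image,
    Subtype.exists, exists_prop]
  constructor
  · rintro ⟨_, ⟨k, hk, rfl⟩, h⟩; exact ⟨k, hk, h⟩
  · rintro ⟨k, hk, h⟩; exact ⟨_, ⟨k, hk, rfl⟩, h⟩

/-- Almost every affine subspace meeting a bounded piece of a translate of `W` is transversal
to `W`. -/
theorem IsNormalMeasure.measure_not_transversal {μ : Measure (AGr V m)} (hμ : IsNormalMeasure μ)
    (W : Submodule ℝ V) {K : Set V} (hK : IsCompact K) (x₀ : V) (hKW : ∀ x ∈ K, x - x₀ ∈ W) :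
    μ {G | G ∈ hitting m K ∧ G.1.direction ⊔ W ≠ ⊤} = 0 := by
  have := hμ.sigmaFinite
  have : ProperSpace V := FiniteDimensional.proper_real V
  let _ : MeasurableSpace V := borel V
  have : BorelSpace V := ⟨rfl⟩
  let vol : Measure V := Measure.addHaar
  let Z : Set (V × AGr V m) :=
    {x | x.2 ∈ hitting m (ContinuousLinearMap.id ℝ V x.1 +ᵥ K)} ∩
      Prod.snd ⁻¹' {G : AGr V m | G.1.direction ⊔ W = ⊤}ᶜ
  have hZ : MeasurableSet Z := (isClosed_setOf_vadd_hitting _ hK).measurableSet.inter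
    (measurable_snd (isOpen_sup_eq_top W).measurableSet.compl)
  have hN : MeasurableSet {G | G ∈ hitting m K ∧ G.1.direction ⊔ W ≠ ⊤} :=
    (isClosed_hitting hK).measurableSet.inter (isOpen_sup_eq_top W).measurableSet.compl
  -- Average over all translates v + K. By invariance every slice in v has the same measure. For
  -- fixed nontransversal G, the admissible v lie in a translate of the proper subspace dir G + W,
  -- which is Haar null. As vol V ≠ 0, the common value must be 0.
  have h1 : vol.prod μ Z = μ {G | G ∈ hitting m K ∧ G.1.direction ⊔ W ≠ ⊤} * vol univ := by
    rw [Measure.prod_apply hZ, ← lintegral_const]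
    refine lintegral_congr fun v => ?_
    rw [← hμ.translation_invariant (-v) _ hN]
    congr 1
    ext G
    simp only [Z, mem_preimage, mem_inter_iff, mem_ofPred_eq, mem_compl_iff,
      translate_mem_hitting, direction_translate, neg_neg]
    rfl
  have h2 : vol.prod μ Z = 0 := by
    rw [Measure.prod_apply_symm hZ, lintegral_eq_zero_iff' (measurable_measure_prodMk_right hZ).aemeasurable]
    refine Filter.Eventually.of_forall fun G => ?_
    by_cases hG : G.1.direction ⊔ W = ⊤
    · convert! measure_empty (μ := vol)
      ext v
      simp [Z, hG]
    · obtain ⟨g, hg⟩ := G.2.1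
      refine measure_mono_null ?_ (Measure.addHaar_affineSubspace vol
        (AffineSubspace.mk' (g - x₀) (G.1.direction ⊔ W)) ?_)
      · rintro v ⟨⟨_, hx, k, hk, rfl⟩, -⟩
        rw [SetLike.mem_coe, AffineSubspace.mem_mk']
        have h3 : (v + k) -ᵥ g ∈ G.1.direction := AffineSubspace.vsub_mem_direction hx hg
        have h4 := Submodule.sub_mem _ (Submodule.mem_sup_left (T := W) h3)
          (Submodule.mem_sup_right (hKW k hk))
        convert! h4 using 1
        simp only [vsub_eq_sub]; abel
      · intro h
        apply hG
        rw [← AffineSubspace.direction_mk' (g - x₀) (G.1.direction ⊔ W), h,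
          AffineSubspace.direction_top]
  rw [h1, mul_eq_zero] at h2
  exact h2.resolve_right (NeZero.ne _)

theorem exists_unique_param {G : AGr V p} {ψ : (Fin p → ℝ) →L[ℝ] V}
    (hG : G.1.direction ⊔ LinearMap.range (ψ : (Fin p → ℝ) →ₗ[ℝ] V) = ⊤) :
    ∃ u, ∀ w, ψ w ∈ G.1 ↔ w = u := by
  obtain ⟨z, rfl⟩ := surjective_fiber G
  rw [sup_eq_top_iff] at hG
  let B : (Fin p → ℝ) →ₗ[ℝ] (Fin p → ℝ) := (z.1.1 ∘L ψ : (Fin p → ℝ) →L[ℝ] (Fin p → ℝ))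
  have hB : Function.Surjective B := fun r => by
    obtain ⟨⟨_, w, rfl⟩, hw⟩ := hG r
    exact ⟨w, hw⟩
  have hB' := LinearMap.injective_iff_surjective.2 hB
  obtain ⟨u, hu⟩ := hB z.2
  refine ⟨u, fun w => ?_⟩
  rw [mem_fiber, ← hu]
  exact hB'.eq_iff

/-- This is the uniqueness argument for invariant measures. Consider the pairs (v, G) such that a
transversal G meets both ψ(A) and ψ(v) + ψ(B). Since G meets the range of ψ at one parameter u, the
slice over G is u − B, and the total is the left side. Translating by ψ(v) and replacing v by −v
interchanges A and B. -/
theorem IsNormalMeasure.hitting_mul_volume_comm {μ : Measure (AGr V p)} (hμ : IsNormalMeasure μ)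
    (ψ : (Fin p → ℝ) →L[ℝ] V) {A B : Set (Fin p → ℝ)} (hA : IsCompact A) (hB : IsCompact B) :
    μ (hitting p (ψ '' A)) * volume B = μ (hitting p (ψ '' B)) * volume A := by
  have := hμ.sigmaFinite
  let D : Set (AGr V p) := {G | G.1.direction ⊔ LinearMap.range (ψ : (Fin p → ℝ) →ₗ[ℝ] V) = ⊤}
  have hD : MeasurableSet D := (isOpen_sup_eq_top _).measurableSet
  let Z : Set (Fin p → ℝ) → Set (Fin p → ℝ) → Set ((Fin p → ℝ) × AGr V p) := fun A B =>
    Prod.snd ⁻¹' (hitting p (ψ '' A) ∩ D) ∩ {x | x.2 ∈ hitting p (ψ x.1 +ᵥ ψ '' B)}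
  have hZ : ∀ A B, IsCompact A → IsCompact B → MeasurableSet (Z A B) := fun A B hA hB =>
    (measurable_snd ((isClosed_hitting (hA.image ψ.continuous)).measurableSet.inter hD)).inter
      (isClosed_setOf_vadd_hitting ψ (hB.image ψ.continuous)).measurableSet
  have hnull : ∀ A, IsCompact A → μ (hitting p (ψ '' A) ∩ D) = μ (hitting p (ψ '' A)) := by
    intro A hA
    rw [← measure_inter_add_sdiff (hitting p (ψ '' A)) hD]
    refine (add_zero _).symm.trans (congrArg _ (Eq.symm ?_))
    exact hμ.measure_not_transversal _ (hA.image ψ.continuous) 0 (by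
      rintro _ ⟨a, -, rfl⟩
      rw [sub_zero]
      exact LinearMap.mem_range_self (ψ : (Fin p → ℝ) →ₗ[ℝ] V) a)
  have hmeas : ∀ A B, IsCompact A → IsCompact B →
      volume.prod μ (Z A B) = μ (hitting p (ψ '' A)) * volume B := by
    intro A B hA hB
    have hAD : MeasurableSet (hitting p (ψ '' A) ∩ D) :=
      (isClosed_hitting (hA.image ψ.continuous)).measurableSet.inter hD
    rw [Measure.prod_apply_symm (hZ A B hA hB), ← hnull A hA, mul_comm, ← lintegral_indicator_const hAD]
    refine lintegral_congr fun G => ?_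
    by_cases hG : G ∈ hitting p (ψ '' A) ∩ D
    · rw [indicator_of_mem hG]
      obtain ⟨u, hu⟩ := exists_unique_param hG.2
      have : (fun v => (v, G)) ⁻¹' Z A B = (fun v => u - v) ⁻¹' B := by
        ext v
        simp only [Z, mem_preimage, mem_inter_iff, hG, mem_ofPred_eq]
        constructor
        · rintro ⟨-, _, hx, _, ⟨b, hb, rfl⟩, rfl⟩
          have : ψ (v + b) ∈ G.1 := by rw [map_add]; exact hx
          rw [← (hu _).1 this, add_sub_cancel_left]
          exact hb
        · intro h
          refine ⟨trivial, ψ u, (hu u).2 rfl, ψ (u - v), ⟨_, h, rfl⟩, ?_⟩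
          simp
      rw [this]
      exact (Measure.measurePreserving_sub_left volume u).measure_preimage hB.measurableSet.nullMeasurableSet
    · rw [indicator_of_notMem hG]
      convert! measure_empty (μ := volume)
      ext v
      simp only [Z, mem_preimage, mem_inter_iff, mem_empty_iff_false, iff_false]
      exact fun h => hG h.1
  have hswap : volume.prod μ (Z A B) = volume.prod μ (Z B A) := by
    rw [Measure.prod_apply (hZ A B hA hB), Measure.prod_apply (hZ B A hB hA),
      ← (Measure.measurePreserving_neg (volume : Measure (Fin p → ℝ))).lintegral_comp
        (measurable_measure_prodMk_left (hZ B A hB hA))]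
    refine lintegral_congr fun v => ?_
    rw [← hμ.translation_invariant (ψ v) _ (measurable_prodMk_left (hZ A B hA hB))]
    congr 1
    ext G
    simp only [Z, D, mem_preimage, mem_inter_iff, mem_ofPred_eq, translate_mem_hitting,
      direction_translate, map_neg, vadd_vadd, neg_add_cancel, zero_vadd]
    tauto
  rw [← hmeas A B hA hB, ← hmeas B A hB hA, hswap]

/-- A normal measure restricted to a `p`-dimensional affine subspace is a multiple of the
Lebesgue measure. -/
theorem IsNormalMeasure.hitting_flat {μ : Measure (AGr V p)} (hμ : IsNormalMeasure μ)
    (ψ : (Fin p → ℝ) →L[ℝ] V) {A : Set (Fin p → ℝ)} (hA : IsCompact A) (x₀ : V) :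
    μ (hitting p (x₀ +ᵥ ψ '' A)) =
      μ (hitting p (parallelepiped fun i => ψ (Pi.single i 1))) * volume A := by
  have h1 : μ (hitting p (x₀ +ᵥ ψ '' A)) = μ (hitting p (ψ '' A)) := by
    rw [← hμ.translation_invariant (-x₀) _
      (isClosed_hitting (hA.image ψ.continuous)).measurableSet]
    congr 1
    ext G
    rw [mem_preimage, translate_mem_hitting, neg_neg]
  have h2 := hμ.hitting_mul_volume_comm ψ hA (isCompact_Icc (a := 0) (b := 1))
  rw [h1, parallelepiped_comp_single, ← h2, Real.volume_Icc_pi]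
  simp

end NormalMeasures

/-! ### Ker χ is an ideal, so the product of normal densities is well defined. -/

section ChiMul

variable {V : Type*} [NormedAddCommGroup V] [NormedSpace ℝ V] [FiniteDimensional ℝ V] {m p q : ℕ}

theorem isTransversal_of_sup_eq_top (h : p + q = m) {G : AGr V p} {H : AGr V q}
    (hne : ((G.1 : Set V) ∩ H.1).Nonempty) (hs : G.1.direction ⊔ H.1.direction = ⊤) :
    IsTransversal m (G, H) := by
  obtain ⟨x, hG, hH⟩ := hne
  refine ⟨⟨x, hG, hH⟩, ?_⟩
  change finrank ℝ (V ⧸ (G.1 ⊓ H.1).direction) = m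
  rw [AffineSubspace.direction_inf_of_mem hG hH]
  have h1 := Submodule.finrank_sup_add_finrank_inf_eq G.1.direction H.1.direction
  have h2 := Submodule.finrank_quotient_add_finrank (G.1.direction ⊓ H.1.direction)
  have h3 := finrank_direction_add G
  have h4 := finrank_direction_add H
  rw [hs, finrank_top] at h1
  omega

theorem chi_eq_iff {μ₁ μ₂ : Measure (AGr V p)} (h₁ : IsNormalMeasure μ₁) (h₂ : IsNormalMeasure μ₂)
    {ξ : Fin p → V} : chi μ₁ ξ = chi μ₂ ξ ↔
      μ₁ (hitting p (parallelepiped ξ)) = μ₂ (hitting p (parallelepiped ξ)) :=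
  ENNReal.toReal_eq_toReal_iff' (h₁.hitting_lt_top (isCompact_parallelepiped ξ)).ne
    (h₂.hitting_lt_top (isCompact_parallelepiped ξ)).ne

/-- The transversality condition can be dropped: a subspace G meeting H ∩ K that is transversal to
dir H ∩ W is transversal to H, and the remaining G form a null set. -/
theorem IsNormalMeasure.measure_transversal_meet {μ : Measure (AGr V p)} (hμ : IsNormalMeasure μ)
    (h : p + q = m) (H : AGr V q) {K : Set V} (hK : IsCompact K) {x₀ : V} (W : Submodule ℝ V)
    (hKW : ∀ x ∈ K, x - x₀ ∈ W) (hx₀ : x₀ ∈ H.1) :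
    μ {G | IsTransversal m (G, H) ∧ (((G.1 : Set V) ∩ H.1) ∩ K).Nonempty} =
      μ (hitting p ((H.1 : Set V) ∩ K)) := by
  have hc : IsCompact ((H.1 : Set V) ∩ K) := hK.inter_left (H.1.closed_of_finiteDimensional)
  refine le_antisymm (measure_mono fun G hG => by rw [hitting, mem_ofPred_eq, ← inter_assoc]; exact hG.2) ?_
  refine (measure_mono (t := {G | IsTransversal m (G, H) ∧
    (((G.1 : Set V) ∩ H.1) ∩ K).Nonempty} ∪ {G | G ∈ hitting p ((H.1 : Set V) ∩ K) ∧
      G.1.direction ⊔ (H.1.direction ⊓ W) ≠ ⊤}) fun G hG => ?_).trans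
    ((measure_union_le _ _).trans ?_)
  · by_cases hs : G.1.direction ⊔ (H.1.direction ⊓ W) = ⊤
    · left
      have hG' : (((G.1 : Set V) ∩ H.1) ∩ K).Nonempty := by rw [inter_assoc]; exact hG
      refine ⟨isTransversal_of_sup_eq_top h (hG'.mono inter_subset_left) ?_, hG'⟩
      rw [eq_top_iff, ← hs]
      exact sup_le_sup_left inf_le_left _
    · exact Or.inr ⟨hG, hs⟩
  · rw [hμ.measure_not_transversal _ hc x₀, add_zero]
    exact fun x hx => ⟨AffineSubspace.vsub_mem_direction hx.1 hx₀, hKW x hx.2⟩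

/-- For `H` transversal to the span of `ξ`, the measure of the set of the `G` such that `G ∩ H`
meets the parallelotope of `ξ` depends on the density of the measure only. -/
theorem measure_transversal_meet_congr {μ₁ μ₂ : Measure (AGr V p)} (h₁ : IsNormalMeasure μ₁)
    (h₂ : IsNormalMeasure μ₂) (hχ : chi μ₁ = chi μ₂) (h : p + q = m) (H : AGr V q)
    (ξ : Fin m → V) (hH : H ∈ hitting q (parallelepiped ξ) →
      H.1.direction ⊔ Submodule.span ℝ (range ξ) = ⊤) :
    μ₁ {G | IsTransversal m (G, H) ∧ (((G.1 : Set V) ∩ H.1) ∩ parallelepiped ξ).Nonempty} =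
      μ₂ {G | IsTransversal m (G, H) ∧ (((G.1 : Set V) ∩ H.1) ∩ parallelepiped ξ).Nonempty} := by
  by_cases hmeet : H ∈ hitting q (parallelepiped ξ)
  swap
  · have : {G : AGr V p | IsTransversal m (G, H) ∧
        (((G.1 : Set V) ∩ H.1) ∩ parallelepiped ξ).Nonempty} = ∅ := by
      ext G
      simp only [mem_ofPred_eq, mem_empty_iff_false, iff_false]
      rintro ⟨-, x, ⟨-, hx⟩, hx'⟩
      exact hmeet ⟨x, hx, hx'⟩
    rw [this, measure_empty, measure_empty]
  have hsup := hH hmeet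
  obtain ⟨x₀, hx₀, hx₀'⟩ := hmeet
  set W := Submodule.span ℝ (range ξ) with hW
  have hK := isCompact_parallelepiped ξ
  have hpW : ∀ x ∈ parallelepiped ξ, x ∈ W := by
    rintro _ ⟨t, -, rfl⟩
    exact W.sum_mem fun i _ => W.smul_mem _ (Submodule.subset_span (mem_range_self i))
  have hKW : ∀ x ∈ parallelepiped ξ, x - x₀ ∈ W := fun x hx => W.sub_mem (hpW x hx) (hpW x₀ hx₀')
  rw [h₁.measure_transversal_meet h H hK W hKW hx₀, h₂.measure_transversal_meet h H hK W hKW hx₀]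
  have hc : IsCompact ((H.1 : Set V) ∩ parallelepiped ξ) :=
    hK.inter_left (H.1.closed_of_finiteDimensional)
  set L := H.1.direction ⊓ W with hL
  have hcL : ∀ x ∈ (H.1 : Set V) ∩ parallelepiped ξ, x - x₀ ∈ L := fun x hx =>
    ⟨AffineSubspace.vsub_mem_direction hx.1 hx₀, hKW x hx.2⟩
  -- As dir H + W = V, dim L = dim H + dim W − dim V, where dim H = dim V − q and dim W ≤ p + q.
  have hdim : finrank ℝ L ≤ p := by
    have e1 := Submodule.finrank_sup_add_finrank_inf_eq H.1.direction W
    have e2 := finrank_direction_add H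
    have e3 : finrank ℝ W ≤ m := (finrank_range_le_card ξ).trans (by simp)
    rw [hsup, finrank_top, ← hL] at e1
    omega
  -- If dim L < p, no G of codimension p is transversal to L, so both measures vanish. If dim L = p,
  -- the section H ∩ P is a compact set in a p-flat, where each measure is Lebesgue measure times
  -- the value of its density on a basis of L.
  rcases hdim.lt_or_eq with hlt | heq
  · have hz : ∀ {μ : Measure (AGr V p)}, IsNormalMeasure μ →
        μ (hitting p ((H.1 : Set V) ∩ parallelepiped ξ)) = 0 := fun {μ} hμ => by
      rw [← hμ.measure_not_transversal L hc x₀ hcL]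
      congr 1
      ext G
      refine ⟨fun hG => ⟨hG, fun htop => ?_⟩, fun hG => hG.1⟩
      have e1 := Submodule.finrank_add_le_finrank_add_finrank G.1.direction L
      have e2 := finrank_direction_add G
      rw [htop, finrank_top] at e1
      omega
    rw [hz h₁, hz h₂]
  · let e : (Fin p → ℝ) ≃ₗ[ℝ] L := LinearEquiv.ofFinrankEq _ _ (by rw [heq]; simp)
    let ψ : (Fin p → ℝ) →L[ℝ] V := LinearMap.toContinuousLinearMap (L.subtype ∘ₗ e.toLinearMap)
    have hψ : Topology.IsClosedEmbedding ψ := LinearMap.isClosedEmbedding_of_injective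
      (LinearMap.ker_eq_bot.2 (Subtype.val_injective.comp e.injective))
    have hcont : Continuous fun a => x₀ + ψ a := by fun_prop
    let A : Set (Fin p → ℝ) := ψ ⁻¹' (-x₀ +ᵥ ((H.1 : Set V) ∩ parallelepiped ξ))
    have hA : IsCompact A := hψ.isCompact_preimage (hc.vadd _)
    have hcA : (H.1 : Set V) ∩ parallelepiped ξ = x₀ +ᵥ ψ '' A := by
      rw [image_preimage_eq_of_subset, vadd_neg_vadd]
      rintro _ ⟨x, hx, rfl⟩
      refine ⟨e.symm ⟨x - x₀, hcL x hx⟩, ?_⟩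
      change ((e (e.symm _) : L) : V) = _
      rw [LinearEquiv.apply_symm_apply]
      simp [sub_eq_neg_add]
    rw [hcA, h₁.hitting_flat ψ hA, h₂.hitting_flat ψ hA,
      (chi_eq_iff h₁ h₂).1 (congrFun hχ _)]

/-- By Fubini it is enough to compare the slices over H, and ν-almost every H meeting the
parallelotope is transversal to its span. -/
theorem chi_mulMeasure_congr_left {μ₁ μ₂ : Measure (AGr V p)} {ν : Measure (AGr V q)}
    (h₁ : IsNormalMeasure μ₁) (h₂ : IsNormalMeasure μ₂) (hν : IsNormalMeasure ν)
    (hχ : chi μ₁ = chi μ₂) (h : p + q = m) :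
    chi (mulMeasure μ₁ ν m) = chi (mulMeasure μ₂ ν m) := by
  have := h₁.sigmaFinite
  have := h₂.sigmaFinite
  have := hν.sigmaFinite
  ext ξ
  have hK := isCompact_parallelepiped ξ
  have hm := measurableSet_transversal_meet h hK
  rw [chi, chi, mulMeasure_hitting h _ _ hK, mulMeasure_hitting h _ _ hK,
    Measure.prod_apply_symm hm, Measure.prod_apply_symm hm]
  congr 1
  refine lintegral_congr_ae ?_
  have hae := hν.measure_not_transversal (Submodule.span ℝ (range ξ)) hK 0 (by
    rintro _ ⟨t, -, rfl⟩
    rw [sub_zero]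
    exact Submodule.sum_mem _ fun i _ =>
      Submodule.smul_mem _ _ (Submodule.subset_span (mem_range_self i)))
  filter_upwards [measure_eq_zero_iff_ae_notMem.1 hae] with H hH
  refine measure_transversal_meet_congr h₁ h₂ hχ h H ξ fun hm => ?_
  by_contra hc
  exact hH ⟨hm, hc⟩

theorem chi_mulMeasure_comm {μ : Measure (AGr V p)} {ν : Measure (AGr V q)}
    (hμ : IsNormalMeasure μ) (hν : IsNormalMeasure ν) (h : p + q = m) :
    chi (mulMeasure μ ν m) = chi (mulMeasure ν μ m) := by
  have := hμ.sigmaFinite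
  have := hν.sigmaFinite
  have h' : q + p = m := by omega
  ext ξ
  have hK := isCompact_parallelepiped ξ
  rw [chi, chi, mulMeasure_hitting h _ _ hK, mulMeasure_hitting h' _ _ hK, ← Measure.prod_swap,
    Measure.map_apply measurable_swap (measurableSet_transversal_meet h hK)]
  congr 2
  ext ⟨H, G⟩
  simp only [IsTransversal, mem_preimage, Prod.swap_prod_mk, mem_ofPred_eq]
  rw [inf_comm, inter_comm (G.1 : Set V)]

theorem IsNormalMeasure.add {μ₁ μ₂ : Measure (AGr V p)} (h₁ : IsNormalMeasure μ₁)
    (h₂ : IsNormalMeasure μ₂) : IsNormalMeasure (μ₁ + μ₂) where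
  finite_on_compacts K hK := by
    rw [Measure.add_apply]
    exact ENNReal.add_lt_top.2 ⟨h₁.finite_on_compacts K hK, h₂.finite_on_compacts K hK⟩
  translation_invariant v D hD := by
    rw [Measure.add_apply, Measure.add_apply, h₁.translation_invariant v D hD,
      h₂.translation_invariant v D hD]

theorem chi_add {μ₁ μ₂ : Measure (AGr V p)} (h₁ : IsNormalMeasure μ₁) (h₂ : IsNormalMeasure μ₂)
    (ξ : Fin p → V) : chi (μ₁ + μ₂) ξ = chi μ₁ ξ + chi μ₂ ξ := by
  have hK := isCompact_parallelepiped ξ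
  rw [chi, Measure.add_apply, ENNReal.toReal_add (h₁.hitting_lt_top hK).ne
    (h₂.hitting_lt_top hK).ne, chi, chi]

theorem measure_transversal_meet_lt_top {μ : Measure (AGr V p)} {ν : Measure (AGr V q)}
    (hμ : IsNormalMeasure μ) (hν : IsNormalMeasure ν) {K : Set V} (hK : IsCompact K) :
    μ.prod ν {x | IsTransversal m x ∧ (((x.1.1 : Set V) ∩ x.2.1) ∩ K).Nonempty} < ⊤ := by
  have := hμ.sigmaFinite
  have := hν.sigmaFinite
  refine (measure_mono (t := hitting p K ×ˢ hitting q K) ?_).trans_lt ?_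
  · rintro x ⟨-, y, ⟨h1, h2⟩, h3⟩
    exact ⟨⟨y, h1, h3⟩, ⟨y, h2, h3⟩⟩
  · rw [Measure.prod_prod]
    exact ENNReal.mul_lt_top (hμ.hitting_lt_top hK) (hν.hitting_lt_top hK)

theorem chi_mulMeasure_add_left {μ₁ μ₂ : Measure (AGr V p)} {ν : Measure (AGr V q)}
    (h₁ : IsNormalMeasure μ₁) (h₂ : IsNormalMeasure μ₂) (hν : IsNormalMeasure ν) (h : p + q = m)
    (ξ : Fin m → V) : chi (mulMeasure (μ₁ + μ₂) ν m) ξ =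
      chi (mulMeasure μ₁ ν m) ξ + chi (mulMeasure μ₂ ν m) ξ := by
  have := h₁.sigmaFinite
  have := h₂.sigmaFinite
  have := hν.sigmaFinite
  have hK := isCompact_parallelepiped ξ
  rw [chi, chi, chi, mulMeasure_hitting h _ _ hK, mulMeasure_hitting h _ _ hK,
    mulMeasure_hitting h _ _ hK, Measure.add_prod, Measure.add_apply, ENNReal.toReal_add
      (measure_transversal_meet_lt_top h₁ hν hK).ne (measure_transversal_meet_lt_top h₂ hν hK).ne]

/-- The signed case reduces to the nonnegative one by moving negative parts across: `μ₁.pos +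
μ₂.neg` and `μ₂.pos + μ₁.neg` have the same density. -/
theorem NormalMeasure.chiMul_congr_left {μ₁ μ₂ : NormalMeasure V p} (hχ : μ₁.chi = μ₂.chi)
    (ν : NormalMeasure V q) (h : p + q = m) : μ₁.chiMul ν m = μ₂.chiMul ν m := by
  have key : NormalDensity.chi (μ₁.pos + μ₂.neg) = NormalDensity.chi (μ₂.pos + μ₁.neg) := by
    ext ξ
    have := congrFun hχ ξ
    rw [NormalMeasure.chi, NormalMeasure.chi] at this
    rw [chi_add μ₁.isNormal_pos μ₂.isNormal_neg, chi_add μ₂.isNormal_pos μ₁.isNormal_neg]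
    linarith
  ext ξ
  have h1 := congrFun (chi_mulMeasure_congr_left (μ₁.isNormal_pos.add μ₂.isNormal_neg)
    (μ₂.isNormal_pos.add μ₁.isNormal_neg) ν.isNormal_pos key h) ξ
  have h2 := congrFun (chi_mulMeasure_congr_left (μ₁.isNormal_pos.add μ₂.isNormal_neg)
    (μ₂.isNormal_pos.add μ₁.isNormal_neg) ν.isNormal_neg key h) ξ
  rw [chi_mulMeasure_add_left μ₁.isNormal_pos μ₂.isNormal_neg ν.isNormal_pos h,
    chi_mulMeasure_add_left μ₂.isNormal_pos μ₁.isNormal_neg ν.isNormal_pos h] at h1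
  rw [chi_mulMeasure_add_left μ₁.isNormal_pos μ₂.isNormal_neg ν.isNormal_neg h,
    chi_mulMeasure_add_left μ₂.isNormal_pos μ₁.isNormal_neg ν.isNormal_neg h] at h2
  rw [NormalMeasure.chiMul, NormalMeasure.chiMul]
  linarith

theorem NormalMeasure.chiMul_comm (μ : NormalMeasure V p) (ν : NormalMeasure V q)
    (h : p + q = m) : μ.chiMul ν m = ν.chiMul μ m := by
  ext ξ
  rw [NormalMeasure.chiMul, NormalMeasure.chiMul,
    chi_mulMeasure_comm μ.isNormal_pos ν.isNormal_pos h,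
    chi_mulMeasure_comm μ.isNormal_neg ν.isNormal_neg h,
    chi_mulMeasure_comm μ.isNormal_pos ν.isNormal_neg h,
    chi_mulMeasure_comm μ.isNormal_neg ν.isNormal_pos h]
  ring

/-- The product of normal densities may be computed from any representing measures. -/
theorem mulDensity_chi (μ : NormalMeasure V p) (ν : NormalMeasure V q) (h : p + q = m) :
    mulDensity μ.chi ν.chi m = μ.chiMul ν m := by
  have hn : IsNormal μ.chi ∧ IsNormal ν.chi := ⟨⟨μ, rfl⟩, ⟨ν, rfl⟩⟩
  rw [mulDensity, dif_pos hn, NormalMeasure.chiMul_congr_left hn.1.choose_spec.symm _ h,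
    NormalMeasure.chiMul_comm _ _ h,
    NormalMeasure.chiMul_congr_left hn.2.choose_spec.symm _ (by omega),
    NormalMeasure.chiMul_comm _ _ (by omega)]

end ChiMul

/-! ### Normal measures built from measures on spaces of linear maps. -/

section OfMeasure

variable {V : Type*} [NormedAddCommGroup V] [NormedSpace ℝ V] {m p q : ℕ}

/-- `|det T(ξ)|` for a linear map `T : V → ℝ^m` and `ξ ∈ V^m`. -/
def absDet (T : V →L[ℝ] (Fin m → ℝ)) (ξ : Fin m → V) : ℝ :=
  |(Matrix.of fun i j => T (ξ j) i).det|

theorem continuous_absDet :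
    Continuous fun x : (V →L[ℝ] (Fin m → ℝ)) × (Fin m → V) => absDet x.1 x.2 := by
  refine (Continuous.matrix_det ?_).abs
  refine continuous_matrix fun i j => ?_
  have : Continuous fun x : (V →L[ℝ] (Fin m → ℝ)) × (Fin m → V) => x.1 (x.2 j) := by fun_prop
  exact (continuous_apply i).comp this

theorem volume_image_parallelepiped (T : V →L[ℝ] (Fin m → ℝ)) (ξ : Fin m → V) :
    volume (T '' parallelepiped ξ) = ENNReal.ofReal (absDet T ξ) := by
  let M : Matrix (Fin m) (Fin m) ℝ := Matrix.of fun i j => T (ξ j) i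
  have h1 : T '' parallelepiped ξ = parallelepiped (fun j => T (ξ j)) := by
    rw [← ContinuousLinearMap.coe_coe T, image_parallelepiped]
    rfl
  have h2 : (fun j => T (ξ j)) =
      fun j => LinearMap.toContinuousLinearMap (Matrix.toLin' M) (Pi.single j 1) := by
    ext j i
    simp [M, Matrix.toLin'_apply]
  rw [h1, h2, parallelepiped_comp_single, LinearMap.coe_toContinuousLinearMap',
    Measure.addHaar_image_linearMap, LinearMap.det_toLin', Real.volume_Icc_pi]
  simp [absDet, M]

theorem absDet_eq_zero {T : V →L[ℝ] (Fin m → ℝ)} (hT : ¬ Function.Surjective T) (ξ : Fin m → V) :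
    absDet T ξ = 0 := by
  rw [absDet, abs_eq_zero]
  by_contra hdet
  apply hT
  intro r
  obtain ⟨t, ht⟩ := (Matrix.mulVec_surjective_iff_isUnit (A := Matrix.of fun i j => T (ξ j) i)).2
    ((Matrix.isUnit_iff_isUnit_det _).2 (isUnit_iff_ne_zero.2 hdet)) r
  refine ⟨∑ j, t j • ξ j, ?_⟩
  rw [← ht, map_sum]
  ext i
  simp [Matrix.mulVec, dotProduct, mul_comm]

/-- The translation invariant measure on `AGr V m` which is the image of `κ × vol` under
`(f, r) ↦ f⁻¹(r)`, for a measure `κ` on the space of linear maps `f : V → ℝ^m`. -/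
def ofMeasure (κ : Measure (V →L[ℝ] (Fin m → ℝ))) : Measure (AGr V m) :=
  ((κ.comap (Subtype.val : Surj V m → _)).prod volume).map fiber

theorem measurable_fiber : Measurable (fiber (V := V) (m := m)) := continuous_fiber.measurable

theorem measurableSet_surjective :
    MeasurableSet {f : V →L[ℝ] (Fin m → ℝ) | Function.Surjective f} :=
  isOpen_surjective.measurableSet

variable [FiniteDimensional ℝ V]

instance : SecondCountableTopology (V →L[ℝ] (Fin m → ℝ)) :=
  have : ProperSpace (V →L[ℝ] (Fin m → ℝ)) := FiniteDimensional.proper ℝ _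
  inferInstance

theorem lintegral_comap_surj (κ : Measure (V →L[ℝ] (Fin m → ℝ)))
    {F : (V →L[ℝ] (Fin m → ℝ)) → ENNReal} (hF : ∀ f : V →L[ℝ] (Fin m → ℝ), ¬ Function.Surjective f → F f = 0) :
    ∫⁻ f : Surj V m, F f.1 ∂(κ.comap (Subtype.val : Surj V m → _)) = ∫⁻ f, F f ∂κ := by
  refine (lintegral_subtype_comap measurableSet_surjective F).trans ?_
  rw [← lintegral_indicator measurableSet_surjective]
  refine lintegral_congr fun f => ?_
  by_cases hf : Function.Surjective f
  · exact indicator_of_mem hf F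
  · rw [hF f hf]; exact indicator_of_notMem hf F

theorem ofMeasure_hitting (κ : Measure (V →L[ℝ] (Fin m → ℝ))) [IsFiniteMeasure κ] {K : Set V}
    (hK : IsCompact K) : ofMeasure κ (hitting m K) =
      ∫⁻ f in {f | Function.Surjective f}, volume (f '' K) ∂κ := by
  have hm := (isClosed_hitting (m := m) hK).measurableSet
  rw [ofMeasure, Measure.map_apply measurable_fiber hm, Measure.prod_apply (measurable_fiber hm),
    ← lintegral_subtype_comap measurableSet_surjective]
  refine lintegral_congr fun f => congrArg _ ?_
  ext r
  exact mem_hitting_fiber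

/-- The levels r at which f⁻¹(r) meets the parallelotope fill its image, of volume |det f(ξ)|. This
vanishes when f is not surjective, so the restriction to surjective maps disappears. -/
theorem ofMeasure_parallelepiped (κ : Measure (V →L[ℝ] (Fin m → ℝ))) [IsFiniteMeasure κ]
    (ξ : Fin m → V) : ofMeasure κ (hitting m (parallelepiped ξ)) =
      ∫⁻ f, ENNReal.ofReal (absDet f ξ) ∂κ := by
  rw [ofMeasure_hitting κ (isCompact_parallelepiped ξ)]
  simp_rw [volume_image_parallelepiped]
  rw [← lintegral_subtype_comap measurableSet_surjective]
  exact lintegral_comap_surj κ (F := fun f => ENNReal.ofReal (absDet f ξ)) fun f hf => by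
    rw [absDet_eq_zero hf, ENNReal.ofReal_zero]

/-- A compact set of subspaces consists of subspaces meeting some fixed ball, and the bound on ‖f‖
controls the volume of the image of that ball. Translation by v acts as r ↦ r + f(v), which
preserves Lebesgue measure. -/
theorem isNormalMeasure_ofMeasure (κ : Measure (V →L[ℝ] (Fin m → ℝ))) [IsFiniteMeasure κ] {C : ℝ}
    (hC : ∀ᵐ f ∂κ, ‖f‖ ≤ C) : IsNormalMeasure (ofMeasure κ) where
  finite_on_compacts K hK := by
    have hmono : Monotone fun n : ℕ => hitting m (Metric.ball (0 : V) n) := fun a b hab =>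
      hitting_mono (Metric.ball_subset_ball (by exact_mod_cast hab))
    obtain ⟨n, hn⟩ := hK.elim_directed_cover _ (fun n : ℕ => isOpen_hitting Metric.isOpen_ball)
      (fun G _ => mem_iUnion.2 (exists_mem_hitting_ball G)) hmono.directed_le
    have : ProperSpace V := FiniteDimensional.proper_real V
    refine (measure_mono (hn.trans (hitting_mono Metric.ball_subset_closedBall))).trans_lt ?_
    rw [ofMeasure_hitting κ (isCompact_closedBall 0 _)]
    refine (setLIntegral_le_lintegral _ _).trans_lt ?_
    refine (lintegral_mono_ae (g := fun _ => volume (Metric.closedBall (0 : Fin m → ℝ) (C * n))) ?_).trans_lt ?_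
    · filter_upwards [hC] with f hf
      refine measure_mono ?_
      rintro _ ⟨x, hx, rfl⟩
      rw [mem_closedBall_zero_iff] at hx ⊢
      exact (f.le_opNorm x).trans
        (mul_le_mul hf hx (norm_nonneg _) ((norm_nonneg _).trans hf))
    · rw [lintegral_const]
      exact ENNReal.mul_lt_top measure_closedBall_lt_top (measure_lt_top κ univ)
  translation_invariant v D hD := by
    have ht : ∀ f : Surj V m, (fun r => fiber (f, r)) ⁻¹' (AGr.translate v ⁻¹' D) =
        (fun r => r + f.1 v) ⁻¹' ((fun r => fiber (f, r)) ⁻¹' D) := fun f => by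
      ext r
      simp only [mem_preimage, translate_fiber]
    have hpre : fiber ⁻¹' (AGr.translate v ⁻¹' D) =
        (fun z : Surj V m × (Fin m → ℝ) => (z.1, z.2 + z.1.1 v)) ⁻¹' (fiber ⁻¹' D) := by
      ext z
      simp only [mem_preimage, translate_fiber]
    have hmt : MeasurableSet (AGr.translate v ⁻¹' D) := by
      have : Continuous (AGr.translate (m := m) v) := by
        rw [isOpenQuotientMap_fiber.isQuotientMap.continuous_iff]
        have : AGr.translate v ∘ fiber =
            fun z : Surj V m × (Fin m → ℝ) => fiber (z.1, z.2 + z.1.1 v) :=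
          funext fun z => translate_fiber v z
        rw [this]
        exact continuous_fiber.comp (by fun_prop)
      exact this.measurable hD
    rw [ofMeasure, Measure.map_apply measurable_fiber hD, Measure.map_apply measurable_fiber hmt,
      Measure.prod_apply (measurable_fiber hD), Measure.prod_apply (measurable_fiber hmt)]
    refine lintegral_congr fun f => ?_
    exact (congrArg volume (ht f)).trans (measure_preimage_add_right volume (f.1 v) _)

/-- The intersection of f⁻¹(r) and f'⁻¹(r') is the fibre of the joined map over (r, r'). For fixed f
and f', the pairs (r, r') that count form the image of the parallelotope. Fubini then leaves the
integral over f and f'. -/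
theorem mulMeasure_ofMeasure (κ : Measure (V →L[ℝ] (Fin p → ℝ))) [IsFiniteMeasure κ]
    (κ' : Measure (V →L[ℝ] (Fin q → ℝ))) [IsFiniteMeasure κ'] (h : p + q = m) (ξ : Fin m → V) :
    mulMeasure (ofMeasure κ) (ofMeasure κ') m (hitting m (parallelepiped ξ)) =
      ∫⁻ f, ∫⁻ f', ENNReal.ofReal (absDet (joinMap h f f') ξ) ∂κ' ∂κ := by
  have hK := isCompact_parallelepiped ξ
  have hm := measurableSet_transversal_meet h hK
  have hm' := (measurable_fiber.prodMap measurable_fiber) hm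
  rw [mulMeasure_hitting h _ _ hK, ofMeasure, ofMeasure,
    Measure.map_prod_map _ _ measurable_fiber measurable_fiber,
    Measure.map_apply (measurable_fiber.prodMap measurable_fiber) hm]
  let S : Set ((Surj V p × (Fin p → ℝ)) × (Surj V q × (Fin q → ℝ))) :=
    {x | Function.Surjective (joinMap h x.1.1.1 x.2.1.1) ∧
      joinL h (x.1.2, x.2.2) ∈ joinMap h x.1.1.1 x.2.1.1 '' parallelepiped ξ}
  have hS : Prod.map fiber fiber ⁻¹' {x : AGr V p × AGr V q | IsTransversal m x ∧
      (((x.1.1 : Set V) ∩ x.2.1) ∩ parallelepiped ξ).Nonempty} = S := by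
    ext ⟨z, w⟩
    refine and_congr (isTransversal_fiber_iff h) ?_
    constructor
    · rintro ⟨x, ⟨h1, h2⟩, h3⟩
      exact ⟨x, h3, congrArg (joinL h) (mem_inf_fiber.1 ⟨h1, h2⟩)⟩
    · rintro ⟨x, h3, hx⟩
      exact ⟨x, mem_inf_fiber.2 ((joinL h).injective hx), h3⟩
  rw [hS] at hm' ⊢
  have hsec : ∀ (f : Surj V p) (f' : Surj V q),
      (volume.prod volume) {y : (Fin p → ℝ) × (Fin q → ℝ) | ((f, y.1), (f', y.2)) ∈ S} =
        ENNReal.ofReal (absDet (joinMap h f.1 f'.1) ξ) := by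
    intro f f'
    by_cases hs : Function.Surjective (joinMap h f.1 f'.1)
    · have : {y : (Fin p → ℝ) × (Fin q → ℝ) | ((f, y.1), (f', y.2)) ∈ S} =
          joinL h ⁻¹' (joinMap h f.1 f'.1 '' parallelepiped ξ) := by
        ext y
        exact and_iff_right hs
      rw [this, (measurePreserving_joinL h).measure_preimage, volume_image_parallelepiped]
      exact (hK.image (joinMap h f.1 f'.1).continuous).measurableSet.nullMeasurableSet
    · have : {y : (Fin p → ℝ) × (Fin q → ℝ) | ((f, y.1), (f', y.2)) ∈ S} = ∅ := by
        ext y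
        simp only [mem_empty_iff_false, iff_false]
        exact fun hy => hs hy.1
      rw [this, measure_empty, absDet_eq_zero hs, ENNReal.ofReal_zero]
  have hm1 : ∀ f : Surj V p, MeasurableSet {y : ((Fin p → ℝ) × Surj V q) × (Fin q → ℝ) |
      ((f, y.1.1), (y.1.2, y.2)) ∈ S} := fun f =>
    (show Measurable fun y : ((Fin p → ℝ) × Surj V q) × (Fin q → ℝ) =>
      ((f, y.1.1), (y.1.2, y.2)) by fun_prop) hm'
  have hm2 : ∀ (f : Surj V p) (f' : Surj V q),
      MeasurableSet {y : (Fin p → ℝ) × (Fin q → ℝ) | ((f, y.1), (f', y.2)) ∈ S} := fun f f' =>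
    (show Measurable fun y : (Fin p → ℝ) × (Fin q → ℝ) => ((f, y.1), (f', y.2)) by fun_prop) hm'
  rw [Measure.prod_apply hm', lintegral_prod _ (measurable_measure_prodMk_left hm').aemeasurable]
  refine Eq.trans ?_ (lintegral_comap_surj κ
    (F := fun f => ∫⁻ f', ENNReal.ofReal (absDet (joinMap h f f') ξ) ∂κ') ?_)
  · refine lintegral_congr fun f => ?_
    calc ∫⁻ r, ((κ'.comap Subtype.val).prod volume) (Prod.mk (f, r) ⁻¹' S) =
        ∫⁻ r, ∫⁻ f' : Surj V q, volume {s | ((f, r), (f', s)) ∈ S} ∂(κ'.comap Subtype.val) :=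
          lintegral_congr fun r => Measure.prod_apply (measurable_prodMk_left hm')
      _ = ∫⁻ f' : Surj V q, (∫⁻ r, volume {s | ((f, r), (f', s)) ∈ S}) ∂(κ'.comap Subtype.val) :=
          lintegral_lintegral_swap (measurable_measure_prodMk_left (hm1 f)).aemeasurable
      _ = ∫⁻ f' : Surj V q, ENNReal.ofReal (absDet (joinMap h f.1 f'.1) ξ)
            ∂(κ'.comap Subtype.val) :=
          lintegral_congr fun f' => by rw [← hsec f f', Measure.prod_apply (hm2 f f')]; rfl
      _ = _ := lintegral_comap_surj κ' (F := fun f' => ENNReal.ofReal (absDet (joinMap h f.1 f') ξ))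
          fun f' hf' => by
            rw [absDet_eq_zero, ENNReal.ofReal_zero]
            rw [joinMap_surjective_iff]
            exact fun hs => hf' (Prod.snd_surjective.comp hs)
  · intro f hf
    refine (lintegral_congr fun f' => ?_).trans lintegral_zero
    rw [absDet_eq_zero, ENNReal.ofReal_zero]
    rw [joinMap_surjective_iff]
    exact fun hs => hf (Prod.fst_surjective.comp hs)

end OfMeasure

/-! ### Densities of the form ∫ g(s) |det T_s(ξ)| ds, their normality and their products. -/

/-- A bounded measurable family of linear maps `T s : V → ℝ^m` with bounded weights `g s`,
parametrized by a finite measure space `S`. -/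
structure CosineData (V : Type*) [NormedAddCommGroup V] [NormedSpace ℝ V] (S : Type*)
    [MeasurableSpace S] (m : ℕ) where
  base : Measure S
  isFinite : IsFiniteMeasure base
  weight : S → ℝ
  map : S → V →L[ℝ] (Fin m → ℝ)
  measurable_weight : Measurable weight
  measurable_map : Measurable map
  bdd_weight : ∃ C, ∀ s, |weight s| ≤ C
  bdd_map : ∃ C, ∀ s, ‖map s‖ ≤ C

theorem absDet_nonneg {V : Type*} [NormedAddCommGroup V] [NormedSpace ℝ V] {m : ℕ}
    (T : V →L[ℝ] (Fin m → ℝ)) (ξ : Fin m → V) : 0 ≤ absDet T ξ := abs_nonneg _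

theorem absDet_eq_of_rows {V : Type*} [NormedAddCommGroup V] [NormedSpace ℝ V] {m : ℕ} {ι : Type*}
    {T T' : V →L[ℝ] (Fin m → ℝ)} (e e' : ι ≃ Fin m) (h : ∀ x a, T x (e a) = T' x (e' a))
    (ξ : Fin m → V) : absDet T ξ = absDet T' ξ := by
  rw [absDet, absDet, ← Matrix.abs_det_submatrix_equiv_equiv (e.symm.trans e') (Equiv.refl _)
    (Matrix.of fun i j => T' (ξ j) i)]
  congr 2
  ext i j
  simpa using h (ξ j) (e.symm i)

theorem integral_add_sub_add {S : Type*} [MeasurableSpace S] {μ : Measure S} {a b c d e : S → ℝ}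
    (ha : Integrable a μ) (hb : Integrable b μ) (hc : Integrable c μ) (hd : Integrable d μ)
    (h : ∀ s, a s + b s - (c s + d s) = e s) :
    (∫ s, a s ∂μ) + (∫ s, b s ∂μ) - ((∫ s, c s ∂μ) + ∫ s, d s ∂μ) = ∫ s, e s ∂μ := by
  have : e = (a + b) - (c + d) := funext fun s => (h s).symm
  rw [this, integral_sub' (ha.add hb) (hc.add hd), integral_add' ha hb, integral_add' hc hd]

namespace CosineData

variable {V : Type*} [NormedAddCommGroup V] [NormedSpace ℝ V] {m p q : ℕ}
  {S S' : Type*} [MeasurableSpace S] [MeasurableSpace S']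

instance (D : CosineData V S m) : IsFiniteMeasure D.base := D.isFinite

/-- The density `ξ ↦ ∫ g(s) |det T_s(ξ)| ds`. -/
def density (D : CosineData V S m) (ξ : Fin m → V) : ℝ :=
  ∫ s, D.weight s * absDet (D.map s) ξ ∂D.base

/-- The normal measure on `AGr V m` defined by the family `D.map` with weights `u`. -/
def part (D : CosineData V S m) (u : S → ℝ) : Measure (AGr V m) :=
  ofMeasure ((D.base.withDensity fun s => ENNReal.ofReal (u s)).map D.map)

theorem isFiniteMeasure_withDensity (D : CosineData V S m) {u : S → ℝ} {C : ℝ}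
    (hC : ∀ s, u s ≤ C) :
    IsFiniteMeasure (D.base.withDensity fun s => ENNReal.ofReal (u s)) := by
  refine MeasureTheory.isFiniteMeasure_withDensity ?_
  refine ((lintegral_mono fun s => ENNReal.ofReal_le_ofReal (hC s)).trans_lt ?_).ne
  rw [lintegral_const]
  exact ENNReal.mul_lt_top ENNReal.ofReal_lt_top (measure_lt_top _ _)

variable [FiniteDimensional ℝ V]

theorem measurable_absDet (D : CosineData V S m) (ξ : Fin m → V) :
    Measurable fun s => absDet (D.map s) ξ :=
  (continuous_absDet.comp (Continuous.prodMk_left ξ)).measurable.comp D.measurable_map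

theorem exists_absDet_le (D : CosineData V S m) (ξ : Fin m → V) :
    ∃ C, ∀ s, absDet (D.map s) ξ ≤ C := by
  obtain ⟨C, hC⟩ := D.bdd_map
  have : ProperSpace (V →L[ℝ] (Fin m → ℝ)) := FiniteDimensional.proper ℝ _
  obtain ⟨B, hB⟩ := (isCompact_closedBall (0 : V →L[ℝ] (Fin m → ℝ)) C).exists_bound_of_continuousOn
    (continuous_absDet.comp (Continuous.prodMk_left ξ)).continuousOn
  exact ⟨B, fun s => (le_abs_self _).trans (hB _ (by simpa using hC s))⟩

theorem integrable (D : CosineData V S m) {u : S → ℝ} (hu : Measurable u) {C : ℝ}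
    (hC : ∀ s, |u s| ≤ C) (ξ : Fin m → V) :
    Integrable (fun s => u s * absDet (D.map s) ξ) D.base := by
  obtain ⟨B, hB⟩ := D.exists_absDet_le ξ
  refine Integrable.of_bound (hu.mul (D.measurable_absDet ξ)).aestronglyMeasurable (C * B)
    (Filter.Eventually.of_forall fun s => ?_)
  rw [Real.norm_eq_abs, abs_mul, abs_of_nonneg (absDet_nonneg _ _)]
  exact mul_le_mul (hC s) (hB s) (absDet_nonneg _ _) ((abs_nonneg _).trans (hC s))

theorem lintegral_part (D : CosineData V S m) {u : S → ℝ} (hu : Measurable u)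
    {F : (V →L[ℝ] (Fin m → ℝ)) → ENNReal} (hF : Measurable F) :
    ∫⁻ f, F f ∂((D.base.withDensity fun s => ENNReal.ofReal (u s)).map D.map) =
      ∫⁻ s, ENNReal.ofReal (u s) * F (D.map s) ∂D.base := by
  rw [lintegral_map hF D.measurable_map]
  exact lintegral_withDensity_eq_lintegral_mul _ hu.ennreal_ofReal (hF.comp D.measurable_map)

theorem isNormalMeasure_part (D : CosineData V S m) {u : S → ℝ} {C : ℝ}
    (hC : ∀ s, u s ≤ C) : IsNormalMeasure (D.part u) := by
  have := D.isFiniteMeasure_withDensity hC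
  obtain ⟨B, hB⟩ := D.bdd_map
  refine isNormalMeasure_ofMeasure _ (C := B) ?_
  rw [ae_map_iff D.measurable_map.aemeasurable (measurableSet_le measurable_norm measurable_const)]
  exact Filter.Eventually.of_forall hB

theorem measurable_ofReal_absDet (ξ : Fin m → V) :
    Measurable fun f : V →L[ℝ] (Fin m → ℝ) => ENNReal.ofReal (absDet f ξ) :=
  (continuous_absDet.comp (Continuous.prodMk_left ξ)).measurable.ennreal_ofReal

theorem chi_part (D : CosineData V S m) {u : S → ℝ} (hu : Measurable u) (h0 : ∀ s, 0 ≤ u s) {C : ℝ}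
    (hC : ∀ s, u s ≤ C) (ξ : Fin m → V) :
    chi (D.part u) ξ = ∫ s, u s * absDet (D.map s) ξ ∂D.base := by
  have := D.isFiniteMeasure_withDensity hC
  rw [chi, part, ofMeasure_parallelepiped, D.lintegral_part hu (measurable_ofReal_absDet ξ),
    integral_eq_lintegral_of_nonneg_ae
      (Filter.Eventually.of_forall fun s => mul_nonneg (h0 s) (absDet_nonneg _ _))
      (hu.mul (D.measurable_absDet ξ)).aestronglyMeasurable]
  simp_rw [ENNReal.ofReal_mul (h0 _)]

/-- The product family. -/
def mul (D : CosineData V S p) (D' : CosineData V S' q) (h : p + q = m) :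
    CosineData V (S × S') m where
  base := D.base.prod D'.base
  isFinite := inferInstance
  weight s := D.weight s.1 * D'.weight s.2
  map s := joinMap h (D.map s.1) (D'.map s.2)
  measurable_weight := (D.measurable_weight.comp measurable_fst).mul
    (D'.measurable_weight.comp measurable_snd)
  measurable_map := (continuous_joinMap h).measurable.comp
    ((D.measurable_map.comp measurable_fst).prodMk (D'.measurable_map.comp measurable_snd))
  bdd_weight := by
    obtain ⟨C, hC⟩ := D.bdd_weight
    obtain ⟨C', hC'⟩ := D'.bdd_weight
    refine ⟨C * C', fun s => ?_⟩
    rw [abs_mul]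
    exact mul_le_mul (hC _) (hC' _) (abs_nonneg _) ((abs_nonneg _).trans (hC s.1))
  bdd_map := by
    obtain ⟨C, hC⟩ := D.bdd_map
    obtain ⟨C', hC'⟩ := D'.bdd_map
    have : ProperSpace (V →L[ℝ] (Fin p → ℝ)) := FiniteDimensional.proper ℝ _
    have : ProperSpace (V →L[ℝ] (Fin q → ℝ)) := FiniteDimensional.proper ℝ _
    obtain ⟨B, hB⟩ := ((isCompact_closedBall (0 : V →L[ℝ] (Fin p → ℝ)) C).prod
      (isCompact_closedBall (0 : V →L[ℝ] (Fin q → ℝ)) C')).exists_bound_of_continuousOn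
      (continuous_joinMap h).continuousOn
    exact ⟨B, fun s => hB (D.map s.1, D'.map s.2)
      ⟨by simpa using hC s.1, by simpa using hC' s.2⟩⟩

theorem chi_mulMeasure_part (D : CosineData V S p) (D' : CosineData V S' q) (h : p + q = m)
    {u : S → ℝ} {u' : S' → ℝ} (hu : Measurable u) (hu' : Measurable u') (h0 : ∀ s, 0 ≤ u s)
    (h0' : ∀ s, 0 ≤ u' s) {C C' : ℝ} (hC : ∀ s, u s ≤ C) (hC' : ∀ s, u' s ≤ C') (ξ : Fin m → V) :
    chi (mulMeasure (D.part u) (D'.part u') m) ξ =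
      ∫ s, (u s.1 * u' s.2) * absDet (joinMap h (D.map s.1) (D'.map s.2)) ξ
        ∂(D.base.prod D'.base) := by
  have := D.isFiniteMeasure_withDensity hC
  have := D'.isFiniteMeasure_withDensity hC'
  let F : (V →L[ℝ] (Fin p → ℝ)) → (V →L[ℝ] (Fin q → ℝ)) → ENNReal := fun f f' =>
    ENNReal.ofReal (absDet (joinMap h f f') ξ)
  have hm : Measurable (Function.uncurry F) :=
    (measurable_ofReal_absDet ξ).comp (continuous_joinMap h).measurable
  have hmD : Measurable fun s : S × S' => absDet (joinMap h (D.map s.1) (D'.map s.2)) ξ :=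
    (D.mul D' h).measurable_absDet ξ
  have huu : Measurable fun s : S × S' => u s.1 * u' s.2 :=
    (hu.comp measurable_fst).mul (hu'.comp measurable_snd)
  have hprod : Measurable fun s : S × S' =>
      u s.1 * u' s.2 * absDet (joinMap h (D.map s.1) (D'.map s.2)) ξ := huu.mul hmD
  rw [integral_eq_lintegral_of_nonneg_ae (Filter.Eventually.of_forall fun s =>
      mul_nonneg (mul_nonneg (h0 _) (h0' _)) (absDet_nonneg _ _)) hprod.aestronglyMeasurable,
    lintegral_prod _ hprod.ennreal_ofReal.aemeasurable, chi, part, part,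
    mulMeasure_ofMeasure _ _ h]
  refine congrArg ENNReal.toReal ?_
  have e0 := D.lintegral_part (F := fun f => ∫⁻ f', F f f'
    ∂((D'.base.withDensity fun s' => ENNReal.ofReal (u' s')).map D'.map)) hu
    hm.lintegral_prod_right'
  refine e0.trans (lintegral_congr fun s => ?_)
  have hjoin : Measurable fun f' => joinMap h (D.map s) f' :=
    ((continuous_joinMap h).comp (Continuous.prodMk_right (D.map s))).measurable
  have hFs : Measurable fun f' => F (D.map s) f' := (measurable_ofReal_absDet ξ).comp hjoin
  have hFs' : Measurable fun s' => F (D.map s) (D'.map s') := hFs.comp D'.measurable_map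
  have e1 : ∫⁻ f', F (D.map s) f'
        ∂((D'.base.withDensity fun s' => ENNReal.ofReal (u' s')).map D'.map) =
      ∫⁻ s', ENNReal.ofReal (u' s') * F (D.map s) (D'.map s') ∂D'.base := D'.lintegral_part hu' hFs
  have e2 : ENNReal.ofReal (u s) * ∫⁻ s', ENNReal.ofReal (u' s') * F (D.map s) (D'.map s') ∂D'.base
      = ∫⁻ s', ENNReal.ofReal (u s) * (ENNReal.ofReal (u' s') * F (D.map s) (D'.map s')) ∂D'.base :=
    (lintegral_const_mul _ (hu'.ennreal_ofReal.mul hFs')).symm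
  have e3 : ∀ s', ENNReal.ofReal (u s) * (ENNReal.ofReal (u' s') * F (D.map s) (D'.map s')) =
      ENNReal.ofReal (u s * u' s' * absDet (joinMap h (D.map s) (D'.map s')) ξ) := fun s' => by
    rw [← mul_assoc, ← ENNReal.ofReal_mul (h0 _), ← ENNReal.ofReal_mul (mul_nonneg (h0 _) (h0' _))]
  rw [e1, e2]
  exact lintegral_congr e3

theorem exists_bound_parts (D : CosineData V S m) : ∃ C,
    (∀ s, max (D.weight s) 0 ≤ C) ∧ ∀ s, max (-D.weight s) 0 ≤ C := by
  obtain ⟨C, hC⟩ := D.bdd_weight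
  exact ⟨C, fun s => max_le ((le_abs_self _).trans (hC s)) ((abs_nonneg _).trans (hC s)),
    fun s => max_le ((neg_le_abs _).trans (hC s)) ((abs_nonneg _).trans (hC s))⟩

theorem measurable_posPart (D : CosineData V S m) : Measurable fun s => max (D.weight s) 0 :=
  D.measurable_weight.max measurable_const

theorem measurable_negPart (D : CosineData V S m) : Measurable fun s => max (-D.weight s) 0 :=
  D.measurable_weight.neg.max measurable_const

/-- The normal measure which represents the density of the family. -/
def normalMeasure (D : CosineData V S m) : NormalMeasure V m where
  pos := D.part fun s => max (D.weight s) 0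
  neg := D.part fun s => max (-D.weight s) 0
  isNormal_pos := by
    obtain ⟨C, hC, -⟩ := D.exists_bound_parts
    exact D.isNormalMeasure_part hC
  isNormal_neg := by
    obtain ⟨C, -, hC⟩ := D.exists_bound_parts
    exact D.isNormalMeasure_part hC

theorem max_sub_max (x : ℝ) : max x 0 - max (-x) 0 = x := by
  rcases le_total x 0 with h | h
  · rw [max_eq_right h, max_eq_left (by linarith)]; ring
  · rw [max_eq_left h, max_eq_right (by linarith)]; ring

theorem normalMeasure_chi (D : CosineData V S m) : D.normalMeasure.chi = D.density := by
  obtain ⟨C, h1, h2⟩ := D.exists_bound_parts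
  ext ξ
  rw [NormalMeasure.chi, normalMeasure, D.chi_part D.measurable_posPart (fun s => le_max_right _ _) h1,
    D.chi_part D.measurable_negPart (fun s => le_max_right _ _) h2, ← integral_sub, density]
  · simp_rw [← sub_mul, max_sub_max]
  · exact D.integrable D.measurable_posPart
      (fun s => by rw [abs_of_nonneg (le_max_right _ _)]; exact h1 s) ξ
  · exact D.integrable D.measurable_negPart
      (fun s => by rw [abs_of_nonneg (le_max_right _ _)]; exact h2 s) ξ

theorem isNormal_density (D : CosineData V S m) : IsNormal D.density :=
  ⟨D.normalMeasure, D.normalMeasure_chi.symm⟩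

/-- Independence of representatives allows the explicit measures to be used. Their products are
computed by Fubini for each pair of signs, and the four terms recombine to the product of the signed
weights. -/
theorem mulDensity_density (D : CosineData V S p) (D' : CosineData V S' q) (h : p + q = m) :
    mulDensity D.density D'.density m = (D.mul D' h).density := by
  rw [← D.normalMeasure_chi, ← D'.normalMeasure_chi, mulDensity_chi _ _ h]
  obtain ⟨C, h1, h2⟩ := D.exists_bound_parts
  obtain ⟨C', h1', h2'⟩ := D'.exists_bound_parts
  have hint : ∀ {u : S → ℝ} {u' : S' → ℝ}, Measurable u → Measurable u' → (∀ s, 0 ≤ u s) →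
      (∀ s, 0 ≤ u' s) → (∀ s, u s ≤ C) → (∀ s, u' s ≤ C') → ∀ ξ : Fin m → V,
      Integrable (fun s : S × S' => (u s.1 * u' s.2) * absDet (joinMap h (D.map s.1) (D'.map s.2)) ξ)
        (D.base.prod D'.base) := by
    intro u u' hu hu' h0 h0' hC hC' ξ
    refine (D.mul D' h).integrable ((hu.comp measurable_fst).mul (hu'.comp measurable_snd))
      (C := C * C') (fun s => ?_) ξ
    rw [Pi.mul_apply, Function.comp_apply, Function.comp_apply,
      abs_of_nonneg (mul_nonneg (h0 _) (h0' _))]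
    exact mul_le_mul (hC _) (hC' _) (h0' _) ((h0 _).trans (hC s.1))
  have p0 : ∀ s, 0 ≤ max (D.weight s) 0 := fun s => le_max_right _ _
  have n0 : ∀ s, 0 ≤ max (-D.weight s) 0 := fun s => le_max_right _ _
  have p0' : ∀ s, 0 ≤ max (D'.weight s) 0 := fun s => le_max_right _ _
  have n0' : ∀ s, 0 ≤ max (-D'.weight s) 0 := fun s => le_max_right _ _
  have mp := D.measurable_posPart
  have mn := D.measurable_negPart
  have mp' := D'.measurable_posPart
  have mn' := D'.measurable_negPart
  ext ξ
  rw [NormalMeasure.chiMul, normalMeasure, normalMeasure,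
    chi_mulMeasure_part D D' h mp mp' p0 p0' h1 h1', chi_mulMeasure_part D D' h mn mn' n0 n0' h2 h2',
    chi_mulMeasure_part D D' h mp mn' p0 n0' h1 h2', chi_mulMeasure_part D D' h mn mp' n0 p0' h2 h1',
    density]
  refine integral_add_sub_add (hint mp mp' p0 p0' h1 h1' ξ) (hint mn mn' n0 n0' h2 h2' ξ)
    (hint mp mn' p0 n0' h1 h2' ξ) (hint mn mp' n0 p0' h2 h1' ξ) fun s => ?_
  change _ = (D.weight s.1 * D'.weight s.2) * absDet (joinMap h (D.map s.1) (D'.map s.2)) ξ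
  linear_combination (max (D'.weight s.2) 0 - max (-D'.weight s.2) 0) *
    absDet (joinMap h (D.map s.1) (D'.map s.2)) ξ * max_sub_max (D.weight s.1) +
    D.weight s.1 * absDet (joinMap h (D.map s.1) (D'.map s.2)) ξ * max_sub_max (D'.weight s.2)

end CosineData

/-! ### Products of finitely many families. -/

/-- The identification `∏ ℝ^{d i} ≃ ℝ^{∑ d i}`. -/
def sigmaL {n : ℕ} (d : Fin n → ℕ) : (∀ i, Fin (d i) → ℝ) ≃L[ℝ] (Fin (∑ i, d i) → ℝ) :=
  LinearEquiv.toContinuousLinearEquiv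
    { toFun := fun x a => x (finSigmaFinEquiv.symm a).1 (finSigmaFinEquiv.symm a).2
      invFun := fun y i a => y (finSigmaFinEquiv ⟨i, a⟩)
      map_add' := fun _ _ => rfl
      map_smul' := fun _ _ => rfl
      left_inv := fun x => by
        ext i a
        exact congrArg (fun b : Σ i, Fin (d i) => x b.1 b.2) (Equiv.symm_apply_apply _ ⟨i, a⟩)
      right_inv := fun y => by ext a; simp only [Sigma.eta, Equiv.apply_symm_apply] }

theorem sigmaL_apply {n : ℕ} {d : Fin n → ℕ} (x : ∀ i, Fin (d i) → ℝ) (a : Fin (∑ i, d i)) :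
    sigmaL d x a = x (finSigmaFinEquiv.symm a).1 (finSigmaFinEquiv.symm a).2 := rfl

theorem sigmaL_apply_mk {n : ℕ} {d : Fin n → ℕ} (x : ∀ i, Fin (d i) → ℝ) (b : Σ i, Fin (d i)) :
    sigmaL d x (finSigmaFinEquiv b) = x b.1 b.2 := by
  rw [sigmaL_apply, Equiv.symm_apply_apply]

/-- The map `(T₁, …, Tₙ) : V → ∏ ℝ^{d i} ≃ ℝ^{∑ d i}`. -/
def stackMap {V : Type*} [NormedAddCommGroup V] [NormedSpace ℝ V] {n : ℕ} {d : Fin n → ℕ}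
    (T : ∀ i, V →L[ℝ] (Fin (d i) → ℝ)) : V →L[ℝ] (Fin (∑ i, d i) → ℝ) :=
  (sigmaL d : (∀ i, Fin (d i) → ℝ) →L[ℝ] (Fin (∑ i, d i) → ℝ)) ∘L ContinuousLinearMap.pi T

theorem stackMap_apply_mk {V : Type*} [NormedAddCommGroup V] [NormedSpace ℝ V] {n : ℕ}
    {d : Fin n → ℕ} (T : ∀ i, V →L[ℝ] (Fin (d i) → ℝ)) (x : V) (b : Σ i, Fin (d i)) :
    stackMap T x (finSigmaFinEquiv b) = T b.1 x b.2 :=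
  sigmaL_apply_mk (fun i => T i x) b

theorem continuous_stackMap {V : Type*} [NormedAddCommGroup V] [NormedSpace ℝ V] {n : ℕ}
    {d : Fin n → ℕ} :
    Continuous fun T : ∀ i, V →L[ℝ] (Fin (d i) → ℝ) => stackMap T := by
  have : Continuous fun T : ∀ i, V →L[ℝ] (Fin (d i) → ℝ) => ContinuousLinearMap.pi T :=
    (ContinuousLinearMap.piEquivL ..).continuous
  exact continuous_const.clm_comp this

theorem sigma_succ_bijective {n : ℕ} (d : Fin (n + 1) → ℕ) : Function.Bijective
    (Sum.elim (fun a => ⟨0, a⟩) (fun b => ⟨b.1.succ, b.2⟩) :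
      Fin (d 0) ⊕ (Σ i : Fin n, Fin (d i.succ)) → Σ i, Fin (d i)) := by
  constructor
  · rintro (a | ⟨i, a⟩) (b | ⟨j, b⟩) h
    · simpa using h
    · simp [Fin.succ_ne_zero, eq_comm] at h
    · simp [Fin.succ_ne_zero] at h
    · simp only [Sum.elim_inr, Sigma.mk.injEq, Fin.succ_inj] at h
      obtain ⟨rfl, h⟩ := h
      simpa using h
  · rintro ⟨i, a⟩
    cases i using Fin.cases with
    | zero => exact ⟨Sum.inl a, rfl⟩
    | succ i => exact ⟨Sum.inr ⟨i, a⟩, rfl⟩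

theorem measurePreserving_cons {n : ℕ} {S : Fin (n + 1) → Type*} [∀ i, MeasurableSpace (S i)]
    (μ : ∀ i, Measure (S i)) [∀ i, SigmaFinite (μ i)] :
    MeasurePreserving (fun x : S 0 × (∀ i : Fin n, S i.succ) => (Fin.cons x.1 x.2 : ∀ i, S i))
      ((μ 0).prod (Measure.pi fun i : Fin n => μ i.succ)) (Measure.pi μ) := by
  have hmeas : Measurable fun x : S 0 × (∀ i : Fin n, S i.succ) =>
      (Fin.cons x.1 x.2 : ∀ i, S i) := by
    rw [measurable_pi_iff]
    intro i
    cases i using Fin.cases with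
    | zero => exact measurable_fst
    | succ i => exact (measurable_pi_apply i).comp measurable_snd
  refine ⟨hmeas, (Measure.pi_eq fun s hs => ?_).symm⟩
  rw [Measure.map_apply hmeas (MeasurableSet.univ_pi hs), Fin.prod_univ_succ,
    ← Measure.pi_pi (fun i : Fin n => μ i.succ), ← Measure.prod_prod]
  congr 1
  ext x
  simp [Fin.forall_fin_succ]

namespace CosineData

variable {V : Type*} [NormedAddCommGroup V] [NormedSpace ℝ V] {m p q : ℕ}
  {S S' : Type*} [MeasurableSpace S] [MeasurableSpace S']

section Pi

variable {n : ℕ} {S : Fin n → Type*} [∀ i, MeasurableSpace (S i)] {d : Fin n → ℕ}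

/-- The product of finitely many families. -/
def pi [FiniteDimensional ℝ V] (D : ∀ i, CosineData V (S i) (d i)) :
    CosineData V (∀ i, S i) (∑ i, d i) where
  base := Measure.pi fun i => (D i).base
  isFinite := inferInstance
  weight s := ∏ i, (D i).weight (s i)
  map s := stackMap fun i => (D i).map (s i)
  measurable_weight := Finset.measurable_prod _ fun i _ =>
    (D i).measurable_weight.comp (measurable_pi_apply i)
  measurable_map := continuous_stackMap.measurable.comp <| measurable_pi_lambda _ fun i =>
    (D i).measurable_map.comp (measurable_pi_apply i)
  bdd_weight := by
    choose C hC using fun i => (D i).bdd_weight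
    refine ⟨∏ i, C i, fun s => ?_⟩
    rw [Finset.abs_prod]
    exact Finset.prod_le_prod (fun i _ => abs_nonneg _) fun i _ => hC i _
  bdd_map := by
    choose C hC using fun i => (D i).bdd_map
    have : ∀ i, ProperSpace (V →L[ℝ] (Fin (d i) → ℝ)) := fun i => FiniteDimensional.proper ℝ _
    obtain ⟨B, hB⟩ := (isCompact_univ_pi fun i => isCompact_closedBall
      (0 : V →L[ℝ] (Fin (d i) → ℝ)) (C i)).exists_bound_of_continuousOn
      continuous_stackMap.continuousOn
    exact ⟨B, fun s => hB (fun i => (D i).map (s i)) fun i _ => by simpa using hC i (s i)⟩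

end Pi

/-- Induction on the number of factors. Joining the first map to the stack of the others gives the
full stack up to a permutation of rows, which |det| does not see. -/
theorem prodDensity_density [FiniteDimensional ℝ V] {n : ℕ} {S : Fin n → Type*}
    [∀ i, MeasurableSpace (S i)] {d : Fin n → ℕ} (D : ∀ i, CosineData V (S i) (d i)) :
    prodDensity (fun i => (D i).density) = (pi D).density := by
  induction n with
  | zero =>
    ext ξ
    rw [prodDensity, density]
    -- The empty product of weights and the 0 × 0 determinant are both 1, and the empty product
    -- measure has mass 1, which gives the unit density.
    have : ∀ s, (pi D).weight s * absDet ((pi D).map s) ξ = 1 := fun s => by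
      have : IsEmpty (Fin (∑ i : Fin 0, d i)) := by
        rw [Fin.sum_univ_zero]; infer_instance
      simp [pi, absDet]
    simp_rw [this]
    simp [pi, Measure.real]
  | succ n ih =>
    have h : d 0 + ∑ i : Fin n, d i.succ = ∑ i, d i := (Fin.sum_univ_succ d).symm
    rw [prodDensity, ih, mulDensity_density _ _ h]
    ext ξ
    rw [density, density]
    have hm : Measurable fun s => (pi D).weight s * absDet ((pi D).map s) ξ :=
      (pi D).measurable_weight.mul ((pi D).measurable_absDet ξ)
    have hc := measurePreserving_cons fun i => (D i).base
    change _ = ∫ s, _ ∂(Measure.pi fun i => (D i).base)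
    rw [← hc.map_eq, integral_map hc.measurable.aemeasurable hm.aestronglyMeasurable]
    refine integral_congr_ae (Filter.Eventually.of_forall fun s => ?_)
    refine congrArg₂ (· * ·) (Fin.prod_univ_succ fun i => (D i).weight
      ((Fin.cons s.1 s.2 : ∀ i, S i) i)).symm ?_
    refine absDet_eq_of_rows ((Equiv.sumCongr (Equiv.refl _) finSigmaFinEquiv).trans
      (finSumFinEquiv.trans (finCongr h)))
      ((Equiv.ofBijective _ (sigma_succ_bijective d)).trans finSigmaFinEquiv) ?_ ξ
    intro x a
    simp only [Equiv.trans_apply, Equiv.ofBijective_apply]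
    refine Eq.trans ?_ (stackMap_apply_mk _ _ _).symm
    refine (joinL_apply h _ _).trans ?_
    rcases a with a | ⟨i, a⟩
    · rfl
    · exact stackMap_apply_mk (fun i : Fin n => (D i.succ).map (s.2 i)) x ⟨i, a⟩

/-- The alternating form det ∘ T factors through the exterior power, so its value depends only on
the m-vector. -/
theorem absDet_smul (T : V →L[ℝ] (Fin m → ℝ)) (t : ℝ) (v w : Fin m → V)
    (h : exteriorPower.ιMulti ℝ m w = t • exteriorPower.ιMulti ℝ m v) :
    absDet T w = |t| * absDet T v := by
  let A : V [⋀^Fin m]→ₗ[ℝ] ℝ := (Matrix.detRowAlternating).compLinearMap (T : V →ₗ[ℝ] (Fin m → ℝ))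
  have hA : ∀ u, absDet T u = |A u| := fun u => by
    rw [absDet, ← Matrix.det_transpose]
    rfl
  have := congrArg (exteriorPower.alternatingMapLinearEquiv A) h
  rw [map_smul, exteriorPower.alternatingMapLinearEquiv_apply_ιMulti,
    exteriorPower.alternatingMapLinearEquiv_apply_ιMulti] at this
  rw [hA, hA, this, smul_eq_mul, abs_mul]

theorem isDensity_density [FiniteDimensional ℝ V] (D : CosineData V S m) :
    IsDensity D.density where
  continuous := by
    rw [continuous_iff_continuousAt]
    intro ξ₀
    obtain ⟨C, hC⟩ := D.bdd_weight
    obtain ⟨B, hB⟩ := D.bdd_map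
    have : ProperSpace (V →L[ℝ] (Fin m → ℝ)) := FiniteDimensional.proper ℝ _
    have : ProperSpace V := FiniteDimensional.proper_real V
    obtain ⟨R, hR⟩ := ((isCompact_closedBall (0 : V →L[ℝ] (Fin m → ℝ)) B).prod
      (isCompact_closedBall ξ₀ 1)).exists_bound_of_continuousOn continuous_absDet.continuousOn
    refine continuousAt_of_dominated (bound := fun _ => C * R)
      (Filter.Eventually.of_forall fun ξ =>
        (D.measurable_weight.mul (D.measurable_absDet ξ)).aestronglyMeasurable) ?_
      (integrable_const _) (Filter.Eventually.of_forall fun s =>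
        (continuous_const.mul (continuous_absDet.comp (Continuous.prodMk_right _))).continuousAt)
    filter_upwards [Metric.closedBall_mem_nhds ξ₀ one_pos] with ξ hξ
    refine Filter.Eventually.of_forall fun s => ?_
    rw [norm_mul]
    exact mul_le_mul (hC s) (hR (D.map s, ξ) ⟨by simpa using hB s, hξ⟩) (norm_nonneg _)
      ((abs_nonneg _).trans (hC s))
  map_smul t v w h := by
    rw [density, density, ← integral_const_mul]
    refine integral_congr_ae (Filter.Eventually.of_forall fun s => ?_)
    simp only [absDet_smul _ t v w h]
    ring

end CosineData

/-! ### Elimination of the fibre columns by a Schur complement with a maximal minor. -/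

section Reduction

open Matrix

/-- T only adds combinations of the last columns to the first, and the rest is the Schur complement
of D. For singular D the inverse carries no information, and the hypothesis supplies a kernel vector
that makes the left side vanish too. -/
theorem abs_det_fromBlocks {a b : Type*} [Fintype a] [Fintype b] [DecidableEq a] [DecidableEq b]
    (A₁ : Matrix a a ℝ) (A₂ : Matrix b a ℝ) (B : Matrix a b ℝ) (D : Matrix b b ℝ)
    (T : Matrix b a ℝ) (h : D.det = 0 → ∃ t, t ≠ 0 ∧ B *ᵥ t = 0 ∧ D *ᵥ t = 0) :
    |(fromBlocks (A₁ + B * T) B (A₂ + D * T) D).det| = |D.det| * |(A₁ - B * D⁻¹ * A₂).det| := by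
  by_cases hD : D.det = 0
  · obtain ⟨t, ht, hB, hDt⟩ := h hD
    rw [hD, abs_zero, zero_mul, abs_eq_zero, ← exists_mulVec_eq_zero_iff]
    refine ⟨Sum.elim 0 t, fun h0 => ht (funext fun i => congrFun h0 (Sum.inr i)), ?_⟩
    rw [fromBlocks_mulVec]
    ext (i | i)
    · simpa using congrFun hB i
    · simpa using congrFun hDt i
  · have : Invertible D := D.invertibleOfIsUnitDet (isUnit_iff_ne_zero.2 hD)
    have e : fromBlocks (A₁ + B * T) B (A₂ + D * T) D =
        fromBlocks A₁ B A₂ D * fromBlocks 1 0 T 1 := by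
      rw [fromBlocks_multiply]; simp
    rw [e, det_mul, det_fromBlocks_zero₁₂, det_fromBlocks₂₂, det_one, det_one, mul_one, mul_one,
      abs_mul, invOf_eq_nonsing_inv]

variable {d k m : ℕ}

/-- The `k × k` minor of `F` formed by the rows selected by `e`. -/
def minor (e : Fin d ⊕ Fin k ≃ Fin m) (F : Fin m → Fin k → ℝ) : ℝ :=
  (Matrix.of fun b => F (e (.inr b))).det

/-- The matrix expressing the rows of `F` not selected by `e` through the selected ones. -/
def coeff (e : Fin d ⊕ Fin k ≃ Fin m) (F : Fin m → Fin k → ℝ) : Matrix (Fin d) (Fin k) ℝ :=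
  Matrix.of (fun a => F (e (.inl a))) * (Matrix.of fun b => F (e (.inr b)))⁻¹

/-- The minor of `F` selected by `e` has the largest absolute value. -/
def IsMax (e : Fin d ⊕ Fin k ≃ Fin m) (F : Fin m → Fin k → ℝ) : Prop :=
  ∀ e' : Fin d ⊕ Fin k ≃ Fin m, |minor e' F| ≤ |minor e F|

/-- The linear map `ℝ^m → ℝ^d` vanishing on the columns of `F` (if the minor selected by `e` is
not zero) and equal to the identity on the coordinates that are not selected. -/
def redMap (e : Fin d ⊕ Fin k ≃ Fin m) (F : Fin m → Fin k → ℝ) : (Fin m → ℝ) →L[ℝ] (Fin d → ℝ) :=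
  LinearMap.toContinuousLinearMap
    (Matrix.toLin' ((fromCols 1 (-coeff e F)).submatrix id e.symm))

theorem redMap_apply (e : Fin d ⊕ Fin k ≃ Fin m) (F : Fin m → Fin k → ℝ) (x : Fin m → ℝ)
    (a : Fin d) :
    redMap e F x a = x (e (.inl a)) - (coeff e F *ᵥ fun b => x (e (.inr b))) a := by
  change ((fromCols 1 (-coeff e F)).submatrix id e.symm *ᵥ x) a = _
  rw [submatrix_mulVec_equiv, fromCols_mulVec, one_mulVec, neg_mulVec, ← sub_eq_add_neg]
  rfl

theorem exists_equiv_extending {r : Fin k → Fin m} (hr : Function.Injective r) (h : d + k = m) :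
    ∃ e : Fin d ⊕ Fin k ≃ Fin m, ∀ b, e (.inr b) = r b := by
  classical
  have hc : Fintype.card (Fin d) = Fintype.card ↥(range r)ᶜ := by
    have h1 := Fintype.card_compl_set (range r)
    rw [Set.card_range_of_injective hr, Fintype.card_fin, Fintype.card_fin] at h1
    rw [h1, Fintype.card_fin]; omega
  exact ⟨(Equiv.sumComm _ _).trans (((Equiv.ofInjective r hr).sumCongr
    (Fintype.equivOfCardEq hc)).trans (Equiv.Set.sumCompl _)), fun b => by simp⟩

/-- If the largest minor is zero, all are. An injective F would have k independent rows, and the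
minor on those rows would not vanish. -/
theorem IsMax.exists_mulVec_eq_zero {e : Fin d ⊕ Fin k ≃ Fin m} {F : Fin m → Fin k → ℝ}
    (he : IsMax e F) (h0 : minor e F = 0) : ∃ t, t ≠ 0 ∧ Matrix.of F *ᵥ t = 0 := by
  by_contra! hF
  have h : d + k = m := by simpa using Fintype.card_congr e
  have hrank : (Matrix.of F).rank = k := by
    have : Function.Injective (Matrix.of F).mulVecLin := by
      rw [injective_iff_map_eq_zero]
      intro t ht
      by_contra hne
      exact hF t hne ht
    rw [Matrix.rank, LinearMap.finrank_range_of_inj this, finrank_fin_fun]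
  rw [rank_eq_finrank_span_row] at hrank
  obtain ⟨f, hf, -, hli⟩ := Submodule.exists_fun_fin_finrank_span_eq ℝ (Set.range (Matrix.of F).row)
  choose r hr using hf
  have hli' : LinearIndependent ℝ (f ∘ Fin.cast hrank.symm) :=
    hli.comp _ (Fin.cast_injective _)
  have hinj : Function.Injective fun b => r (Fin.cast hrank.symm b) := fun b b' hb =>
    hli'.injective (by
      have hb : r (Fin.cast hrank.symm b) = r (Fin.cast hrank.symm b') := hb
      rw [Function.comp_apply, Function.comp_apply, ← hr, hb, hr])
  obtain ⟨e', he'⟩ := exists_equiv_extending hinj h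
  have hne : minor e' F ≠ 0 := by
    have hrow : (Matrix.of fun b => F (e' (.inr b))).row = f ∘ Fin.cast hrank.symm := by
      ext b i
      rw [Function.comp_apply, ← hr, ← he']
      rfl
    rw [minor, ← isUnit_iff_ne_zero, ← isUnit_iff_isUnit_det, ← linearIndependent_rows_iff_isUnit,
      hrow]
    exact hli'
  have := he e'
  rw [h0, abs_zero] at this
  exact hne (abs_eq_zero.1 (le_antisymm this (abs_nonneg _)))

theorem coeff_apply (e : Fin d ⊕ Fin k ≃ Fin m) (F : Fin m → Fin k → ℝ) (a : Fin d) (b : Fin k) :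
    coeff e F a b = (minor e F)⁻¹ *
      ∑ j, F (e (.inl a)) j * (Matrix.of fun b => F (e (.inr b))).adjugate j b := by
  rw [coeff, inv_def, Ring.inverse_eq_inv', Matrix.mul_apply, Finset.mul_sum]
  refine Finset.sum_congr rfl fun j _ => ?_
  rw [Matrix.smul_apply, smul_eq_mul, of_apply, minor]
  ring

/-- By Cramer's rule an entry is a quotient of two minors whose row selections differ in one row,
with the maximal one in the denominator. This is why a maximal minor is selected: the reduced maps
stay bounded even where the rank of F drops. -/
theorem IsMax.abs_coeff_le {e : Fin d ⊕ Fin k ≃ Fin m} {F : Fin m → Fin k → ℝ}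
    (he : IsMax e F) (a : Fin d) (b : Fin k) : |coeff e F a b| ≤ 1 := by
  set D : Matrix (Fin k) (Fin k) ℝ := Matrix.of fun b => F (e (.inr b)) with hD
  have hswap : minor ((Equiv.swap (.inl a) (.inr b)).trans e) F =
      (D.updateRow b (F (e (.inl a)))).det := by
    rw [minor]
    congr 1
    ext i j
    by_cases hi : i = b
    · subst hi
      simp
    · rw [updateRow_ne hi]
      simp [Equiv.swap_apply_of_ne_of_ne, hi, hD]
  have hc : coeff e F a b = (D.det)⁻¹ * (D.updateRow b (F (e (.inl a)))).det := by
    rw [← cramer_transpose_apply, cramer_eq_adjugate_mulVec, ← adjugate_transpose, coeff_apply]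
    refine congrArg₂ (· * ·) rfl ?_
    rw [mulVec, dotProduct]
    exact Finset.sum_congr rfl fun i _ => by rw [transpose_apply, mul_comm]
  have := he ((Equiv.swap (.inl a) (.inr b)).trans e)
  rw [hswap] at this
  rw [hc, abs_mul, abs_inv]
  -- When every minor vanishes, the convention 0⁻¹ = 0 makes the coefficient 0.
  by_cases h0 : |D.det| = 0
  · rw [h0, _root_.inv_zero, zero_mul]; exact zero_le_one
  · rw [inv_mul_le_iff₀ (lt_of_le_of_ne (abs_nonneg _) (Ne.symm h0)), mul_one]
    exact this

theorem exists_bound_redMap (d k m : ℕ) : ∃ C, ∀ (e : Fin d ⊕ Fin k ≃ Fin m)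
    (F : Fin m → Fin k → ℝ), IsMax e F → ‖redMap e F‖ ≤ C := by
  let L : (Fin d → Fin m → ℝ) →ₗ[ℝ] (Fin m → ℝ) →L[ℝ] (Fin d → ℝ) :=
    (LinearMap.toContinuousLinearMap.toLinearMap ∘ₗ Matrix.toLin'.toLinearMap) ∘ₗ
      (Matrix.ofLinearEquiv ℝ).toLinearMap
  have hcomp : IsCompact (Set.pi univ fun _ : Fin d => Set.pi univ fun _ : Fin m =>
      Set.Icc (-1 : ℝ) 1) := isCompact_univ_pi fun _ => isCompact_univ_pi fun _ => isCompact_Icc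
  obtain ⟨C, hC⟩ := hcomp.exists_bound_of_continuousOn
    L.continuous_of_finiteDimensional.continuousOn
  refine ⟨C, fun e F he => hC ((fromCols 1 (-coeff e F)).submatrix id e.symm) ?_⟩
  intro a _ i _
  refine abs_le.1 ?_
  rw [submatrix_apply]
  rcases e.symm i with a' | b
  · rw [fromCols_apply_inl, id, one_apply]
    split <;> simp
  · rw [fromCols_apply_inr, id, Matrix.neg_apply, abs_neg]
    exact he.abs_coeff_le a b

theorem measurable_minor {S : Type*} [MeasurableSpace S] (e : Fin d ⊕ Fin k ≃ Fin m)
    {F : S → Fin m → Fin k → ℝ} (hF : Measurable F) : Measurable fun s => minor e (F s) := by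
  have : Continuous fun F : Fin m → Fin k → ℝ => minor e F :=
    Continuous.matrix_det (by fun_prop)
  exact this.measurable.comp hF

theorem measurable_redMap {S : Type*} [MeasurableSpace S] (e : Fin d ⊕ Fin k ≃ Fin m)
    {F : S → Fin m → Fin k → ℝ} (hF : Measurable F) : Measurable fun s => redMap e (F s) := by
  let L : (Fin d → Fin m → ℝ) →ₗ[ℝ] (Fin m → ℝ) →L[ℝ] (Fin d → ℝ) :=
    (LinearMap.toContinuousLinearMap.toLinearMap ∘ₗ Matrix.toLin'.toLinearMap) ∘ₗ
      (Matrix.ofLinearEquiv ℝ).toLinearMap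
  have hL : Measurable fun s => L ((fromCols 1 (-coeff e (F s))).submatrix id e.symm) := by
    refine L.continuous_of_finiteDimensional.measurable.comp ?_
    refine measurable_pi_lambda _ fun a => measurable_pi_lambda _ fun i => ?_
    simp only [submatrix_apply]
    rcases e.symm i with a' | b
    · exact measurable_const
    · simp only [fromCols_apply_inr, Matrix.neg_apply, coeff_apply]
      refine ((measurable_minor e hF).inv.mul (Finset.measurable_sum _ fun j _ =>
        Measurable.mul ?_ ?_)).neg
      · exact (measurable_pi_apply j).comp ((measurable_pi_apply (e (.inl a))).comp hF)
      · have hc : Continuous fun F : Fin m → Fin k → ℝ =>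
            (Matrix.of fun b => F (e (.inr b))).adjugate j b :=
          (Continuous.matrix_adjugate (by fun_prop)).matrix_elem j b
        exact hc.measurable.comp hF
  exact hL

/-- Enumerate the indices and take the first one attaining the maximum. The maximality conditions
are finite intersections of measurable sets. -/
theorem exists_measurable_argmax {S ι : Type*} [MeasurableSpace S] [Finite ι] [Nonempty ι]
    [MeasurableSpace ι] {f : ι → S → ℝ} (hf : ∀ i, Measurable (f i)) :
    ∃ σ : S → ι, Measurable σ ∧ ∀ s i, f i s ≤ f (σ s) s := by
  classical
  obtain ⟨N, ⟨ε⟩⟩ := Finite.exists_equiv_fin ι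
  have hN : ∀ n : ℕ, n < N ∨ ¬ n < N := fun n => em _
  let i₀ : ι := Classical.arbitrary ι
  let g : ℕ → ι := fun n => if h : n < N then ε.symm ⟨n, h⟩ else i₀
  have hg : ∀ i, ∃ n, g n = i := fun i => ⟨ε i, by simp [g]⟩
  have hex : ∀ s, ∃ n, ∀ i, f i s ≤ f (g n) s := fun s => by
    obtain ⟨i, hi⟩ := Finite.exists_max fun i => f i s
    obtain ⟨n, rfl⟩ := hg i
    exact ⟨n, hi⟩
  refine ⟨fun s => g (Nat.find (hex s)), ?_, fun s => Nat.find_spec (hex s)⟩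
  refine (measurable_from_nat (f := g)).comp (measurable_find hex fun n => ?_)
  have : {s | ∀ i, f i s ≤ f (g n) s} = ⋂ i, {s | f i s ≤ f (g n) s} := by ext; simp
  rw [this]
  exact MeasurableSet.iInter fun i => measurableSet_le (hf i) (hf _)

/-- This passes from degree m to degree d. With rows ordered by e, the last k columns are the two
blocks of F, and the Schur complement is the matrix of `redMap e F ∘L T` on η. -/
theorem absDet_append {V W : Type*} [NormedAddCommGroup V] [NormedSpace ℝ V]
    [NormedAddCommGroup W] [NormedSpace ℝ W] (h : d + k = m) {e : Fin d ⊕ Fin k ≃ Fin m}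
    {F : Fin m → Fin k → ℝ} (he : IsMax e F) (T : V →L[ℝ] (Fin m → ℝ)) (η : Fin d → V)
    (t : Fin d → Fin k → ℝ) (B : W →L[ℝ] (Fin m → ℝ)) (u : Fin d → W) (v : Fin k → W)
    (hv : ∀ b i, B (v b) i = F i b) (hu : ∀ l, B (u l) = T (η l) + Matrix.of F *ᵥ t l) :
    absDet B (Fin.append u v ∘ Fin.cast h.symm) =
      |minor e F| * absDet (redMap e F ∘L T) η := by
  have key := abs_det_fromBlocks (Matrix.of fun a l => T (η l) (e (.inl a)))
    (Matrix.of fun b l => T (η l) (e (.inr b))) (Matrix.of fun a => F (e (.inl a)))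
    (Matrix.of fun b => F (e (.inr b))) (Matrix.of fun b l => t l b) (fun h0 => by
      obtain ⟨t, ht, h⟩ := he.exists_mulVec_eq_zero h0
      exact ⟨t, ht, funext fun a => congrFun h (e (.inl a)), funext fun b => congrFun h (e (.inr b))⟩)
  rw [absDet, ← Matrix.abs_det_submatrix_equiv_equiv e (finSumFinEquiv.trans (finCongr h))]
  refine Eq.trans (congrArg (fun M => |Matrix.det M|) ?_) (key.trans ?_)
  · ext (a | b) (l | c)
    · simp [hu, Matrix.mul_apply, mulVec, dotProduct]
    · simp [hv]
    · simp [hu, Matrix.mul_apply, mulVec, dotProduct]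
    · simp [hv]
  · refine congrArg₂ (· * ·) rfl (congrArg (fun M => |Matrix.det M|) ?_)
    ext a l
    rw [of_apply, ContinuousLinearMap.comp_apply, redMap_apply]
    rfl

theorem det_blockDiagonal_sigma {n : ℕ} {k : Fin n → ℕ} (R : ∀ i, Matrix (Fin (k i)) (Fin (k i)) ℝ) :
    (blockDiagonal' R).det = ∏ i, (R i).det := by
  rw [(blockTriangular_blockDiagonal' R).det_fintype]
  refine Finset.prod_congr rfl fun i _ => ?_
  rw [← det_submatrix_equiv_self (Equiv.sigmaSubtype i).symm]
  congr 1
  ext a b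
  exact blockDiagonal'_apply_eq R i a b

theorem blockDiagonal'_mulVec {n : ℕ} {p k : Fin n → ℕ} (M : ∀ i, Matrix (Fin (p i)) (Fin (k i)) ℝ)
    (x : ∀ i, Fin (k i) → ℝ) (b : Σ i, Fin (p i)) :
    (blockDiagonal' M *ᵥ fun c => x c.1 c.2) b = (M b.1 *ᵥ x b.1) b.2 := by
  obtain ⟨i, b⟩ := b
  rw [mulVec, dotProduct, Fintype.sum_sigma, Finset.sum_eq_single i]
  · simp only [blockDiagonal'_apply_eq]
    rfl
  · intro j _ hj
    exact Finset.sum_eq_zero fun c _ => by rw [blockDiagonal'_apply_ne _ _ _ hj.symm, zero_mul]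
  · simp

/-- A fibre vector of one factor is killed by the maps of the others. Once the unselected rows of
all factors are put before the selected ones, the fibre columns form block diagonal matrices, so
inverse and Schur complement can be taken factor by factor. -/
theorem absDet_stackMap_append {V W : Type*} [NormedAddCommGroup V] [NormedSpace ℝ V]
    [NormedAddCommGroup W] [NormedSpace ℝ W] {n : ℕ} {d k m : Fin n → ℕ} (h : ∀ i, d i + k i = m i)
    {e : ∀ i, Fin (d i) ⊕ Fin (k i) ≃ Fin (m i)} {F : ∀ i, Fin (m i) → Fin (k i) → ℝ}
    (he : ∀ i, IsMax (e i) (F i)) (T : ∀ i, V →L[ℝ] (Fin (m i) → ℝ)) (η : Fin (∑ i, d i) → V)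
    (t : Fin (∑ i, d i) → ∀ i, Fin (k i) → ℝ) (B : ∀ i, W →L[ℝ] (Fin (m i) → ℝ))
    (u : Fin (∑ i, d i) → W) (v : Fin (∑ i, k i) → W)
    (hv : ∀ i b x, B i (v (finSigmaFinEquiv ⟨i, b⟩)) x = F i x b)
    (hv0 : ∀ i j b, i ≠ j → B i (v (finSigmaFinEquiv ⟨j, b⟩)) = 0)
    (hu : ∀ l i, B i (u l) = T i (η l) + Matrix.of (F i) *ᵥ t l i) :
    absDet (stackMap B) (Fin.append u v ∘ Fin.cast (sum_degrees h).symm) =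
      (∏ i, |minor (e i) (F i)|) * absDet (stackMap fun i => redMap (e i) (F i) ∘L T i) η := by
  let L : ∀ i, Matrix (Fin (d i)) (Fin (k i)) ℝ := fun i => Matrix.of fun a => F i (e i (.inl a))
  let R : ∀ i, Matrix (Fin (k i)) (Fin (k i)) ℝ := fun i => Matrix.of fun a => F i (e i (.inr a))
  let A₁ : Matrix (Σ i, Fin (d i)) (Σ i, Fin (d i)) ℝ := Matrix.of fun a l =>
    T a.1 (η (finSigmaFinEquiv l)) (e a.1 (.inl a.2))
  let A₂ : Matrix (Σ i, Fin (k i)) (Σ i, Fin (d i)) ℝ := Matrix.of fun b l =>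
    T b.1 (η (finSigmaFinEquiv l)) (e b.1 (.inr b.2))
  have hdet : (blockDiagonal' R).det = ∏ i, minor (e i) (F i) := det_blockDiagonal_sigma R
  have key := abs_det_fromBlocks A₁ A₂ (blockDiagonal' L) (blockDiagonal' R)
    (Matrix.of fun b l => t (finSigmaFinEquiv l) b.1 b.2) (fun h0 => by
      rw [hdet, Finset.prod_eq_zero_iff] at h0
      obtain ⟨i, -, hi⟩ := h0
      obtain ⟨t, ht, h⟩ := (he i).exists_mulVec_eq_zero hi
      have hne : Function.update (0 : ∀ i, Fin (k i) → ℝ) i t ≠ 0 := fun h0 => ht (by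
        simpa using congrFun h0 i)
      have hz : ∀ j, Matrix.of (F j) *ᵥ Function.update (0 : ∀ i, Fin (k i) → ℝ) i t j = 0 :=
        fun j => by
          by_cases hj : j = i
          · subst hj; simpa using h
          · simp [Function.update_of_ne hj]
      refine ⟨fun c => Function.update (0 : ∀ i, Fin (k i) → ℝ) i t c.1 c.2, fun h0 => hne ?_,
        ?_, ?_⟩
      · ext j c
        exact congrFun h0 ⟨j, c⟩
      · ext ⟨j, a⟩
        rw [blockDiagonal'_mulVec L]
        exact congrFun (hz j) (e j (.inl a))
      · ext ⟨j, a⟩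
        rw [blockDiagonal'_mulVec R]
        exact congrFun (hz j) (e j (.inr a)))
  -- `e₁` reorders rows, which are stacked factor by factor, while `e₂` reorders columns, where all
  -- base vectors precede all fibre vectors. Using two unrelated reorderings is harmless inside
  -- |det|.
  let e₁ : (Σ i, Fin (d i)) ⊕ (Σ i, Fin (k i)) ≃ Fin (∑ i, m i) :=
    ((Equiv.sigmaSumDistrib _ _).symm.trans (Equiv.sigmaCongrRight e)).trans finSigmaFinEquiv
  let e₂ : (Σ i, Fin (d i)) ⊕ (Σ i, Fin (k i)) ≃ Fin (∑ i, m i) :=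
    (Equiv.sumCongr finSigmaFinEquiv finSigmaFinEquiv).trans
      (finSumFinEquiv.trans (finCongr (sum_degrees h)))
  rw [absDet, ← Matrix.abs_det_submatrix_equiv_equiv e₁ e₂]
  have hl : ∀ i (a : Fin (d i)) x, stackMap B x (e₁ (.inl ⟨i, a⟩)) = B i x (e i (.inl a)) :=
    fun i a x => stackMap_apply_mk B x ⟨i, e i (.inl a)⟩
  have hr : ∀ i (a : Fin (k i)) x, stackMap B x (e₁ (.inr ⟨i, a⟩)) = B i x (e i (.inr a)) :=
    fun i a x => stackMap_apply_mk B x ⟨i, e i (.inr a)⟩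
  have hcl : ∀ l, (Fin.append u v ∘ Fin.cast (sum_degrees h).symm) (e₂ (.inl l)) =
      u (finSigmaFinEquiv l) := fun l => by simp [e₂]
  have hcr : ∀ l, (Fin.append u v ∘ Fin.cast (sum_degrees h).symm) (e₂ (.inr l)) =
      v (finSigmaFinEquiv l) := fun l => by simp [e₂]
  refine Eq.trans (congrArg (fun M => |Matrix.det M|) ?_) (key.trans ?_)
  · ext (⟨i, a⟩ | ⟨i, b⟩) (l | ⟨j, c⟩)
    · rw [submatrix_apply, of_apply, hcl, hl, hu, fromBlocks_apply₁₁]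
      exact congrArg₂ (· + ·) rfl (blockDiagonal'_mulVec L (t (finSigmaFinEquiv l)) ⟨i, a⟩).symm
    · rw [submatrix_apply, of_apply, hcr, hl, fromBlocks_apply₁₂]
      by_cases hij : i = j
      · subst hij
        rw [hv, blockDiagonal'_apply_eq]; rfl
      · rw [hv0 i j c hij, blockDiagonal'_apply_ne _ _ _ hij, Pi.zero_apply]
    · rw [submatrix_apply, of_apply, hcl, hr, hu, fromBlocks_apply₂₁]
      exact congrArg₂ (· + ·) rfl (blockDiagonal'_mulVec R (t (finSigmaFinEquiv l)) ⟨i, b⟩).symm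
    · rw [submatrix_apply, of_apply, hcr, hr, fromBlocks_apply₂₂]
      by_cases hij : i = j
      · subst hij
        rw [hv, blockDiagonal'_apply_eq]; rfl
      · rw [hv0 i j c hij, blockDiagonal'_apply_ne _ _ _ hij, Pi.zero_apply]
  rw [hdet, Finset.abs_prod]
  -- If one block is singular, the inverse of the block matrix need not be blockwise, but both sides
  -- carry the factor 0.
  by_cases h0 : ∏ i, |minor (e i) (F i)| = 0
  · rw [h0, zero_mul, zero_mul]
  refine congrArg₂ (· * ·) rfl ?_
  have hinv : (blockDiagonal' R)⁻¹ = blockDiagonal' fun i => (R i)⁻¹ := by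
    refine inv_eq_left_inv ?_
    rw [← blockDiagonal'_mul, ← blockDiagonal'_one]
    congr 1
    ext1 i
    refine nonsing_inv_mul _ (isUnit_iff_ne_zero.2 fun hi => h0 ?_)
    exact Finset.prod_eq_zero (Finset.mem_univ i) (abs_eq_zero.2 hi)
  rw [absDet, ← Matrix.abs_det_submatrix_equiv_equiv finSigmaFinEquiv finSigmaFinEquiv, hinv,
    ← blockDiagonal'_mul]
  refine congrArg (fun M => |Matrix.det M|) ?_
  ext ⟨i, a⟩ l
  rw [submatrix_apply, of_apply, stackMap_apply_mk, ContinuousLinearMap.comp_apply, redMap_apply]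
  exact congrArg₂ (· - ·) rfl (blockDiagonal'_mulVec (fun i => L i * (R i)⁻¹)
    (fun i b => T i (η (finSigmaFinEquiv l)) (e i (.inr b))) ⟨i, a⟩)

end Reduction

/-! ### Independence of fibre integrals from the decomposition. -/

section Parametrization

variable {E : Type*} [NormedAddCommGroup E] [NormedSpace ℝ E] {H : Type*} [TopologicalSpace H]
  {I : ModelWithCorners ℝ E H} {X : Type*} [TopologicalSpace X] [ChartedSpace H X]

variable (I) in
/-- A decomposition of a submanifold `S` of `X` as in `ParamDecomposition`, where the inverses of
the parametrizations extend to smooth maps on open subsets of `X`. -/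
structure IsParam (S : Set X) {k : ℕ} {ι : Type*} (dom piece : ι → Set (Fin k → ℝ))
    (param : ι → (Fin k → ℝ) → X) : Prop where
  isOpen_dom : ∀ j, IsOpen (dom j)
  piece_subset : ∀ j, piece j ⊆ dom j
  measurableSet_piece : ∀ j, MeasurableSet (piece j)
  contMDiffOn : ∀ j, ContMDiffOn 𝓘(ℝ, Fin k → ℝ) I ∞ (param j) (dom j)
  exists_chart : ∀ j, ∃ (N : Set X) (κ : X → Fin k → ℝ), IsOpen N ∧
    ContMDiffOn I 𝓘(ℝ, Fin k → ℝ) ∞ κ N ∧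
    (∀ u ∈ dom j, param j u ∈ S ∩ N ∧ κ (param j u) = u) ∧
    ∀ x ∈ S ∩ N, κ x ∈ dom j ∧ param j (κ x) = x
  disjoint : ∀ i j, i ≠ j → Disjoint (param i '' piece i) (param j '' piece j)
  cover : ⋃ j, param j '' piece j = S

variable {S : Set X} {k : ℕ} {ι : Type*} {dom piece : ι → Set (Fin k → ℝ)}
  {param : ι → (Fin k → ℝ) → X}

namespace IsParam

theorem injOn (hQ : IsParam I S dom piece param) (j : ι) : InjOn (param j) (dom j) := by
  obtain ⟨N, κ, -, -, h, -⟩ := hQ.exists_chart j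
  intro u hu v hv huv
  rw [← (h u hu).2, huv, (h v hv).2]

theorem injective_mfderiv (hQ : IsParam I S dom piece param) (j : ι) {u : Fin k → ℝ}
    (hu : u ∈ dom j) : Function.Injective (mfderiv 𝓘(ℝ, Fin k → ℝ) I (param j) u) := by
  obtain ⟨N, κ, hN, hκ, h, -⟩ := hQ.exists_chart j
  have h1 : MDifferentiableAt 𝓘(ℝ, Fin k → ℝ) I (param j) u :=
    ((hQ.contMDiffOn j).contMDiffAt ((hQ.isOpen_dom j).mem_nhds hu)).mdifferentiableAt (by simp)
  have h2 : MDifferentiableAt I 𝓘(ℝ, Fin k → ℝ) κ (param j u) :=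
    (hκ.contMDiffAt (hN.mem_nhds (h u hu).1.2)).mdifferentiableAt (by simp)
  have h3 : κ ∘ param j =ᶠ[𝓝 u] id := by
    filter_upwards [(hQ.isOpen_dom j).mem_nhds hu] with v hv using (h v hv).2
  have h4 := mfderiv_comp u h2 h1
  rw [h3.mfderiv_eq, mfderiv_id] at h4
  intro v w hvw
  have := fun v => congrArg (fun L => L v) h4
  exact (this v).trans ((congrArg _ hvw).trans (this w).symm)

theorem nonempty [Finite ι] (hQ : IsParam I S dom piece param) :
    Nonempty (ParamDecomposition I S k) := by
  obtain ⟨N, ⟨ε⟩⟩ := Finite.exists_equiv_fin ι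
  exact ⟨{
    N := N
    dom := dom ∘ ε.symm
    piece := piece ∘ ε.symm
    param := param ∘ ε.symm
    isOpen_dom := fun j => hQ.isOpen_dom _
    piece_subset := fun j => hQ.piece_subset _
    measurableSet_piece := fun j => hQ.measurableSet_piece _
    contMDiffOn := fun j => hQ.contMDiffOn _
    injOn := fun j => hQ.injOn _
    immersion := fun j u hu => hQ.injective_mfderiv _ hu
    mapsTo := fun j u hu => by
      obtain ⟨N, κ, -, -, h, -⟩ := hQ.exists_chart (ε.symm j)
      exact (h u hu).1.1
    disjoint := fun i j hij => hQ.disjoint _ _ (ε.symm.injective.ne hij)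
    cover := by
      rw [← hQ.cover]
      exact ε.symm.surjective.iUnion_comp fun j => param j '' piece j }⟩

/-- The density `ρ` in the parametrization `f`. -/
def _root_.NormalDensity.DensityFamily.along (ρ : DensityFamily I X k) (f : (Fin k → ℝ) → X)
    (u : Fin k → ℝ) : ℝ :=
  ρ (f u) fun i => mfderiv 𝓘(ℝ, Fin k → ℝ) I f u (Pi.single i (1 : ℝ))

/-- Change of parametrization. -/
theorem exists_transition (hQ : IsParam I S dom piece param) (i : ι)
    {f : (Fin k → ℝ) → X} {U : Set (Fin k → ℝ)} (hU : IsOpen U)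
    (hf : ContMDiffOn 𝓘(ℝ, Fin k → ℝ) I ∞ f U) (hinj : InjOn f U) (hfS : MapsTo f U S)
    {ρ : DensityFamily I X k}
    (hρ : ∀ x ∈ S, ∀ (v : Fin k → TangentSpace I x) (N : Fin k → Fin k → ℝ),
      ρ x (fun c => ∑ b, N c b • v b) = |(Matrix.of N).det| * ρ x v) :
    ∃ (O : Set (Fin k → ℝ)) (τ : (Fin k → ℝ) → Fin k → ℝ), IsOpen O ∧ O ⊆ U ∧
      DifferentiableOn ℝ τ O ∧ InjOn τ O ∧ (∀ u ∈ O, τ u ∈ dom i ∧ param i (τ u) = f u) ∧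
      (∀ u ∈ U, ∀ v ∈ dom i, param i v = f u → u ∈ O ∧ τ u = v) ∧
      ∀ u ∈ O, ρ.along f u = |(fderiv ℝ τ u).det| * ρ.along (param i) (τ u) := by
  obtain ⟨N, κ, hN, hκ, h1, h2⟩ := hQ.exists_chart i
  -- The transition map is κ ∘ f, with κ the smooth extension to N of the inverse of `param i`. It
  -- is smooth because κ is defined on an open set of X and not merely on S.
  have hO : IsOpen (U ∩ f ⁻¹' N) := hf.continuousOn.isOpen_inter_preimage hU hN
  have hτ : ContDiffOn ℝ ∞ (κ ∘ f) (U ∩ f ⁻¹' N) := by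
    rw [← contMDiffOn_iff_contDiffOn]
    exact hκ.comp (hf.mono inter_subset_left) inter_subset_right
  have hd : DifferentiableOn ℝ (κ ∘ f) (U ∩ f ⁻¹' N) := hτ.differentiableOn (by simp)
  have hp : ∀ u ∈ U ∩ f ⁻¹' N, (κ ∘ f) u ∈ dom i ∧ param i ((κ ∘ f) u) = f u := fun u hu =>
    h2 _ ⟨hfS hu.1, hu.2⟩
  refine ⟨U ∩ f ⁻¹' N, κ ∘ f, hO, inter_subset_left, hd, ?_, hp, ?_, ?_⟩
  · intro u hu v hv huv
    refine hinj hu.1 hv.1 ?_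
    rw [← (hp u hu).2, huv, (hp v hv).2]
  · intro u hu v hv huv
    refine ⟨⟨hu, ?_⟩, ?_⟩
    · rw [mem_preimage, ← huv]; exact (h1 v hv).1.2
    · rw [Function.comp_apply, ← huv]; exact (h1 v hv).2
  · intro u hu
    set τ := κ ∘ f with hτdef
    have h3 : MDifferentiableAt 𝓘(ℝ, Fin k → ℝ) I (param i) (τ u) :=
      ((hQ.contMDiffOn i).contMDiffAt
        ((hQ.isOpen_dom i).mem_nhds (hp u hu).1)).mdifferentiableAt (by simp)
    have h4 : MDifferentiableAt 𝓘(ℝ, Fin k → ℝ) 𝓘(ℝ, Fin k → ℝ) τ u :=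
      (hd.differentiableAt (hO.mem_nhds hu)).mdifferentiableAt
    have h5 : f =ᶠ[𝓝 u] param i ∘ τ := by
      filter_upwards [hO.mem_nhds hu] with v hv using (hp v hv).2.symm
    have h6 : mfderiv 𝓘(ℝ, Fin k → ℝ) I f u =
        (mfderiv 𝓘(ℝ, Fin k → ℝ) I (param i) (τ u)).comp (fderiv ℝ τ u) := by
      rw [h5.mfderiv_eq, mfderiv_comp u h3 h4, mfderiv_eq_fderiv]
      rfl
    have h7 : (fderiv ℝ τ u).det = (Matrix.of fun c b => fderiv ℝ τ u (Pi.single c 1) b).det := by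
      rw [ContinuousLinearMap.det, ← LinearMap.det_toMatrix', ← Matrix.det_transpose]
      congr 1
    rw [DensityFamily.along, DensityFamily.along, h7]
    have h8 := hρ (param i (τ u)) (by rw [(hp u hu).2]; exact hfS hu.1)
      (fun b => mfderiv 𝓘(ℝ, Fin k → ℝ) I (param i) (τ u) (Pi.single b (1 : ℝ)))
      (fun c b => fderiv ℝ τ u (Pi.single c 1) b)
    rw [← h8]
    have h9 : ∀ {x x' : X} (hx : x = x') (v : Fin k → E), (ρ x v : ℝ) = ρ x' v := by
      rintro x _ rfl v; rfl
    refine (h9 (hp u hu).2.symm _).trans (congrArg _ (funext fun c => ?_))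
    rw [h6]
    change mfderiv 𝓘(ℝ, Fin k → ℝ) I (param i) (τ u) (fderiv ℝ τ u (Pi.single c 1)) = _
    conv_lhs => rw [← Finset.univ_sum_single (fderiv ℝ τ u (Pi.single c 1))]
    refine (map_sum (mfderiv 𝓘(ℝ, Fin k → ℝ) I (param i) (τ u)) _ _).trans
      (Finset.sum_congr rfl fun b _ => ?_)
    refine Eq.trans (congrArg _ ?_)
      (map_smul (mfderiv 𝓘(ℝ, Fin k → ℝ) I (param i) (τ u)) (fderiv ℝ τ u (Pi.single c 1) b) _)
    change (Pi.single b (fderiv ℝ τ u (Pi.single c 1) b) : Fin k → ℝ) =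
      fderiv ℝ τ u (Pi.single c 1) b • (Pi.single b 1 : Fin k → ℝ)
    rw [← Pi.single_smul, smul_eq_mul, mul_one]

/-- Cut both decompositions into their common refinement and apply the change of variables formula
on each part. P must be arbitrary, since `integralOver` uses an unspecified one. -/
theorem integral_eq [Fintype ι] (hQ : IsParam I S dom piece param)
    (P : ParamDecomposition I S k) {ρ : DensityFamily I X k}
    (hρ : ∀ x ∈ S, ∀ (v : Fin k → TangentSpace I x) (N : Fin k → Fin k → ℝ),
      ρ x (fun c => ∑ b, N c b • v b) = |(Matrix.of N).det| * ρ x v)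
    (hint : ∀ i, IntegrableOn (ρ.along (param i)) (piece i)) :
    P.integral I ρ = ∑ i, ∫ u in piece i, ρ.along (param i) u := by
  classical
  choose O τ hO hOU hd hinj h1 h2 h3 using fun j i => hQ.exists_transition i (P.isOpen_dom j)
    (P.contMDiffOn j) (P.injOn j) (P.mapsTo j) hρ
  let A : Fin P.N → ι → Set (Fin k → ℝ) := fun j i => P.piece j ∩ (O j i ∩ τ j i ⁻¹' piece i)
  have hA : ∀ j i, MeasurableSet (A j i) := fun j i => by
    refine (P.measurableSet_piece j).inter ?_
    -- The transition map is controlled only on `O j i`. Extending it by 0 gives a globally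
    -- measurable function with the same trace there.
    have := (hd j i).continuousOn.measurable_piecewise (g := fun _ => 0) continuousOn_const
      (hO j i).measurableSet
    have h4 : O j i ∩ τ j i ⁻¹' piece i =
        O j i ∩ ((O j i).piecewise (τ j i) fun _ => 0) ⁻¹' piece i := by
      ext u
      refine and_congr_right fun hu => ?_
      rw [mem_preimage, mem_preimage, Set.piecewise_eq_of_mem _ _ _ hu]
    rw [h4]
    exact (hO j i).measurableSet.inter (this (hQ.measurableSet_piece i))
  have hAO : ∀ j i, A j i ⊆ O j i := fun j i u hu => hu.2.1
  have hderiv : ∀ j i, ∀ u ∈ A j i,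
      HasFDerivWithinAt (τ j i) (fderiv ℝ (τ j i) u) (A j i) u := fun j i u hu =>
    ((hd j i).differentiableAt ((hO j i).mem_nhds (hAO j i hu))).hasFDerivAt.hasFDerivWithinAt
  have hinjA : ∀ j i, InjOn (τ j i) (A j i) := fun j i => (hinj j i).mono (hAO j i)
  have himg : ∀ j i, MeasurableSet (τ j i '' A j i) := fun j i =>
    measurable_image_of_fderivWithin (hA j i) (hderiv j i) (hinjA j i)
  have hsub : ∀ j i, τ j i '' A j i ⊆ piece i := by
    rintro j i _ ⟨u, hu, rfl⟩
    exact hu.2.2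
  have hpieceA : ∀ j, P.piece j = ⋃ i, A j i := fun j => by
    refine Subset.antisymm (fun u hu => ?_) (iUnion_subset fun i => inter_subset_left)
    obtain ⟨i, v, hv, hvu⟩ := mem_iUnion.1 (hQ.cover.ge (P.mapsTo j (P.piece_subset j hu)))
    obtain ⟨h4, h5⟩ := h2 j i u (P.piece_subset j hu) v (hQ.piece_subset i hv) hvu
    exact mem_iUnion.2 ⟨i, hu, h4, by rw [mem_preimage, h5]; exact hv⟩
  have hpieceB : ∀ i, piece i = ⋃ j, τ j i '' A j i := fun i => by
    refine Subset.antisymm (fun v hv => ?_) (iUnion_subset fun j => hsub j i)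
    have hS : param i v ∈ S := hQ.cover.le (mem_iUnion.2 ⟨i, v, hv, rfl⟩)
    obtain ⟨j, u, hu, huv⟩ := mem_iUnion.1 (P.cover.ge hS)
    obtain ⟨h4, h5⟩ := h2 j i u (P.piece_subset j hu) v (hQ.piece_subset i hv) huv.symm
    exact mem_iUnion.2 ⟨j, u, ⟨hu, h4, by rw [mem_preimage, h5]; exact hv⟩, h5⟩
  have hdisjA : ∀ j, Pairwise (Function.onFun Disjoint (A j)) := fun j i i' hii => by
    rw [Function.onFun, Set.disjoint_left]
    intro u hu hu'
    refine Set.disjoint_left.1 (hQ.disjoint i i' hii) ⟨_, hu.2.2, (h1 j i u hu.2.1).2⟩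
      ⟨_, hu'.2.2, (h1 j i' u hu'.2.1).2⟩
  have hdisjB : ∀ i, Pairwise (Function.onFun Disjoint fun j => τ j i '' A j i) :=
    fun i j j' hjj => by
    rw [Function.onFun, Set.disjoint_left]
    rintro _ ⟨u, hu, rfl⟩ ⟨u', hu', huu⟩
    refine Set.disjoint_left.1 (P.disjoint j j' hjj) ⟨u, hu.1, rfl⟩ ⟨u', hu'.1, ?_⟩
    rw [← (h1 j i u hu.2.1).2, ← (h1 j' i u' hu'.2.1).2, huu]
  have hintB : ∀ j i, IntegrableOn (ρ.along (param i)) (τ j i '' A j i) := fun j i =>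
    (hint i).mono_set (hsub j i)
  have hcongr : ∀ j i, EqOn (fun u => |(fderiv ℝ (τ j i) u).det| • ρ.along (param i) (τ j i u))
      (ρ.along (P.param j)) (A j i) := fun j i u hu => (h3 j i u (hAO j i hu)).symm
  have hintA : ∀ j i, IntegrableOn (ρ.along (P.param j)) (A j i) := fun j i => by
    rw [← integrableOn_congr_fun (hcongr j i) (hA j i)]
    exact (integrableOn_image_iff_integrableOn_abs_det_fderiv_smul volume (hA j i) (hderiv j i)
      (hinjA j i) _).1 (hintB j i)
  have e1 : ∀ j, ∫ u in P.piece j, ρ.along (P.param j) u =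
      ∑ i, ∫ u in A j i, ρ.along (P.param j) u := fun j => by
    rw [hpieceA j]
    exact integral_iUnion_fintype (hA j) (hdisjA j) (hintA j)
  have e2 : ∀ i, ∫ u in piece i, ρ.along (param i) u =
      ∑ j, ∫ u in τ j i '' A j i, ρ.along (param i) u := fun i => by
    conv_lhs => rw [hpieceB i]
    exact integral_iUnion_fintype (fun j => himg j i) (hdisjB i) fun j => hintB j i
  change ∑ j, ∫ u in P.piece j, ρ.along (P.param j) u = _
  simp_rw [e1, e2]
  rw [Finset.sum_comm]
  refine Finset.sum_congr rfl fun i _ => Finset.sum_congr rfl fun j _ => ?_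
  rw [integral_image_eq_integral_abs_det_fderiv_smul volume (hA j i) (hderiv j i) (hinjA j i)]
  exact (setIntegral_congr_fun (hA j i) (hcongr j i)).symm

theorem integralOver_eq [Fintype ι] (hQ : IsParam I S dom piece param) {ρ : DensityFamily I X k}
    (hρ : ∀ x ∈ S, ∀ (v : Fin k → TangentSpace I x) (N : Fin k → Fin k → ℝ),
      ρ x (fun c => ∑ b, N c b • v b) = |(Matrix.of N).det| * ρ x v)
    (hint : ∀ i, IntegrableOn (ρ.along (param i)) (piece i)) :
    integralOver I S ρ = ∑ i, ∫ u in piece i, ρ.along (param i) u := by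
  rw [integralOver, dif_pos hQ.nonempty]
  exact hQ.integral_eq _ hρ hint

end IsParam

end Parametrization

/-! ### Column operations on base and fibre vectors. -/

section LocalFormula

open scoped Matrix

/-- The `m` vectors `A η₁, …, A η_d, F e₁, …, F e_k`. -/
def columns {V W : Type*} [NormedAddCommGroup V] [NormedSpace ℝ V] [NormedAddCommGroup W]
    [NormedSpace ℝ W] {d k m : ℕ} (h : d + k = m) (A : V →L[ℝ] W) (F : (Fin k → ℝ) →L[ℝ] W)
    (η : Fin d → V) : Fin m → W :=
  Fin.append (fun l => A (η l)) (fun b => F (Pi.single b 1)) ∘ Fin.cast h.symm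

theorem continuous_columns {V W : Type*} [NormedAddCommGroup V] [NormedSpace ℝ V]
    [NormedAddCommGroup W] [NormedSpace ℝ W] {d k m : ℕ} (h : d + k = m) :
    Continuous fun x : (V →L[ℝ] W) × ((Fin k → ℝ) →L[ℝ] W) × (Fin d → V) =>
      columns h x.1 x.2.1 x.2.2 := by
  subst h
  refine continuous_pi fun i => ?_
  refine Fin.addCases (fun l => ?_) (fun b => ?_) i
  · simp only [columns, Fin.cast_refl, Function.comp_id, Fin.append_left]
    fun_prop
  · simp only [columns, Fin.cast_refl, Function.comp_id, Fin.append_right]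
    fun_prop

/-- The new columns arise from the old ones by a block triangular matrix with diagonal blocks 1 and
N. The case N = 1 gives independence of the lift, and t = 0 gives the transformation rule of a
density along the fibre. -/
theorem absDet_append_comb {W : Type*} [NormedAddCommGroup W] [NormedSpace ℝ W] {d k m : ℕ}
    (h : d + k = m) (T : W →L[ℝ] (Fin m → ℝ)) (u : Fin d → W) (v : Fin k → W)
    (t : Fin d → Fin k → ℝ) (N : Fin k → Fin k → ℝ) :
    absDet T (Fin.append (fun l => u l + ∑ b, t l b • v b) (fun c => ∑ b, N c b • v b) ∘
      Fin.cast h.symm) = |(Matrix.of N).det| * absDet T (Fin.append u v ∘ Fin.cast h.symm) := by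
  subst h
  have hM : ∀ w : Fin (d + k) → W, absDet T w =
      |((Matrix.of fun i j => T (w j) i).submatrix finSumFinEquiv finSumFinEquiv).det| := fun w =>
    (Matrix.abs_det_submatrix_equiv_equiv finSumFinEquiv finSumFinEquiv _).symm
  have hN : |(Matrix.of N).det| = |(Matrix.fromBlocks 1 0 (Matrix.of t)ᵀ (Matrix.of N)ᵀ).det| := by
    rw [Matrix.det_fromBlocks_zero₁₂, Matrix.det_one, one_mul, Matrix.det_transpose]
  rw [hM, hM, hN, mul_comm, ← abs_mul, ← Matrix.det_mul]
  congr 2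
  ext i (l | c)
  · simp [Matrix.mul_apply, Matrix.one_apply, mul_comm]
  · simp [Matrix.mul_apply, mul_comm]

theorem comp_append {W W' : Type*} {d k m : ℕ} (h : d + k = m) (L : W → W') (a : Fin d → W)
    (b : Fin k → W) : (fun l => L ((Fin.append a b ∘ Fin.cast h.symm) l)) =
      Fin.append (fun l => L (a l)) (fun c => L (b c)) ∘ Fin.cast h.symm := by
  subst h
  funext i
  refine Fin.addCases (fun l => ?_) (fun b => ?_) i <;> simp

end LocalFormula

/-! ### The Gelfand transform in local coordinates. -/

section LocalData

variable {E : Type*} [NormedAddCommGroup E] [NormedSpace ℝ E] {H : Type*} [TopologicalSpace H]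
  (I : ModelWithCorners ℝ E H)
  {E' : Type*} [NormedAddCommGroup E'] [NormedSpace ℝ E'] {H' : Type*} [TopologicalSpace H']
  (J : ModelWithCorners ℝ E' H')
  {E'' : Type*} [NormedAddCommGroup E''] [NormedSpace ℝ E'']
  {H'' : Type*} [TopologicalSpace H''] (K : ModelWithCorners ℝ E'' H'')
  {X : Type*} [TopologicalSpace X] [ChartedSpace H X]
  {Y : Type*} [TopologicalSpace Y] [ChartedSpace H' Y]
  {Γ : Type*} [TopologicalSpace Γ] [ChartedSpace H'' Γ]
  {m : ℕ}

/-- Local coordinates for a double fibration `Y ← X → Γ` and a top density `Φ` on `Γ`, over the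
image of a set `U` under a local parametrization `φ` of `Y`: the fibres over `φ z` are parametrized
by `u ∈ ℝ^k`, the density `Φ` at `q (param z u)` is `coef * |det (T ∘ C)|`, and the map `C ∘ dq` is
given by `A` in the directions of `Y` and by `F` in the directions of the fibre. -/
structure LocalData (p : X → Y) (q : X → Γ) (Φ : DensityFamily K Γ m) (φ : E' → Y) (k : ℕ)
    {W : Type*} [NormedAddCommGroup W] [NormedSpace ℝ W] (T : W →L[ℝ] (Fin m → ℝ)) (U : Set E')
    (ι : Type) where
  dom : ι → Set (Fin k → ℝ)
  piece : ι → Set (Fin k → ℝ)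
  cell : ι → Set (Fin k → ℝ)
  param : ι → E' → (Fin k → ℝ) → X
  coef : ι → E' × (Fin k → ℝ) → ℝ
  C : ι → E' × (Fin k → ℝ) → E'' →L[ℝ] W
  A : ι → E' × (Fin k → ℝ) → E' →L[ℝ] W
  F : ι → E' × (Fin k → ℝ) → (Fin k → ℝ) →L[ℝ] W
  isParam : ∀ z ∈ U, IsParam I (p ⁻¹' {φ z}) dom piece fun j => param j z
  measurableSet_piece : ∀ j, MeasurableSet (piece j)
  piece_subset_cell : ∀ j, piece j ⊆ cell j
  isCompact_cell : ∀ j, IsCompact (cell j)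
  continuousOn_coef : ∀ j, ContinuousOn (coef j) (U ×ˢ cell j)
  continuousOn_A : ∀ j, ContinuousOn (A j) (U ×ˢ cell j)
  continuousOn_F : ∀ j, ContinuousOn (F j) (U ×ˢ cell j)
  density_eq : ∀ j, ∀ z ∈ U, ∀ u ∈ piece j, ∀ w : Fin m → TangentSpace K (q (param j z u)),
    Φ (q (param j z u)) w = coef j (z, u) * absDet T fun l => C j (z, u) (w l)
  fiber_eq : ∀ j, ∀ z ∈ U, ∀ u ∈ piece j, ∀ v : Fin k → ℝ,
    C j (z, u) (mfderiv I K q (param j z u) (mfderiv 𝓘(ℝ, Fin k → ℝ) I (param j z) u v)) =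
      F j (z, u) v
  lift_eq : ∀ j, ∀ z ∈ U, ∀ u ∈ piece j, ∀ (ξ : TangentSpace I (param j z u)) (ζ : E'),
    mfderiv I J p (param j z u) ξ = mfderiv 𝓘(ℝ, E') J φ z ζ →
    ∃ t : Fin k → ℝ, C j (z, u) (mfderiv I K q (param j z u) ξ) = A j (z, u) ζ + F j (z, u) t
  surjective : ∀ j, ∀ z ∈ U, ∀ u ∈ piece j,
    Function.Surjective (mfderiv I J p (param j z u))

namespace LocalData

variable {I J K} {p : X → Y} {q : X → Γ} {Φ : DensityFamily K Γ m} {φ : E' → Y} {k : ℕ}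
  {W : Type*} [NormedAddCommGroup W] [NormedSpace ℝ W] {T : W →L[ℝ] (Fin m → ℝ)} {U : Set E'}
  {ι : Type} {d : ℕ}

/-- The integrand of the Gelfand transform in local coordinates. -/
def integrand (D : LocalData I J K p q Φ φ k T U ι) (h : d + k = m) (j : ι) (z : E')
    (η : Fin d → E') (u : Fin k → ℝ) : ℝ :=
  D.coef j (z, u) * absDet T (columns h (D.A j (z, u)) (D.F j (z, u)) η)

theorem continuousOn_integrand (D : LocalData I J K p q Φ φ k T U ι) (h : d + k = m) (j : ι) :
    ContinuousOn (fun x : (E' × (Fin d → E')) × (Fin k → ℝ) => D.integrand h j x.1.1 x.1.2 x.2)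
      ((U ×ˢ univ) ×ˢ D.cell j) := by
  have hmap : MapsTo (fun x : (E' × (Fin d → E')) × (Fin k → ℝ) => (x.1.1, x.2))
      ((U ×ˢ univ) ×ˢ D.cell j) (U ×ˢ D.cell j) := fun x hx => ⟨hx.1.1, hx.2⟩
  have hc : ContinuousOn (fun x : (E' × (Fin d → E')) × (Fin k → ℝ) => (x.1.1, x.2))
      ((U ×ˢ univ) ×ˢ D.cell j) := by fun_prop
  have hη : ContinuousOn (fun x : (E' × (Fin d → E')) × (Fin k → ℝ) => x.1.2)
      ((U ×ˢ univ) ×ˢ D.cell j) := by fun_prop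
  have h1 := (continuous_columns (V := E') (W := W) h).comp_continuousOn
    (((D.continuousOn_A j).comp hc hmap).prodMk (((D.continuousOn_F j).comp hc hmap).prodMk hη))
  exact ((D.continuousOn_coef j).comp hc hmap).mul
    ((continuous_absDet.comp (Continuous.prodMk_right T)).comp_continuousOn h1)

theorem integrableOn_integrand (D : LocalData I J K p q Φ φ k T U ι) (h : d + k = m) (j : ι)
    {z : E'} (hz : z ∈ U) (η : Fin d → E') : IntegrableOn (D.integrand h j z η) (D.piece j) := by
  have h1 : ContinuousOn (D.integrand h j z η) (D.cell j) :=
    (D.continuousOn_integrand h j).comp (f := fun u => ((z, η), u)) (by fun_prop)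
      fun u hu => ⟨⟨hz, trivial⟩, hu⟩
  exact (h1.integrableOn_compact (D.isCompact_cell j)).mono_set (D.piece_subset_cell j)

theorem continuousAt_integral [FiniteDimensional ℝ E'] [Fintype ι]
    (D : LocalData I J K p q Φ φ k T U ι)
    (h : d + k = m) {z₀ : E'} (hU : U ∈ 𝓝 z₀) (η₀ : Fin d → E') :
    ContinuousAt (fun x : E' × (Fin d → E') => ∑ j, ∫ u in D.piece j, D.integrand h j x.1 x.2 u)
      (z₀, η₀) := by
  have : ProperSpace E' := FiniteDimensional.proper ℝ E'
  obtain ⟨r, hr, hrU⟩ := Metric.nhds_basis_closedBall.mem_iff.1 hU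
  refine tendsto_finsetSum _ fun j _ => ?_
  have hsub : (Metric.closedBall z₀ r ×ˢ Metric.closedBall η₀ 1) ×ˢ D.cell j ⊆
      (U ×ˢ univ) ×ˢ D.cell j := Set.prod_mono (Set.prod_mono hrU (subset_univ _)) Subset.rfl
  obtain ⟨B, hB⟩ := (((isCompact_closedBall z₀ r).prod (isCompact_closedBall η₀ 1)).prod
    (D.isCompact_cell j)).exists_bound_of_continuousOn ((D.continuousOn_integrand h j).mono hsub)
  have hnhds : Metric.closedBall z₀ r ×ˢ Metric.closedBall η₀ 1 ∈ 𝓝 (z₀, η₀) :=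
    prod_mem_nhds (Metric.closedBall_mem_nhds _ hr) (Metric.closedBall_mem_nhds _ one_pos)
  have hfin : volume (D.piece j) ≠ ⊤ :=
    ((measure_mono (D.piece_subset_cell j)).trans_lt (D.isCompact_cell j).measure_lt_top).ne
  refine continuousAt_of_dominated (bound := fun _ => B) ?_ ?_ (integrableOn_const hfin) ?_
  · filter_upwards [hnhds] with x hx
    exact (D.integrableOn_integrand h j (hrU hx.1) x.2).aestronglyMeasurable
  · filter_upwards [hnhds] with x hx
    exact (ae_restrict_iff' (D.measurableSet_piece j)).2 (Eventually.of_forall fun u hu =>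
      hB (x, u) ⟨hx, D.piece_subset_cell j hu⟩)
  · refine (ae_restrict_iff' (D.measurableSet_piece j)).2 (Eventually.of_forall fun u hu => ?_)
    refine ContinuousOn.continuousAt (s := Metric.closedBall z₀ r ×ˢ Metric.closedBall η₀ 1) ?_ hnhds
    exact ((D.continuousOn_integrand h j).mono hsub).comp (f := fun x => (x, u)) (by fun_prop)
      fun x hx => ⟨hx, D.piece_subset_cell j hu⟩

theorem density_append (D : LocalData I J K p q Φ φ k T U ι) (h : d + k = m) {j : ι} {z : E'}
    (hz : z ∈ U) {u : Fin k → ℝ} (hu : u ∈ D.piece j)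
    (ξ : Fin d → TangentSpace I (D.param j z u)) (f : Fin k → TangentSpace I (D.param j z u)) :
    pullback I K q Φ (D.param j z u) (Fin.append ξ f ∘ Fin.cast h.symm) =
      D.coef j (z, u) * absDet T (Fin.append
        (fun l => D.C j (z, u) (mfderiv I K q (D.param j z u) (ξ l)))
        (fun b => D.C j (z, u) (mfderiv I K q (D.param j z u) (f b))) ∘ Fin.cast h.symm) := by
  refine (D.density_eq j z hz u hu _).trans ?_
  rw [← comp_append h (fun v : TangentSpace I (D.param j z u) =>
    D.C j (z, u) (mfderiv I K q (D.param j z u) v))]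

/-- The lift produced by `Function.invFun` is arbitrary. By `lift_eq` its image differs from A η
only by a combination of fibre columns, which the determinant ignores. -/
theorem gelfandTransform_eq [Fintype ι] (D : LocalData I J K p q Φ φ k T U ι) (h : d + k = m)
    {z : E'} (hz : z ∈ U) (η : Fin d → E') :
    gelfandTransform I J K p q h Φ (φ z) (fun l => mfderiv 𝓘(ℝ, E') J φ z (η l)) =
      ∑ j, ∫ u in D.piece j, D.integrand h j z η u := by
  have key : ∀ j, EqOn (DensityFamily.along (I := I) (fun x (f : Fin k → TangentSpace I x) =>
      pullback I K q Φ x (Fin.append (fun l => Function.invFun (mfderiv I J p x)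
        (mfderiv 𝓘(ℝ, E') J φ z (η l))) f ∘ Fin.cast h.symm)) (D.param j z))
      (D.integrand h j z η) (D.piece j) := by
    intro j u hu
    refine (D.density_append h hz hu _ _).trans ?_
    have hlift := fun l => D.lift_eq j z hz u hu _ (η l)
      (Function.invFun_eq (D.surjective j z hz u hu (mfderiv 𝓘(ℝ, E') J φ z (η l))))
    choose t ht using hlift
    have ht' : ∀ l, D.C j (z, u) (mfderiv I K q (D.param j z u)
        (Function.invFun (mfderiv I J p (D.param j z u)) (mfderiv 𝓘(ℝ, E') J φ z (η l)))) =
        D.A j (z, u) (η l) + ∑ b, t l b • D.F j (z, u) (Pi.single b 1) := fun l => by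
      refine (ht l).trans (congrArg _ ?_)
      conv_lhs => rw [← Finset.univ_sum_single (t l), map_sum]
      refine Finset.sum_congr rfl fun b _ => ?_
      rw [← map_smul, ← Pi.single_smul, smul_eq_mul, mul_one]
    have hf : ∀ b, D.C j (z, u) (mfderiv I K q (D.param j z u)
        (mfderiv 𝓘(ℝ, Fin k → ℝ) I (D.param j z) u (Pi.single b (1 : ℝ)))) =
        ∑ c, (1 : Matrix (Fin k) (Fin k) ℝ) c b • D.F j (z, u) (Pi.single c 1) := fun b => by
      refine (D.fiber_eq j z hz u hu _).trans ?_
      simp [Matrix.one_apply]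
    rw [funext ht', funext hf]
    refine congrArg (D.coef j (z, u) * ·) ?_
    refine (absDet_append_comb h T _ _ t fun b c => (1 : Matrix (Fin k) (Fin k) ℝ) c b).trans ?_
    have : (Matrix.of fun b c => (1 : Matrix (Fin k) (Fin k) ℝ) c b) = 1 := by
      ext b c; simp [Matrix.one_apply, eq_comm]
    rw [this, Matrix.det_one, abs_one, one_mul]
    rfl
  refine ((D.isParam z hz).integralOver_eq ?_ fun j => ?_).trans
    (Finset.sum_congr rfl fun j _ => setIntegral_congr_fun (D.measurableSet_piece j) (key j))
  · intro x hx v N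
    obtain ⟨j, u, hu, rfl⟩ := mem_iUnion.1 ((D.isParam z hz).cover.ge hx)
    rw [D.density_append h hz hu, D.density_append h hz hu, mul_left_comm]
    refine congrArg (D.coef j (z, u) * ·) ?_
    have := absDet_append_comb h T (fun l => D.C j (z, u) (mfderiv I K q (D.param j z u)
        (Function.invFun (mfderiv I J p (D.param j z u)) (mfderiv 𝓘(ℝ, E') J φ z (η l)))))
      (fun b => D.C j (z, u) (mfderiv I K q (D.param j z u) (v b))) 0 N
    simp only [Pi.zero_apply, zero_smul, Finset.sum_const_zero, add_zero] at this
    rw [← this]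
    refine congrArg (fun f => absDet T (Fin.append _ f ∘ Fin.cast h.symm)) (funext fun c => ?_)
    let L : E →L[ℝ] W := (D.C j (z, u)).comp (mfderiv I K q (D.param j z u))
    exact (map_sum L (fun b => N c b • v b) Finset.univ).trans
      (Finset.sum_congr rfl fun b _ => map_smul L (N c b) (v b))
  · exact (integrableOn_congr_fun (key j) (D.measurableSet_piece j)).2
      (D.integrableOn_integrand h j hz η)

end LocalData

end LocalData

/-! ### Differentiation on finite products of manifolds. -/

section PiManifold

variable {n : ℕ} {E : Fin n → Type*} [∀ i, NormedAddCommGroup (E i)] [∀ i, NormedSpace ℝ (E i)]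
  {M : Fin n → Type*} [∀ i, TopologicalSpace (M i)] [∀ i, ChartedSpace (E i) (M i)]
  {E' : Type*} [NormedAddCommGroup E'] [NormedSpace ℝ E'] {H' : Type*} [TopologicalSpace H']
  {I : ModelWithCorners ℝ E' H'} {N : Type*} [TopologicalSpace N] [ChartedSpace H' N]

theorem range_modelPi : range (modelPi E) = univ := eq_univ_of_forall fun z => ⟨z, rfl⟩

theorem extChartAt_modelPi_target (x : ∀ i, M i) :
    (extChartAt (modelPi E) x).target =
      univ.pi fun i => (extChartAt 𝓘(ℝ, E i) (x i)).target := by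
  have : ∀ i, (extChartAt 𝓘(ℝ, E i) (x i)).target = (chartAt (E i) (x i)).target := fun i => by
    rw [extChartAt_target, modelWithCornersSelf_coe, range_id, inter_univ]
    rfl
  rw [extChartAt_target, range_modelPi, inter_univ, funext this]
  rfl

theorem hasMFDerivAt_modelPi {f : N → ∀ i, M i} {x : N}
    {f' : ∀ i, TangentSpace I x →L[ℝ] TangentSpace 𝓘(ℝ, E i) (f x i)}
    (h : ∀ i, HasMFDerivAt I 𝓘(ℝ, E i) (fun y => f y i) x (f' i)) :
    HasMFDerivAt I (modelPi E) f x (ContinuousLinearMap.pi f' : E' →L[ℝ] ∀ i, E i) :=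
  ⟨continuousAt_pi.2 fun i => (h i).1, hasFDerivWithinAt_pi.2 fun i => (h i).2⟩

/-- Charts of the product are products of charts, so in them the evaluation map coincides with a
linear projection. -/
theorem hasMFDerivAt_apply (i : Fin n) (x : ∀ i, M i) :
    HasMFDerivAt (modelPi E) 𝓘(ℝ, E i) (fun y : ∀ i, M i => y i) x
      (ContinuousLinearMap.proj i : (∀ i, E i) →L[ℝ] E i) := by
  refine ⟨(continuous_apply i).continuousAt, ?_⟩
  refine ((ContinuousLinearMap.proj i : (∀ i, E i) →L[ℝ] E i).hasFDerivWithinAt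
    (s := range (modelPi E))).congr_of_eventuallyEq ?_
    ((extChartAt 𝓘(ℝ, E i) (x i)).right_inv (mem_extChartAt_target (x i)))
  filter_upwards [extChartAt_target_mem_nhdsWithin (I := modelPi E) x] with z hz
  rw [extChartAt_modelPi_target] at hz
  exact (extChartAt 𝓘(ℝ, E i) (x i)).right_inv (hz i trivial)

theorem contMDiffOn_modelPi {f : N → ∀ i, M i} {s : Set N} {r : WithTop ℕ∞}
    (h : ∀ i, ContMDiffOn I 𝓘(ℝ, E i) r (fun y => f y i) s) : ContMDiffOn I (modelPi E) r f s := by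
  intro x hx
  rw [contMDiffWithinAt_iff]
  refine ⟨continuousWithinAt_pi.2 fun i => (h i x hx).continuousWithinAt,
    contDiffWithinAt_pi.2 fun i => (contMDiffWithinAt_iff.1 (h i x hx)).2⟩

theorem contMDiff_apply {r : WithTop ℕ∞} (i : Fin n) :
    ContMDiff (modelPi E) 𝓘(ℝ, E i) r (fun y : ∀ i, M i => y i) := by
  intro x
  rw [contMDiffAt_iff]
  refine ⟨(continuous_apply i).continuousAt, ?_⟩
  refine (ContinuousLinearMap.contDiff
    (ContinuousLinearMap.proj i : (∀ i, E i) →L[ℝ] E i)).contDiffWithinAt.congr_of_eventuallyEq ?_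
    ((extChartAt 𝓘(ℝ, E i) (x i)).right_inv (mem_extChartAt_target (x i)))
  filter_upwards [extChartAt_target_mem_nhdsWithin (I := modelPi E) x] with z hz
  rw [extChartAt_modelPi_target] at hz
  exact (extChartAt 𝓘(ℝ, E i) (x i)).right_inv (hz i trivial)

end PiManifold

/-! ### Local data of a product of double fibrations. -/

section ProductData

/-- Each c·|det T| is the density of a one-point family with Dirac base measure. This makes the
product density on Γ explicit, again as a multiple of |det| of a stacked map. -/
theorem prodDensity_absDet {V : Type*} [NormedAddCommGroup V] [NormedSpace ℝ V]
    [FiniteDimensional ℝ V] {n : ℕ} {m : Fin n → ℕ} (c : Fin n → ℝ)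
    (T : ∀ i, V →L[ℝ] (Fin (m i) → ℝ)) (w : Fin (∑ i, m i) → V) :
    prodDensity (fun i w => c i * absDet (T i) w) w = (∏ i, c i) * absDet (stackMap T) w := by
  let D : ∀ i, CosineData V Unit (m i) := fun i =>
    { base := Measure.dirac ()
      isFinite := inferInstance
      weight := fun _ => c i
      map := fun _ => T i
      measurable_weight := measurable_const
      measurable_map := measurable_const
      bdd_weight := ⟨_, fun _ => le_rfl⟩
      bdd_map := ⟨_, fun _ => le_rfl⟩ }
  have h : (fun i w => c i * absDet (T i) w) = fun i => (D i).density := by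
    ext i w
    exact (integral_dirac (fun _ : Unit => c i * absDet (T i) w) ()).symm
  rw [h, CosineData.prodDensity_density, CosineData.density, integral_unique]
  simp [CosineData.pi, Measure.real, D]

variable {n : ℕ} {EX EY EΓ W : Fin n → Type*}
  [∀ i, NormedAddCommGroup (EX i)] [∀ i, NormedSpace ℝ (EX i)]
  [∀ i, NormedAddCommGroup (EY i)] [∀ i, NormedSpace ℝ (EY i)]
  [∀ i, NormedAddCommGroup (EΓ i)] [∀ i, NormedSpace ℝ (EΓ i)] [∀ i, FiniteDimensional ℝ (EΓ i)]
  [∀ i, NormedAddCommGroup (W i)] [∀ i, NormedSpace ℝ (W i)]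
  {X Y Γ : Fin n → Type*}
  [∀ i, TopologicalSpace (X i)] [∀ i, ChartedSpace (EX i) (X i)]
  [∀ i, TopologicalSpace (Y i)] [∀ i, ChartedSpace (EY i) (Y i)]
  [∀ i, TopologicalSpace (Γ i)] [∀ i, ChartedSpace (EΓ i) (Γ i)]
  {k m : Fin n → ℕ}

theorem hasMFDerivAt_pi_map {p : ∀ i, X i → Y i} {x : ∀ i, X i}
    (h : ∀ i, MDifferentiableAt 𝓘(ℝ, EX i) 𝓘(ℝ, EY i) (p i) (x i)) :
    HasMFDerivAt (modelPi EX) (modelPi EY) (fun (x : ∀ i, X i) i => p i (x i)) x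
      (ContinuousLinearMap.pi fun i => (mfderiv 𝓘(ℝ, EX i) 𝓘(ℝ, EY i) (p i) (x i) :
        EX i →L[ℝ] EY i) ∘L ContinuousLinearMap.proj i : (∀ i, EX i) →L[ℝ] ∀ i, EY i) :=
  hasMFDerivAt_modelPi fun i => (h i).hasMFDerivAt.comp x (hasMFDerivAt_apply i x)

theorem hasMFDerivAt_pi_param {V : Type*} [NormedAddCommGroup V] [NormedSpace ℝ V]
    {V' : Fin n → Type*} [∀ i, NormedAddCommGroup (V' i)] [∀ i, NormedSpace ℝ (V' i)]
    {f : ∀ i, V' i → X i} (L : ∀ i, V →L[ℝ] V' i) {u : V}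
    (h : ∀ i, MDifferentiableAt 𝓘(ℝ, V' i) 𝓘(ℝ, EX i) (f i) (L i u)) :
    HasMFDerivAt 𝓘(ℝ, V) (modelPi EX) (fun u i => f i (L i u)) u
      (ContinuousLinearMap.pi fun i => (mfderiv 𝓘(ℝ, V' i) 𝓘(ℝ, EX i) (f i) (L i u) :
        V' i →L[ℝ] EX i) ∘L L i : V →L[ℝ] ∀ i, EX i) :=
  hasMFDerivAt_modelPi fun i => (h i).hasMFDerivAt.comp u (L i).hasMFDerivAt

/-- The `i`-th block of a vector in `ℝ^{∑ k i}`. -/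
def block (k : Fin n → ℕ) (i : Fin n) : (Fin (∑ i, k i) → ℝ) →L[ℝ] (Fin (k i) → ℝ) :=
  ContinuousLinearMap.proj i ∘L
    ((sigmaL k).symm : (Fin (∑ i, k i) → ℝ) →L[ℝ] ∀ i, Fin (k i) → ℝ)

theorem block_sigmaL (x : ∀ i, Fin (k i) → ℝ) (i : Fin n) : block k i (sigmaL k x) = x i :=
  congrFun ((sigmaL k).symm_apply_apply x) i

theorem sigmaL_block (u : Fin (∑ i, k i) → ℝ) : sigmaL k (fun i => block k i u) = u :=
  (sigmaL k).apply_symm_apply u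

/-- The product of subsets of `ℝ^{k i}`, in `ℝ^{∑ k i}`. -/
def blockPi (k : Fin n → ℕ) (s : ∀ i, Set (Fin (k i) → ℝ)) : Set (Fin (∑ i, k i) → ℝ) :=
  {u | ∀ i, block k i u ∈ s i}

theorem IsParam.pi {S : ∀ i, Set (X i)} {ι : Fin n → Type*}
    {dom piece : ∀ i, ι i → Set (Fin (k i) → ℝ)} {param : ∀ i, ι i → (Fin (k i) → ℝ) → X i}
    (h : ∀ i, IsParam 𝓘(ℝ, EX i) (S i) (dom i) (piece i) (param i)) :
    IsParam (modelPi EX) (univ.pi S) (fun j : ∀ i, ι i => blockPi k fun i => dom i (j i))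
      (fun j => blockPi k fun i => piece i (j i)) (fun j u i => param i (j i) (block k i u)) where
  isOpen_dom j := by
    simp only [blockPi, ofPred_forall]
    exact isOpen_iInter_of_finite fun i => ((h i).isOpen_dom _).preimage (block k i).continuous
  piece_subset j u hu i := (h i).piece_subset _ (hu i)
  measurableSet_piece j := by
    simp only [blockPi, ofPred_forall]
    exact MeasurableSet.iInter fun i =>
      (block k i).continuous.measurable ((h i).measurableSet_piece _)
  contMDiffOn j := contMDiffOn_modelPi fun i => ((h i).contMDiffOn (j i)).comp
    (block k i).contMDiff.contMDiffOn fun u hu => hu i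
  exists_chart j := by
    choose N κ hN hκ h1 h2 using fun i => (h i).exists_chart (j i)
    refine ⟨univ.pi N, fun x => sigmaL k fun i => κ i (x i), isOpen_set_pi finite_univ
      fun i _ => hN i, ?_, ?_, ?_⟩
    · refine (sigmaL k).contDiff.contMDiff.comp_contMDiffOn ?_
      rw [contMDiffOn_pi_space]
      exact fun i => (hκ i).comp (contMDiff_apply i).contMDiffOn fun x hx => hx i trivial
    · intro u hu
      refine ⟨⟨fun i _ => (h1 i _ (hu i)).1.1, fun i _ => (h1 i _ (hu i)).1.2⟩, ?_⟩
      simp only [fun i => (h1 i _ (hu i)).2]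
      exact sigmaL_block u
    · intro x hx
      refine ⟨fun i => ?_, funext fun i => ?_⟩
      · rw [block_sigmaL]
        exact (h2 i (x i) ⟨hx.1 i trivial, hx.2 i trivial⟩).1
      · rw [block_sigmaL]
        exact (h2 i (x i) ⟨hx.1 i trivial, hx.2 i trivial⟩).2
  disjoint j j' hjj := by
    obtain ⟨i, hi⟩ := Function.ne_iff.1 hjj
    rw [Set.disjoint_left]
    rintro x ⟨u, hu, rfl⟩ ⟨u', hu', huu⟩
    exact Set.disjoint_left.1 ((h i).disjoint _ _ hi) ⟨_, hu i, rfl⟩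
      ⟨_, hu' i, congrFun huu i⟩
  cover := by
    ext x
    simp only [mem_iUnion, mem_image]
    constructor
    · rintro ⟨j, u, hu, rfl⟩ i -
      exact (h i).cover.le (mem_iUnion.2 ⟨j i, _, hu i, rfl⟩)
    · intro hx
      choose j u hu hux using fun i => mem_iUnion.1 ((h i).cover.ge (hx i trivial))
      refine ⟨j, sigmaL k u, fun i => ?_, funext fun i => ?_⟩
      · rw [block_sigmaL]; exact hu i
      · rw [block_sigmaL]; exact hux i

/-- The product of local data. -/
def LocalData.pi {p : ∀ i, X i → Y i} {q : ∀ i, X i → Γ i}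
    {Φ : ∀ i, DensityFamily 𝓘(ℝ, EΓ i) (Γ i) (m i)} {φ : ∀ i, EY i → Y i}
    {T : ∀ i, W i →L[ℝ] (Fin (m i) → ℝ)} {U : ∀ i, Set (EY i)} {ι : Fin n → Type}
    (D : ∀ i, LocalData 𝓘(ℝ, EX i) 𝓘(ℝ, EY i) 𝓘(ℝ, EΓ i) (p i) (q i) (Φ i) (φ i) (k i) (T i)
      (U i) (ι i))
    (hp : ∀ i x, MDifferentiableAt 𝓘(ℝ, EX i) 𝓘(ℝ, EY i) (p i) x)
    (hq : ∀ i x, MDifferentiableAt 𝓘(ℝ, EX i) 𝓘(ℝ, EΓ i) (q i) x)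
    (hφ : ∀ i, ∀ z ∈ U i, MDifferentiableAt 𝓘(ℝ, EY i) 𝓘(ℝ, EY i) (φ i) z) :
    LocalData (modelPi EX) (modelPi EY) (modelPi EΓ) (fun (x : ∀ i, X i) i => p i (x i))
      (fun (x : ∀ i, X i) i => q i (x i)) (externalProd Φ) (fun z i => φ i (z i)) (∑ i, k i)
      (stackMap fun i => T i ∘L (ContinuousLinearMap.proj i : (∀ i, W i) →L[ℝ] W i))
      (univ.pi U) (∀ i, ι i) where
  dom j := blockPi k fun i => (D i).dom (j i)
  piece j := blockPi k fun i => (D i).piece (j i)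
  cell j := blockPi k fun i => (D i).cell (j i)
  param j z u i := (D i).param (j i) (z i) (block k i u)
  coef j x := ∏ i, (D i).coef (j i) (x.1 i, block k i x.2)
  C j x := ContinuousLinearMap.pi fun i =>
    (D i).C (j i) (x.1 i, block k i x.2) ∘L ContinuousLinearMap.proj i
  A j x := ContinuousLinearMap.pi fun i =>
    (D i).A (j i) (x.1 i, block k i x.2) ∘L ContinuousLinearMap.proj i
  F j x := ContinuousLinearMap.pi fun i => (D i).F (j i) (x.1 i, block k i x.2) ∘L block k i
  isParam z hz := by
    have : (fun (x : ∀ i, X i) i => p i (x i)) ⁻¹' {fun i => φ i (z i)} =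
        univ.pi fun i => p i ⁻¹' {φ i (z i)} := by
      ext x
      simp [funext_iff]
    rw [this]
    exact IsParam.pi fun i => (D i).isParam (z i) (hz i trivial)
  measurableSet_piece j := by
    simp only [blockPi, ofPred_forall]
    exact MeasurableSet.iInter fun i =>
      (block k i).continuous.measurable ((D i).measurableSet_piece _)
  piece_subset_cell j u hu i := (D i).piece_subset_cell _ (hu i)
  isCompact_cell j := by
    have : blockPi k (fun i => (D i).cell (j i)) =
        sigmaL k '' univ.pi fun i => (D i).cell (j i) := by
      ext u
      constructor
      · exact fun hu => ⟨fun i => block k i u, fun i _ => hu i, sigmaL_block u⟩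
      · rintro ⟨x, hx, rfl⟩ i
        rw [block_sigmaL]; exact hx i trivial
    rw [this]
    exact (isCompact_univ_pi fun i => (D i).isCompact_cell _).image (sigmaL k).continuous
  continuousOn_coef j := by
    refine continuousOn_finsetProd _ fun i _ => ?_
    exact ((D i).continuousOn_coef (j i)).comp (f := fun x : (∀ i, EY i) × (Fin (∑ i, k i) → ℝ) =>
      (x.1 i, block k i x.2)) (by fun_prop) fun x hx => ⟨hx.1 i trivial, hx.2 i⟩
  continuousOn_A j := by
    have h1 : ContinuousOn (fun (x : (∀ i, EY i) × (Fin (∑ i, k i) → ℝ)) i =>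
        (D i).A (j i) (x.1 i, block k i x.2) ∘L
          (ContinuousLinearMap.proj i : (∀ i, EY i) →L[ℝ] EY i))
        (univ.pi U ×ˢ blockPi k fun i => (D i).cell (j i)) := by
      refine continuousOn_pi.2 fun i => ContinuousOn.clm_comp ?_ continuousOn_const
      exact ((D i).continuousOn_A (j i)).comp (f := fun x : (∀ i, EY i) × (Fin (∑ i, k i) → ℝ) =>
        (x.1 i, block k i x.2)) (by fun_prop) fun x hx => ⟨hx.1 i trivial, hx.2 i⟩
    exact (ContinuousLinearMap.piEquivL ..).continuous.comp_continuousOn h1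
  continuousOn_F j := by
    have h1 : ContinuousOn (fun (x : (∀ i, EY i) × (Fin (∑ i, k i) → ℝ)) i =>
        (D i).F (j i) (x.1 i, block k i x.2) ∘L block k i)
        (univ.pi U ×ˢ blockPi k fun i => (D i).cell (j i)) := by
      refine continuousOn_pi.2 fun i => ContinuousOn.clm_comp ?_ continuousOn_const
      exact ((D i).continuousOn_F (j i)).comp (f := fun x : (∀ i, EY i) × (Fin (∑ i, k i) → ℝ) =>
        (x.1 i, block k i x.2)) (by fun_prop) fun x hx => ⟨hx.1 i trivial, hx.2 i⟩
    exact (ContinuousLinearMap.piEquivL ..).continuous.comp_continuousOn h1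
  density_eq j z hz u hu w := by
    refine Eq.trans ?_ (prodDensity_absDet (V := ∀ i, EΓ i)
      (fun i => (D i).coef (j i) (z i, block k i u))
      (fun i => T i ∘L (D i).C (j i) (z i, block k i u) ∘L ContinuousLinearMap.proj i) w)
    refine congrArg (fun δ : ∀ i, (Fin (m i) → ∀ i, EΓ i) → ℝ => prodDensity δ w)
      (funext fun i => funext fun v => ?_)
    refine Eq.trans ?_ ((D i).density_eq (j i) (z i) (hz i trivial) (block k i u) (hu i)
      fun l => v l i)
    refine congrArg (Φ i _) (funext fun l => ?_)
    exact congrArg (fun L : (∀ i, EΓ i) →L[ℝ] EΓ i => L (v l)) (hasMFDerivAt_apply i _).mfderiv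
  fiber_eq j z hz u hu v := by
    have e1 := (hasMFDerivAt_pi_map (p := q) (x := fun i => (D i).param (j i) (z i) (block k i u))
      fun i => hq i _).mfderiv
    have e2 := (hasMFDerivAt_pi_param (X := X) (f := fun i => (D i).param (j i) (z i)) (block k)
      (u := u) fun i => ((((D i).isParam (z i) (hz i trivial)).contMDiffOn (j i)).contMDiffAt
        ((((D i).isParam (z i) (hz i trivial)).isOpen_dom (j i)).mem_nhds
          (((D i).isParam (z i) (hz i trivial)).piece_subset _ (hu i)))).mdifferentiableAt
            (by simp)).mfderiv
    rw [e1, e2]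
    exact funext fun i => (D i).fiber_eq (j i) (z i) (hz i trivial) _ (hu i) (block k i v)
  lift_eq j z hz u hu ξ ζ hξ := by
    have e1 := (hasMFDerivAt_pi_map (p := q) (x := fun i => (D i).param (j i) (z i) (block k i u))
      fun i => hq i _).mfderiv
    have e2 := (hasMFDerivAt_pi_map (p := p) (x := fun i => (D i).param (j i) (z i) (block k i u))
      fun i => hp i _).mfderiv
    have e3 := (hasMFDerivAt_pi_param (X := Y) (f := φ)
      (fun i => (ContinuousLinearMap.proj i : (∀ i, EY i) →L[ℝ] EY i)) (u := z)
      fun i => hφ i (z i) (hz i trivial)).mfderiv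
    have hξ' : ∀ i, mfderiv 𝓘(ℝ, EX i) 𝓘(ℝ, EY i) (p i) ((D i).param (j i) (z i) (block k i u))
        (ξ i) = mfderiv 𝓘(ℝ, EY i) 𝓘(ℝ, EY i) (φ i) (z i) (ζ i) := fun i => by
      have h1 := congrArg (fun L : (∀ i, EX i) →L[ℝ] ∀ i, EY i => L ξ i) e2
      have h2 := congrArg (fun L : (∀ i, EY i) →L[ℝ] ∀ i, EY i => L ζ i) e3
      exact h1.symm.trans ((congrFun hξ i).trans h2)
    choose t ht using fun i =>
      (D i).lift_eq (j i) (z i) (hz i trivial) _ (hu i) (ξ i) (ζ i) (hξ' i)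
    refine ⟨sigmaL k t, ?_⟩
    rw [e1]
    refine funext fun i => (ht i).trans ?_
    change _ = (D i).A (j i) (z i, block k i u) (ζ i) +
      (D i).F (j i) (z i, block k i u) (block k i (sigmaL k t))
    rw [block_sigmaL]
  surjective j z hz u hu := by
    have e2 := (hasMFDerivAt_pi_map (p := p) (x := fun i => (D i).param (j i) (z i) (block k i u))
      fun i => hp i _).mfderiv
    rw [e2]
    intro η
    choose ξ hξ using fun i => (D i).surjective (j i) (z i) (hz i trivial) _ (hu i) (η i)
    exact ⟨ξ, funext hξ⟩

end ProductData

/-! ### A finite measure space that encodes the cells of a fibre. -/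

section Cells

variable {ι : Type*} [Fintype ι] [MeasurableSpace ι] {k : ℕ}

/-- The sum over `j` of the Lebesgue measures on the sets `{j} × piece j`. -/
def pieceMeasure (piece : ι → Set (Fin k → ℝ)) : Measure (ι × (Fin k → ℝ)) :=
  ∑ j, (volume.restrict (piece j)).map (Prod.mk j)

theorem isFiniteMeasure_pieceMeasure {piece cell : ι → Set (Fin k → ℝ)}
    (hsub : ∀ j, piece j ⊆ cell j) (hcell : ∀ j, IsCompact (cell j)) :
    IsFiniteMeasure (pieceMeasure piece) := by
  refine ⟨?_⟩
  rw [pieceMeasure, Measure.finsetSum_apply]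
  refine ENNReal.sum_lt_top.2 fun j _ => ?_
  rw [Measure.map_apply measurable_prodMk_left MeasurableSet.univ, preimage_univ,
    Measure.restrict_apply_univ]
  exact (measure_mono (hsub j)).trans_lt (hcell j).measure_lt_top

theorem integral_pieceMeasure {piece : ι → Set (Fin k → ℝ)} {f : ι × (Fin k → ℝ) → ℝ}
    (hf : Integrable f (pieceMeasure piece)) :
    ∫ s, f s ∂(pieceMeasure piece) = ∑ j, ∫ u in piece j, f (j, u) := by
  rw [pieceMeasure, integrable_finsetSum_measure] at hf
  rw [pieceMeasure, integral_finsetSum_measure hf]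
  exact Finset.sum_congr rfl fun j hj =>
    integral_map measurable_prodMk_left.aemeasurable (hf j hj).aestronglyMeasurable

open Classical in
/-- The function on `ι × ℝ^k` which is given by `G j` on `{j} × piece j` and vanishes elsewhere. -/
def glue {B : Type*} [Zero B] (piece : ι → Set (Fin k → ℝ)) (G : ι → (Fin k → ℝ) → B)
    (s : ι × (Fin k → ℝ)) : B :=
  (piece s.1).piecewise (G s.1) (fun _ => 0) s.2

theorem glue_of_mem {B : Type*} [Zero B] {piece : ι → Set (Fin k → ℝ)} (G : ι → (Fin k → ℝ) → B)
    {j : ι} {u : Fin k → ℝ} (hu : u ∈ piece j) : glue piece G (j, u) = G j u := by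
  classical exact Set.piecewise_eq_of_mem _ _ _ hu

theorem measurable_glue [MeasurableSingletonClass ι] {B : Type*} [NormedAddCommGroup B] [MeasurableSpace B] [BorelSpace B]
    {piece cell : ι → Set (Fin k → ℝ)}
    (hsub : ∀ j, piece j ⊆ cell j) (hpiece : ∀ j, MeasurableSet (piece j))
    {G : ι → (Fin k → ℝ) → B} (hG : ∀ j, ContinuousOn (G j) (cell j)) :
    Measurable (glue piece G) :=
  measurable_from_prod_countable_right fun j => by
    classical exact ((hG j).mono (hsub j)).measurable_piecewise continuousOn_const (hpiece j)

theorem exists_bound_glue {B : Type*} [NormedAddCommGroup B] {piece cell : ι → Set (Fin k → ℝ)}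
    (hsub : ∀ j, piece j ⊆ cell j) (hcell : ∀ j, IsCompact (cell j))
    {G : ι → (Fin k → ℝ) → B} (hG : ∀ j, ContinuousOn (G j) (cell j)) :
    ∃ C, ∀ s, ‖glue piece G s‖ ≤ C := by
  classical
  choose C hC using fun j => (hcell j).exists_bound_of_continuousOn (hG j)
  refine ⟨∑ j, |C j|, fun s => ?_⟩
  by_cases hs : s.2 ∈ piece s.1
  · rw [glue, Set.piecewise_eq_of_mem _ _ _ hs]
    exact (hC _ _ (hsub _ hs)).trans ((le_abs_self _).trans
      (Finset.single_le_sum (f := fun j => |C j|) (fun j _ => abs_nonneg _) (Finset.mem_univ s.1)))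
  · rw [glue, Set.piecewise_eq_of_notMem _ _ _ hs, norm_zero]
    exact Finset.sum_nonneg fun j _ => abs_nonneg _

theorem measurePreserving_sigmaL {n : ℕ} (k : Fin n → ℕ) :
    MeasurePreserving (sigmaL k) (Measure.pi fun _ => volume) volume := by
  refine ⟨(sigmaL k).continuous.measurable, (Measure.pi_eq fun s hs => ?_).symm⟩
  rw [Measure.map_apply (sigmaL k).continuous.measurable (MeasurableSet.univ_pi hs)]
  have : sigmaL k ⁻¹' univ.pi s =
      univ.pi fun i => univ.pi fun a => s (finSigmaFinEquiv ⟨i, a⟩) := by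
    ext x
    simp only [mem_preimage, mem_univ_pi]
    constructor
    · intro h i a
      have := h (finSigmaFinEquiv ⟨i, a⟩)
      rwa [sigmaL_apply_mk] at this
    · intro h a
      obtain ⟨⟨i, a⟩, rfl⟩ := finSigmaFinEquiv.surjective a
      rw [sigmaL_apply_mk]
      exact h i a
  rw [this, Measure.pi_pi]
  simp_rw [volume_pi_pi]
  rw [← finSigmaFinEquiv.prod_comp, Fintype.prod_sigma]

/-- Expanding the product of sums over cells gives one term for each choice j of a cell in every
factor, and `sigmaL` carries the product of Lebesgue measures to Lebesgue measure. -/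
theorem pi_pieceMeasure {n : ℕ} {k : Fin n → ℕ} {ι : Fin n → Type*} [∀ i, Fintype (ι i)]
    [∀ i, MeasurableSpace (ι i)] (piece : ∀ i, ι i → Set (Fin (k i) → ℝ))
    [∀ i, IsFiniteMeasure (pieceMeasure (piece i))] :
    Measure.pi (fun i => pieceMeasure (piece i)) =
      ∑ j : ∀ i, ι i, (volume.restrict (blockPi k fun i => piece i (j i))).map
        fun u i => (j i, block k i u) := by
  have hm : ∀ j : ∀ i, ι i, Measurable fun (u : Fin (∑ i, k i) → ℝ) i => (j i, block k i u) :=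
    fun j => measurable_pi_lambda _ fun i =>
      measurable_prodMk_left.comp (block k i).continuous.measurable
  refine Measure.pi_eq fun s hs => ?_
  rw [Measure.finsetSum_apply]
  simp_rw [pieceMeasure, Measure.finsetSum_apply]
  rw [Finset.prod_univ_sum, Fintype.piFinset_univ]
  refine Finset.sum_congr rfl fun j _ => ?_
  have hms : ∀ i, MeasurableSet (Prod.mk (j i) ⁻¹' s i) := fun i =>
    measurable_prodMk_left (hs i)
  have hpre : MeasurableSet ((fun (u : Fin (∑ i, k i) → ℝ) i => (j i, block k i u)) ⁻¹'
      univ.pi s) := hm j (MeasurableSet.univ_pi hs)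
  have hset : sigmaL k ⁻¹' ((fun (u : Fin (∑ i, k i) → ℝ) i => (j i, block k i u)) ⁻¹' univ.pi s ∩
      blockPi k fun i => piece i (j i)) =
      univ.pi fun i => Prod.mk (j i) ⁻¹' s i ∩ piece i (j i) := by
    ext x
    simp only [blockPi, mem_preimage, mem_inter_iff, mem_univ_pi, mem_ofPred_eq, block_sigmaL,
      forall_and]
  have hvol := (measurePreserving_sigmaL k).measure_preimage_emb
    (sigmaL k).toHomeomorph.measurableEmbedding
    ((fun (u : Fin (∑ i, k i) → ℝ) i => (j i, block k i u)) ⁻¹' univ.pi s ∩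
      blockPi k fun i => piece i (j i))
  rw [Measure.map_apply (hm j) (MeasurableSet.univ_pi hs), Measure.restrict_apply hpre, ← hvol,
    hset, Measure.pi_pi]
  refine Finset.prod_congr rfl fun i _ => ?_
  rw [Measure.map_apply measurable_prodMk_left (hs i), Measure.restrict_apply (hms i)]

end Cells

/-! ### Measurable choice of the maximal minor along a family. -/

section Reduce

variable {E' : Type*} [NormedAddCommGroup E'] [NormedSpace ℝ E'] [FiniteDimensional ℝ E']
  {d k m : ℕ}

theorem exists_bound_minor (d k m : ℕ) (C : ℝ) :
    ∃ C', ∀ (e : Fin d ⊕ Fin k ≃ Fin m) (F : Fin m → Fin k → ℝ), ‖F‖ ≤ C → |minor e F| ≤ C' := by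
  have hcont : ∀ e : Fin d ⊕ Fin k ≃ Fin m, Continuous fun F : Fin m → Fin k → ℝ => minor e F :=
    fun e => Continuous.matrix_det (by fun_prop)
  choose B hB using fun e => (isCompact_closedBall (0 : Fin m → Fin k → ℝ)
    C).exists_bound_of_continuousOn (hcont e).continuousOn
  refine ⟨∑ e, |B e|, fun e F hF => ?_⟩
  exact (hB e _ (by simpa using hF)).trans ((le_abs_self _).trans
    (Finset.single_le_sum (f := fun j => |B j|) (fun j _ => abs_nonneg _) (Finset.mem_univ e)))

/-- A measurable choice of a maximal minor. -/
theorem exists_measurable_isMax {S : Type*} [MeasurableSpace S] (h : d + k = m)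
    {F : S → Fin m → Fin k → ℝ} (hF : Measurable F) :
    ∃ e : S → (Fin d ⊕ Fin k ≃ Fin m), (∀ s, IsMax (e s) (F s)) ∧
      Measurable (fun s => minor (e s) (F s)) ∧ Measurable fun s => redMap (e s) (F s) := by
  -- The row selections form a finite set. With the discrete σ-algebra, joint measurability can be
  -- checked for each fixed selection.
  let _ : MeasurableSpace (Fin d ⊕ Fin k ≃ Fin m) := ⊤
  have : Nonempty (Fin d ⊕ Fin k ≃ Fin m) := ⟨finSumFinEquiv.trans (finCongr h)⟩
  obtain ⟨σ, hσ, hmax⟩ := exists_measurable_argmax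
    (f := fun (e : Fin d ⊕ Fin k ≃ Fin m) s => |minor e (F s)|)
    fun e => (measurable_minor e hF).abs
  refine ⟨σ, hmax, ?_, ?_⟩
  · exact (measurable_from_prod_countable_right (f := fun x : (Fin d ⊕ Fin k ≃ Fin m) × S =>
      minor x.1 (F x.2)) fun e => measurable_minor e hF).comp (hσ.prodMk measurable_id)
  · have h1 : Measurable fun x : (Fin d ⊕ Fin k ≃ Fin m) × S => redMap x.1 (F x.2) := by
      refine measurable_from_prod_countable_right fun e => ?_
      exact measurable_redMap e hF
    have h2 : Measurable fun s => (σ s, s) := hσ.prodMk measurable_id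
    have h3 := h1.comp h2
    simp only [Function.comp_def] at h3
    exact h3

theorem measurable_clm_comp {S : Type*} [MeasurableSpace S]
    {R : S → (Fin m → ℝ) →L[ℝ] (Fin d → ℝ)} {A : S → E' →L[ℝ] (Fin m → ℝ)}
    (hR : Measurable R) (hA : Measurable A) : Measurable fun s => R s ∘L A s := by
  have hcomp : Continuous fun x : ((Fin m → ℝ) →L[ℝ] (Fin d → ℝ)) × (E' →L[ℝ] (Fin m → ℝ)) =>
      x.1 ∘L x.2 := continuous_fst.clm_comp continuous_snd
  exact hcomp.measurable.comp (hR.prodMk hA)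

/-- A bounded measurable family of pairs of linear maps `A : E' → ℝ^m` and `F : ℝ^k → ℝ^m` can be
reduced to a family of linear maps `E' → ℝ^d`. -/
theorem exists_reduction {S : Type*} [MeasurableSpace S] (h : d + k = m) (μ : Measure S)
    [IsFiniteMeasure μ] {c : S → ℝ} {A : S → E' →L[ℝ] (Fin m → ℝ)} {F : S → Fin m → Fin k → ℝ}
    (hc : Measurable c) (hA : Measurable A) (hF : Measurable F) (hc' : ∃ C, ∀ s, ‖c s‖ ≤ C)
    (hA' : ∃ C, ∀ s, ‖A s‖ ≤ C) (hF' : ∃ C, ∀ s, ‖F s‖ ≤ C) :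
    ∃ (Q : CosineData E' S d) (e : S → (Fin d ⊕ Fin k ≃ Fin m)), Q.base = μ ∧
      ∀ s, IsMax (e s) (F s) ∧ Q.weight s = c s * |minor (e s) (F s)| ∧
        Q.map s = redMap (e s) (F s) ∘L A s := by
  obtain ⟨e, hmax, hmin, hred⟩ := exists_measurable_isMax h hF
  obtain ⟨C, hC⟩ := hc'
  obtain ⟨C₁, hC₁⟩ := hA'
  obtain ⟨C₂, hC₂⟩ := hF'
  obtain ⟨C₃, hC₃⟩ := exists_bound_redMap d k m
  obtain ⟨C₄, hC₄⟩ := exists_bound_minor d k m C₂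
  have hw : ∀ s, abs (c s * |minor (e s) (F s)|) ≤ C * C₄ := fun s => by
    rw [abs_mul, abs_abs]
    exact mul_le_mul (hC s) (hC₄ _ _ (hC₂ s)) (abs_nonneg _) ((norm_nonneg _).trans (hC s))
  have hm : ∀ s, ‖redMap (e s) (F s) ∘L A s‖ ≤ C₃ * C₁ := fun s => by
    have h3 := hC₃ (e s) (F s) (hmax s)
    exact (ContinuousLinearMap.opNorm_comp_le _ _).trans
      (mul_le_mul h3 (hC₁ s) (norm_nonneg _) ((norm_nonneg _).trans h3))
  exact ⟨⟨μ, inferInstance, fun s => c s * |minor (e s) (F s)|,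
    fun s => redMap (e s) (F s) ∘L A s, hc.mul hmin.abs, measurable_clm_comp hred hA,
    ⟨_, hw⟩, ⟨_, hm⟩⟩, e, rfl, fun s => ⟨hmax s, rfl, rfl⟩⟩

end Reduce

/-- The composition of the linear maps of a family with a fixed linear map. -/
def CosineData.comp {V V' S : Type*} [NormedAddCommGroup V] [NormedSpace ℝ V]
    [FiniteDimensional ℝ V]
    [NormedAddCommGroup V'] [NormedSpace ℝ V'] [FiniteDimensional ℝ V'] [MeasurableSpace S] {m : ℕ}
    (Q : CosineData V S m) (L : V' →L[ℝ] V) : CosineData V' S m where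
  base := Q.base
  isFinite := Q.isFinite
  weight := Q.weight
  map s := Q.map s ∘L L
  measurable_weight := Q.measurable_weight
  measurable_map := by
    have h : Continuous fun T : V →L[ℝ] (Fin m → ℝ) => T ∘L L :=
      continuous_id.clm_comp continuous_const
    exact h.measurable.comp Q.measurable_map
  bdd_weight := Q.bdd_weight
  bdd_map := by
    obtain ⟨C, hC⟩ := Q.bdd_map
    exact ⟨C * ‖L‖, fun s => (ContinuousLinearMap.opNorm_comp_le _ _).trans
      (mul_le_mul_of_nonneg_right (hC s) (norm_nonneg _))⟩

/-! ### The transform of a single fibration as the density of a family. -/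

section Normal

variable {E : Type*} [NormedAddCommGroup E] [NormedSpace ℝ E] {H : Type*} [TopologicalSpace H]
  {I : ModelWithCorners ℝ E H}
  {E' : Type*} [NormedAddCommGroup E'] [NormedSpace ℝ E'] {H' : Type*} [TopologicalSpace H']
  {J : ModelWithCorners ℝ E' H'}
  {E'' : Type*} [NormedAddCommGroup E''] [NormedSpace ℝ E'']
  {H'' : Type*} [TopologicalSpace H''] {K : ModelWithCorners ℝ E'' H''}
  {X : Type*} [TopologicalSpace X] [ChartedSpace H X]
  {Y : Type*} [TopologicalSpace Y] [ChartedSpace H' Y]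
  {Γ : Type*} [TopologicalSpace Γ] [ChartedSpace H'' Γ]
  {m : ℕ}

namespace LocalData

variable {p : X → Y} {q : X → Γ} {Φ : DensityFamily K Γ m} {φ : E' → Y} {k : ℕ}
  {W : Type*} [NormedAddCommGroup W] [NormedSpace ℝ W] {T : W →L[ℝ] (Fin m → ℝ)} {U : Set E'}
  {ι : Type} {d : ℕ}

/-- The matrix of the map `T ∘ F`. -/
def mat (D : LocalData I J K p q Φ φ k T U ι) (j : ι) (z : E') (u : Fin k → ℝ) :
    Fin m → Fin k → ℝ :=
  fun i b => T (D.F j (z, u) (Pi.single b 1)) i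

variable [FiniteDimensional ℝ E'] [Fintype ι] [MeasurableSpace ι] [MeasurableSingletonClass ι]

theorem exists_cosineData (D : LocalData I J K p q Φ φ k T U ι) (h : d + k = m) {z : E'}
    (hz : z ∈ U) : ∃ (Q : CosineData E' (ι × (Fin k → ℝ)) d)
      (e : ι × (Fin k → ℝ) → (Fin d ⊕ Fin k ≃ Fin m)), Q.base = pieceMeasure D.piece ∧
      ∀ j, ∀ u ∈ D.piece j, IsMax (e (j, u)) (D.mat j z u) ∧
        Q.weight (j, u) = D.coef j (z, u) * |minor (e (j, u)) (D.mat j z u)| ∧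
        Q.map (j, u) = redMap (e (j, u)) (D.mat j z u) ∘L T ∘L D.A j (z, u) := by
  have := isFiniteMeasure_pieceMeasure D.piece_subset_cell D.isCompact_cell
  have hz' : ∀ j, MapsTo (fun u => (z, u)) (D.cell j) (U ×ˢ D.cell j) := fun j u hu => ⟨hz, hu⟩
  have hzc : ∀ j, ContinuousOn (fun u : Fin k → ℝ => (z, u)) (D.cell j) := fun j => by fun_prop
  have hc : ∀ j, ContinuousOn (fun u => D.coef j (z, u)) (D.cell j) := fun j =>
    (D.continuousOn_coef j).comp (hzc j) (hz' j)
  have hA : ∀ j, ContinuousOn (fun u => T ∘L D.A j (z, u)) (D.cell j) := fun j =>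
    continuousOn_const.clm_comp ((D.continuousOn_A j).comp (hzc j) (hz' j))
  have hF : ∀ j, ContinuousOn (fun u => D.mat j z u) (D.cell j) := fun j => by
    refine continuousOn_pi.2 fun i => continuousOn_pi.2 fun b => ?_
    have h1 : ContinuousOn (fun u => T (D.F j (z, u) (Pi.single b 1))) (D.cell j) :=
      T.continuous.comp_continuousOn
        (((D.continuousOn_F j).comp (hzc j) (hz' j)).clm_apply continuousOn_const)
    exact (continuous_apply i).comp_continuousOn h1
  obtain ⟨Q, e, hb, hQ⟩ := exists_reduction h (pieceMeasure D.piece)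
    (measurable_glue D.piece_subset_cell D.measurableSet_piece hc)
    (measurable_glue D.piece_subset_cell D.measurableSet_piece hA)
    (measurable_glue D.piece_subset_cell D.measurableSet_piece hF)
    (exists_bound_glue D.piece_subset_cell D.isCompact_cell hc)
    (exists_bound_glue D.piece_subset_cell D.isCompact_cell hA)
    (exists_bound_glue D.piece_subset_cell D.isCompact_cell hF)
  refine ⟨Q, e, hb, fun j u hu => ?_⟩
  have := hQ (j, u)
  rwa [glue_of_mem _ hu, glue_of_mem _ hu, glue_of_mem _ hu] at this

/-- This writes the local integrals in the form that is known to be normal. The row selection e, the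
weights and the maps stay in the conclusion, because the product comparison must use the same
selection in each factor. -/
theorem exists_density_eq (D : LocalData I J K p q Φ φ k T U ι) (h : d + k = m) {z : E'}
    (hz : z ∈ U) : ∃ (Q : CosineData E' (ι × (Fin k → ℝ)) d)
      (e : ι × (Fin k → ℝ) → (Fin d ⊕ Fin k ≃ Fin m)), Q.base = pieceMeasure D.piece ∧
      (∀ j, ∀ u ∈ D.piece j, IsMax (e (j, u)) (D.mat j z u) ∧
        Q.weight (j, u) = D.coef j (z, u) * |minor (e (j, u)) (D.mat j z u)| ∧
        Q.map (j, u) = redMap (e (j, u)) (D.mat j z u) ∘L T ∘L D.A j (z, u)) ∧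
      ∀ η, Q.density η = ∑ j, ∫ u in D.piece j, D.integrand h j z η u := by
  obtain ⟨Q, e, hb, hQ⟩ := D.exists_cosineData h hz
  refine ⟨Q, e, hb, hQ, fun η => ?_⟩
  obtain ⟨C, hC⟩ := Q.bdd_weight
  have hint := Q.integrable Q.measurable_weight hC η
  rw [hb] at hint
  rw [CosineData.density, hb, integral_pieceMeasure hint]
  refine Finset.sum_congr rfl fun j _ => setIntegral_congr_fun (D.measurableSet_piece j)
    fun u hu => ?_
  obtain ⟨h1, h2, h3⟩ := hQ j u hu
  simp only [h2, h3, integrand, mul_assoc]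
  refine congrArg (D.coef j (z, u) * ·) ?_
  exact (absDet_append h h1 (T ∘L D.A j (z, u)) η 0 T _ _ (fun b i => rfl) fun l => by simp).symm

end LocalData

end Normal

/-! ### The transform of a product of fibrations. -/

section NormalProduct

variable {n : ℕ} {EX EY EΓ W : Fin n → Type*}
  [∀ i, NormedAddCommGroup (EX i)] [∀ i, NormedSpace ℝ (EX i)]
  [∀ i, NormedAddCommGroup (EY i)] [∀ i, NormedSpace ℝ (EY i)] [∀ i, FiniteDimensional ℝ (EY i)]
  [∀ i, NormedAddCommGroup (EΓ i)] [∀ i, NormedSpace ℝ (EΓ i)] [∀ i, FiniteDimensional ℝ (EΓ i)]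
  [∀ i, NormedAddCommGroup (W i)] [∀ i, NormedSpace ℝ (W i)]
  {X Y Γ : Fin n → Type*}
  [∀ i, TopologicalSpace (X i)] [∀ i, ChartedSpace (EX i) (X i)]
  [∀ i, TopologicalSpace (Y i)] [∀ i, ChartedSpace (EY i) (Y i)]
  [∀ i, TopologicalSpace (Γ i)] [∀ i, ChartedSpace (EΓ i) (Γ i)]
  {d k m : Fin n → ℕ} {p : ∀ i, X i → Y i} {q : ∀ i, X i → Γ i}
  {Φ : ∀ i, DensityFamily 𝓘(ℝ, EΓ i) (Γ i) (m i)} {φ : ∀ i, EY i → Y i}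
  {T : ∀ i, W i →L[ℝ] (Fin (m i) → ℝ)} {U : ∀ i, Set (EY i)} {ι : Fin n → Type}
  [∀ i, Fintype (ι i)] [∀ i, MeasurableSpace (ι i)] [∀ i, MeasurableSingletonClass (ι i)]

theorem block_single_self (k : Fin n → ℕ) (i : Fin n) (b : Fin (k i)) :
    block k i (Pi.single (finSigmaFinEquiv ⟨i, b⟩) 1) = Pi.single b 1 := by
  ext a
  change (Pi.single (finSigmaFinEquiv ⟨i, b⟩) 1 : Fin (∑ i, k i) → ℝ) (finSigmaFinEquiv ⟨i, a⟩) = _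
  by_cases hab : a = b
  · subst hab; simp
  · rw [Pi.single_eq_of_ne hab, Pi.single_eq_of_ne]
    simpa using hab

theorem block_single_ne {k : Fin n → ℕ} {i j : Fin n} (hij : i ≠ j) (b : Fin (k j)) :
    block k i (Pi.single (finSigmaFinEquiv ⟨j, b⟩) 1) = 0 := by
  ext a
  change (Pi.single (finSigmaFinEquiv ⟨j, b⟩) 1 : Fin (∑ i, k i) → ℝ) (finSigmaFinEquiv ⟨i, a⟩) = 0
  rw [Pi.single_eq_of_ne]
  simp [hij]

/-- One family, the product of the families of the factors pulled back to the product space, is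
evaluated twice. Expanded over cells, its density is the transform of the product data; by
`CosineData.prodDensity_density` it is the product of the factor densities. -/
theorem LocalData.exists_pi_density_eq
    (D : ∀ i, LocalData 𝓘(ℝ, EX i) 𝓘(ℝ, EY i) 𝓘(ℝ, EΓ i) (p i) (q i) (Φ i) (φ i) (k i) (T i)
      (U i) (ι i))
    (hp : ∀ i x, MDifferentiableAt 𝓘(ℝ, EX i) 𝓘(ℝ, EY i) (p i) x)
    (hq : ∀ i x, MDifferentiableAt 𝓘(ℝ, EX i) 𝓘(ℝ, EΓ i) (q i) x)
    (hφ : ∀ i, ∀ z ∈ U i, MDifferentiableAt 𝓘(ℝ, EY i) 𝓘(ℝ, EY i) (φ i) z)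
    (h : ∀ i, d i + k i = m i) {z : ∀ i, EY i} (hz : ∀ i, z i ∈ U i) :
    ∃ Q : CosineData (∀ i, EY i) (∀ i, ι i × (Fin (k i) → ℝ)) (∑ i, d i),
      (∀ η, Q.density η = ∑ j, ∫ u in (LocalData.pi D hp hq hφ).piece j,
        (LocalData.pi D hp hq hφ).integrand (sum_degrees h) j z η u) ∧
      Q.density = prodDensity fun i (w : Fin (d i) → ∀ i, EY i) =>
        ∑ j, ∫ u in (D i).piece j, (D i).integrand (h i) j (z i) (fun l => w l i) u := by
  choose Q e hb hQ hdens using fun i => (D i).exists_density_eq (h i) (hz i)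
  let Q' : ∀ i, CosineData (∀ i, EY i) (ι i × (Fin (k i) → ℝ)) (d i) := fun i =>
    (Q i).comp (ContinuousLinearMap.proj i)
  have hfin : ∀ i, IsFiniteMeasure (pieceMeasure (D i).piece) := fun i =>
    isFiniteMeasure_pieceMeasure (D i).piece_subset_cell (D i).isCompact_cell
  refine ⟨CosineData.pi Q', fun η => ?_, ?_⟩
  · obtain ⟨C, hC⟩ := (CosineData.pi Q').bdd_weight
    have hint := (CosineData.pi Q').integrable (CosineData.pi Q').measurable_weight hC η
    have hbase : (CosineData.pi Q').base =
        ∑ j : ∀ i, ι i, (volume.restrict (blockPi k fun i => (D i).piece (j i))).map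
          fun u i => (j i, block k i u) := by
      rw [← pi_pieceMeasure]
      exact congrArg Measure.pi (funext hb)
    have hm : ∀ j : ∀ i, ι i, Measurable fun (u : Fin (∑ i, k i) → ℝ) i => (j i, block k i u) :=
      fun j => measurable_pi_lambda _ fun i =>
        measurable_prodMk_left.comp (block k i).continuous.measurable
    rw [hbase, integrable_finsetSum_measure] at hint
    rw [CosineData.density, hbase, integral_finsetSum_measure hint]
    refine Finset.sum_congr rfl fun j hj => ?_
    rw [integral_map (hm j).aemeasurable (hint j hj).aestronglyMeasurable]
    refine setIntegral_congr_fun ((LocalData.pi D hp hq hφ).measurableSet_piece j) fun u hu => ?_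
    have h1 := fun i => (hQ i (j i) (block k i u) (hu i)).1
    have h2 := fun i => (hQ i (j i) (block k i u) (hu i)).2.1
    have h3 := fun i => (hQ i (j i) (block k i u) (hu i)).2.2
    have hw : (CosineData.pi Q').weight (fun i => (j i, block k i u)) =
        (∏ i, (D i).coef (j i) (z i, block k i u)) *
          ∏ i, |minor (e i (j i, block k i u)) ((D i).mat (j i) (z i) (block k i u))| := by
      rw [← Finset.prod_mul_distrib]
      change ∏ i, (Q i).weight (j i, block k i u) = _
      exact Finset.prod_congr rfl fun i _ => h2 i
    have hmap : (CosineData.pi Q').map (fun i => (j i, block k i u)) = stackMap fun i =>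
        redMap (e i (j i, block k i u)) ((D i).mat (j i) (z i) (block k i u)) ∘L
          (T i ∘L (D i).A (j i) (z i, block k i u) ∘L ContinuousLinearMap.proj i) :=
      congrArg stackMap (funext fun i => by
        change (Q i).map (j i, block k i u) ∘L ContinuousLinearMap.proj i = _
        rw [h3]
        rfl)
    change (CosineData.pi Q').weight _ * absDet ((CosineData.pi Q').map _) η = _
    rw [hw, hmap, mul_assoc]
    refine congrArg ((∏ i, (D i).coef (j i) (z i, block k i u)) * ·) ?_
    -- The basis vectors of ℝ^{∑ k i} are fibre directions of one factor and vanish in the other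
    -- blocks, which gives the block diagonal shape. The columns A η carry no fibre correction,
    -- hence the 0.
    refine (absDet_stackMap_append h h1 _ η 0 _ _ _ (fun i b x => ?_) (fun i j' b hij => ?_)
      fun l i => ?_).symm
    · change T i ((D i).F (j i) (z i, block k i u)
        (block k i (Pi.single (finSigmaFinEquiv ⟨i, b⟩) 1))) x = _
      rw [block_single_self]
      rfl
    · change T i ((D i).F (j i) (z i, block k i u)
        (block k i (Pi.single (finSigmaFinEquiv ⟨j', b⟩) 1))) = 0
      rw [block_single_ne hij, map_zero, map_zero]
    · refine Eq.trans ?_ (congrArg (_ + ·) (Matrix.mulVec_zero _).symm)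
      exact (add_zero _).symm
  · rw [← CosineData.prodDensity_density]
    refine congrArg prodDensity (funext fun i => funext fun w => ?_)
    exact hdens i fun l => w l i

end NormalProduct

/-! ### Top densities are multiples of |det|. -/

section TopDensity

/-- An alternating map in as many variables as the dimension is determined by its value on a basis.
Hence w₁ ∧ … ∧ w_m is det(S w) times the m-vector of the basis transported by R, and homogeneity of
δ applies. -/
theorem IsDensity.eq_mul_absDet {V V' : Type*} [NormedAddCommGroup V] [NormedSpace ℝ V]
    [NormedAddCommGroup V'] [NormedSpace ℝ V'] [FiniteDimensional ℝ V'] {m : ℕ}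
    {δ : (Fin m → V) → ℝ} (hδ : IsDensity δ) (b : Basis (Fin m) ℝ V') (S : V →L[ℝ] V')
    (R : V' →L[ℝ] V) (hRS : ∀ v, R (S v) = v) (w : Fin m → V) :
    δ w = δ (fun i => R (b i)) *
      absDet (b.equivFunL : V' →L[ℝ] (Fin m → ℝ)) (fun i => S (w i)) := by
  let A : V' [⋀^Fin m]→ₗ[ℝ] ⋀[ℝ]^m V :=
    (exteriorPower.ιMulti ℝ m).compLinearMap (R : V' →ₗ[ℝ] V)
  have hA : A = (LinearMap.toSpanSingleton ℝ _ (A b)).compAlternatingMap b.det := by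
    refine Basis.ext_alternating b fun v hv => ?_
    obtain ⟨σ, rfl⟩ : ∃ σ : Equiv.Perm (Fin m), ⇑σ = v :=
      ⟨Equiv.ofBijective v (Finite.injective_iff_bijective.1 hv), rfl⟩
    change A (b ∘ σ) = _
    rw [A.map_perm]
    change _ = b.det (b ∘ σ) • A b
    rw [b.det.map_perm, b.det_self]
    simp
  have hw : exteriorPower.ιMulti ℝ m w =
      b.det (fun i => S (w i)) • exteriorPower.ιMulti ℝ m fun i => R (b i) := by
    have := congrArg (fun f => f fun i => S (w i)) hA
    refine Eq.trans ?_ this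
    change _ = exteriorPower.ιMulti ℝ m fun i => R (S (w i))
    simp_rw [hRS]
  rw [hδ.map_smul _ _ _ hw, mul_comm]
  congr 1

end TopDensity

/-! ### Derivatives of charts for manifolds modelled on a normed space. -/

section SelfModel

variable {E : Type*} [NormedAddCommGroup E] [NormedSpace ℝ E] {M : Type*} [TopologicalSpace M]
  [ChartedSpace E M] [IsManifold 𝓘(ℝ, E) ∞ M]

theorem mdifferentiableAt_extChartAt_symm (x : M) {z : E} (hz : z ∈ (extChartAt 𝓘(ℝ, E) x).target) :
    MDifferentiableAt 𝓘(ℝ, E) 𝓘(ℝ, E) (extChartAt 𝓘(ℝ, E) x).symm z := by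
  have : IsManifold 𝓘(ℝ, E) 1 M := IsManifold.of_le (n := ∞) (by simp)
  have h := mdifferentiableWithinAt_extChartAt_symm (I := 𝓘(ℝ, E)) hz
  rwa [modelWithCornersSelf_coe, range_id, mdifferentiableWithinAt_univ] at h

theorem mfderiv_extChartAt_apply_mfderiv_symm (x : M) {z : E}
    (hz : z ∈ (extChartAt 𝓘(ℝ, E) x).target) (v : E) :
    mfderiv 𝓘(ℝ, E) 𝓘(ℝ, E) (extChartAt 𝓘(ℝ, E) x) ((extChartAt 𝓘(ℝ, E) x).symm z)
      (mfderiv 𝓘(ℝ, E) 𝓘(ℝ, E) (extChartAt 𝓘(ℝ, E) x).symm z v) = v := by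
  have : IsManifold 𝓘(ℝ, E) 1 M := IsManifold.of_le (n := ∞) (by simp)
  have h := mfderiv_extChartAt_comp_mfderivWithin_extChartAt_symm (I := 𝓘(ℝ, E)) hz
  rw [modelWithCornersSelf_coe, range_id, mfderivWithin_univ] at h
  exact congrArg (fun L : E →L[ℝ] E => L v) h

theorem mfderiv_symm_apply_mfderiv_extChartAt (x : M) {y : M}
    (hy : y ∈ (extChartAt 𝓘(ℝ, E) x).source) (v : E) :
    mfderiv 𝓘(ℝ, E) 𝓘(ℝ, E) (extChartAt 𝓘(ℝ, E) x).symm (extChartAt 𝓘(ℝ, E) x y)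
      (mfderiv 𝓘(ℝ, E) 𝓘(ℝ, E) (extChartAt 𝓘(ℝ, E) x) y v) = v := by
  have : IsManifold 𝓘(ℝ, E) 1 M := IsManifold.of_le (n := ∞) (by simp)
  have h := mfderivWithin_extChartAt_symm_comp_mfderiv_extChartAt' (I := 𝓘(ℝ, E)) hy
  rw [modelWithCornersSelf_coe, range_id, mfderivWithin_univ] at h
  exact congrArg (fun L : E →L[ℝ] E => L v) h

theorem mfderiv_extChartAt_symm_self (x : M) (v : E) :
    mfderiv 𝓘(ℝ, E) 𝓘(ℝ, E) (extChartAt 𝓘(ℝ, E) x).symm (extChartAt 𝓘(ℝ, E) x x) v = v := by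
  have : IsManifold 𝓘(ℝ, E) 1 M := IsManifold.of_le (n := ∞) (by simp)
  have h := mfderivWithin_range_extChartAt_symm (I := 𝓘(ℝ, E)) (x := x)
  rw [modelWithCornersSelf_coe, range_id, mfderivWithin_univ] at h
  exact congrArg (fun L : E →L[ℝ] E => L v) h

end SelfModel

/-! ### Chain rules for q read in a trivialization of p. -/

section Chain

variable {EX EY EΓ P : Type*} [NormedAddCommGroup EX] [NormedSpace ℝ EX]
  [NormedAddCommGroup EY] [NormedSpace ℝ EY] [NormedAddCommGroup EΓ] [NormedSpace ℝ EΓ]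
  [NormedAddCommGroup P] [NormedSpace ℝ P]
  {X Y Γ : Type*} [TopologicalSpace X] [ChartedSpace EX X] [TopologicalSpace Y] [ChartedSpace EY Y]
  [TopologicalSpace Γ] [ChartedSpace EΓ Γ] {p : X → Y} {q : X → Γ} {χ : Γ → EΓ} {ψ : EY × P → X}
  {z : EY} {u : P}

theorem mfderiv_fiber (hψ : MDifferentiableAt 𝓘(ℝ, EY × P) 𝓘(ℝ, EX) ψ (z, u))
    (hq : MDifferentiableAt 𝓘(ℝ, EX) 𝓘(ℝ, EΓ) q (ψ (z, u)))
    (hχ : MDifferentiableAt 𝓘(ℝ, EΓ) 𝓘(ℝ, EΓ) χ (q (ψ (z, u)))) (v : P) :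
    mfderiv 𝓘(ℝ, EΓ) 𝓘(ℝ, EΓ) χ (q (ψ (z, u))) (mfderiv 𝓘(ℝ, EX) 𝓘(ℝ, EΓ) q (ψ (z, u))
      (mfderiv 𝓘(ℝ, P) 𝓘(ℝ, EX) (fun u => ψ (z, u)) u v)) =
      fderiv ℝ (χ ∘ q ∘ ψ) (z, u) (0, v) := by
  have h1 : HasMFDerivAt 𝓘(ℝ, P) 𝓘(ℝ, EY × P) (fun u : P => (z, u)) u
      (ContinuousLinearMap.inr ℝ EY P) := (hasFDerivAt_prodMk_right z u).hasMFDerivAt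
  have h2 := (hψ.hasMFDerivAt.comp u h1).mfderiv
  have h3 := (hχ.hasMFDerivAt.comp (z, u) (hq.hasMFDerivAt.comp (z, u) hψ.hasMFDerivAt)).mfderiv
  rw [mfderiv_eq_fderiv] at h3
  change mfderiv 𝓘(ℝ, P) 𝓘(ℝ, EX) (ψ ∘ fun u => (z, u)) u = _ at h2
  have h2' : mfderiv 𝓘(ℝ, P) 𝓘(ℝ, EX) (fun u => ψ (z, u)) u v =
      mfderiv 𝓘(ℝ, EY × P) 𝓘(ℝ, EX) ψ (z, u) (0, v) := congrArg (fun L : P →L[ℝ] EX => L v) h2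
  have h3' := congrArg (fun L : EY × P →L[ℝ] EΓ => L (0, v)) h3
  exact (congrArg (fun w => mfderiv 𝓘(ℝ, EΓ) 𝓘(ℝ, EΓ) χ (q (ψ (z, u)))
    (mfderiv 𝓘(ℝ, EX) 𝓘(ℝ, EΓ) q (ψ (z, u)) w)) h2').trans h3'.symm

/-- Since (g₁ ∘ p, g₂) is a local right inverse of ψ, the map χ ∘ q factors through it. In the
derivative, the base component depends on ξ only through dp(ξ), and t is the fibre component. -/
theorem mfderiv_lift {g₁ : Y → EY} {g₂ : X → P}
    (hψ : MDifferentiableAt 𝓘(ℝ, EY × P) 𝓘(ℝ, EX) ψ (z, u))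
    (hq : MDifferentiableAt 𝓘(ℝ, EX) 𝓘(ℝ, EΓ) q (ψ (z, u)))
    (hχ : MDifferentiableAt 𝓘(ℝ, EΓ) 𝓘(ℝ, EΓ) χ (q (ψ (z, u))))
    (hp : MDifferentiableAt 𝓘(ℝ, EX) 𝓘(ℝ, EY) p (ψ (z, u)))
    (hg₁ : MDifferentiableAt 𝓘(ℝ, EY) 𝓘(ℝ, EY) g₁ (p (ψ (z, u))))
    (hg₂ : MDifferentiableAt 𝓘(ℝ, EX) 𝓘(ℝ, P) g₂ (ψ (z, u)))
    (hg : (g₁ (p (ψ (z, u))), g₂ (ψ (z, u))) = (z, u))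
    (hinv : (fun x => ψ (g₁ (p x), g₂ x)) =ᶠ[𝓝 (ψ (z, u))] id) (ξ : EX) :
    ∃ t : P, mfderiv 𝓘(ℝ, EΓ) 𝓘(ℝ, EΓ) χ (q (ψ (z, u)))
      (mfderiv 𝓘(ℝ, EX) 𝓘(ℝ, EΓ) q (ψ (z, u)) ξ) =
      fderiv ℝ (χ ∘ q ∘ ψ) (z, u) (mfderiv 𝓘(ℝ, EY) 𝓘(ℝ, EY) g₁ (p (ψ (z, u)))
        (mfderiv 𝓘(ℝ, EX) 𝓘(ℝ, EY) p (ψ (z, u)) ξ), t) := by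
  refine ⟨mfderiv 𝓘(ℝ, EX) 𝓘(ℝ, P) g₂ (ψ (z, u)) ξ, ?_⟩
  have h3 := hχ.hasMFDerivAt.comp (z, u) (hq.hasMFDerivAt.comp (z, u) hψ.hasMFDerivAt)
  have h3' := h3.mfderiv
  rw [mfderiv_eq_fderiv] at h3'
  rw [← h3'] at h3
  have hg₁' := hg₁.hasMFDerivAt.comp (ψ (z, u)) hp.hasMFDerivAt
  let L : EX →L[ℝ] EY × P := ContinuousLinearMap.prod
    ((mfderiv 𝓘(ℝ, EY) 𝓘(ℝ, EY) g₁ (p (ψ (z, u))) : EY →L[ℝ] EY) ∘L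
      (mfderiv 𝓘(ℝ, EX) 𝓘(ℝ, EY) p (ψ (z, u)) : EX →L[ℝ] EY))
    (mfderiv 𝓘(ℝ, EX) 𝓘(ℝ, P) g₂ (ψ (z, u)) : EX →L[ℝ] P)
  have h4 : HasMFDerivAt 𝓘(ℝ, EX) 𝓘(ℝ, EY × P) (fun x => (g₁ (p x), g₂ x)) (ψ (z, u)) L :=
    ⟨hg₁'.1.prodMk hg₂.hasMFDerivAt.1, hg₁'.2.prodMk hg₂.hasMFDerivAt.2⟩
  rw [← hg] at h3
  have h5 := h3.comp (ψ (z, u)) h4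
  have h6 := hχ.hasMFDerivAt.comp (ψ (z, u)) hq.hasMFDerivAt
  have h7 : (χ ∘ q) =ᶠ[𝓝 (ψ (z, u))] (χ ∘ q ∘ ψ) ∘ fun x => (g₁ (p x), g₂ x) := by
    filter_upwards [hinv] with x hx
    exact congrArg (χ ∘ q) hx.symm
  have h8 := hasMFDerivAt_unique h6 (h5.congr_of_eventuallyEq h7)
  have h9 := congrArg (fun L : EX →L[ℝ] EΓ => L ξ) h8
  rw [hg] at h9
  exact h9

end Chain

/-! ### Transport of parametrizations from the model fibre to the fibres of p. -/

section Embed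

variable {E : Type*} [NormedAddCommGroup E] [NormedSpace ℝ E] {H : Type*} [TopologicalSpace H]
  {I : ModelWithCorners ℝ E H} {X : Type*} [TopologicalSpace X] [ChartedSpace H X]
  {E' : Type*} [NormedAddCommGroup E'] [NormedSpace ℝ E'] {H' : Type*} [TopologicalSpace H']
  {J : ModelWithCorners ℝ E' H'} {F : Type*} [TopologicalSpace F] [ChartedSpace H' F]

theorem IsParam.embed {k : ℕ} {ι : Type*} {dom piece : ι → Set (Fin k → ℝ)}
    {param : ι → (Fin k → ℝ) → F} (h : IsParam J univ dom piece param) {s : F → X}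
    (hs : ContMDiff J I ∞ s) {N : Set X} {g : X → F} (hN : IsOpen N) (hg : ContMDiffOn I J ∞ g N)
    (hsg : ∀ f, s f ∈ N ∧ g (s f) = f) :
    IsParam I (range s) dom piece fun j u => s (param j u) where
  isOpen_dom := h.isOpen_dom
  piece_subset := h.piece_subset
  measurableSet_piece := h.measurableSet_piece
  contMDiffOn j := hs.comp_contMDiffOn (h.contMDiffOn j)
  exists_chart j := by
    obtain ⟨V, κ, hV, hκ, h1, h2⟩ := h.exists_chart j
    refine ⟨N ∩ g ⁻¹' V, κ ∘ g, hg.continuousOn.isOpen_inter_preimage hN hV,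
      hκ.comp (hg.mono inter_subset_left) inter_subset_right, fun u hu => ⟨⟨mem_range_self _,
        (hsg _).1, ?_⟩, ?_⟩, ?_⟩
    · rw [mem_preimage, (hsg _).2]; exact (h1 u hu).1.2
    · rw [Function.comp_apply, (hsg _).2]; exact (h1 u hu).2
    · rintro _ ⟨⟨f, rfl⟩, -, hf⟩
      rw [mem_preimage, (hsg _).2] at hf
      rw [Function.comp_apply, (hsg _).2]
      exact ⟨(h2 f ⟨trivial, hf⟩).1, congrArg s (h2 f ⟨trivial, hf⟩).2⟩
  disjoint i j hij := by
    have hinj : Function.Injective s := fun f f' hff => by rw [← (hsg f).2, hff, (hsg f').2]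
    have := (Set.disjoint_image_iff hinj).2 (h.disjoint i j hij)
    rwa [← image_comp, ← image_comp] at this
  cover := by
    rw [← image_univ, ← h.cover, image_iUnion]
    exact iUnion_congr fun j => image_comp s (param j) (piece j)

end Embed

/-! ### Decomposition of a compact manifold into finitely many chart cells. -/

section Cells

variable {EF : Type*} [NormedAddCommGroup EF] [NormedSpace ℝ EF] {k : ℕ}
  {F : Type*} [TopologicalSpace F] [ChartedSpace EF F]

/-- The chart of `F` at `f` with values in `ℝ^k`. -/
def flatChart (L : EF ≃L[ℝ] (Fin k → ℝ)) (f : F) : PartialEquiv F (Fin k → ℝ) :=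
  (extChartAt 𝓘(ℝ, EF) f).trans L.toEquiv.toPartialEquiv

variable (L : EF ≃L[ℝ] (Fin k → ℝ))

theorem flatChart_source (f : F) :
    (flatChart L f).source = (extChartAt 𝓘(ℝ, EF) f).source := by
  simp [flatChart]

theorem flatChart_target (f : F) :
    (flatChart L f).target = L.symm ⁻¹' (extChartAt 𝓘(ℝ, EF) f).target := by
  rw [flatChart, PartialEquiv.trans_target]
  simp only [Equiv.toPartialEquiv_target, univ_inter]
  rfl

theorem isOpen_flatChart_source (f : F) : IsOpen (flatChart L f).source := by
  rw [flatChart_source]; exact isOpen_extChartAt_source f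

theorem isOpen_flatChart_target (f : F) : IsOpen (flatChart L f).target := by
  rw [flatChart_target]
  exact (isOpen_extChartAt_target f).preimage L.symm.continuous

theorem mem_flatChart_source (f : F) : f ∈ (flatChart L f).source := by
  rw [flatChart_source]; exact mem_extChartAt_source f

variable [IsManifold 𝓘(ℝ, EF) ∞ F]

theorem contMDiffOn_flatChart (f : F) :
    ContMDiffOn 𝓘(ℝ, EF) 𝓘(ℝ, Fin k → ℝ) ∞ (flatChart L f) (flatChart L f).source := by
  rw [flatChart_source, extChartAt_source]
  exact L.contDiff.contMDiff.comp_contMDiffOn contMDiffOn_extChartAt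

theorem contMDiffOn_flatChart_symm (f : F) :
    ContMDiffOn 𝓘(ℝ, Fin k → ℝ) 𝓘(ℝ, EF) ∞ (flatChart L f).symm (flatChart L f).target := by
  rw [flatChart_target]
  exact (contMDiffOn_extChartAt_symm f).comp L.symm.contDiff.contMDiff.contMDiffOn fun u hu => hu

/-- Compactness gives a finite cover by chart balls. The sets O f leave freedom to shrink the balls,
so that later constructions are defined on their closures. -/
theorem exists_isParam_univ [CompactSpace F] {O : F → Set (Fin k → ℝ)}
    (hO : ∀ f, O f ∈ 𝓝 (flatChart L f f)) :
    ∃ (N : ℕ) (c : Fin N → F) (r : Fin N → ℝ) (piece : Fin N → Set (Fin k → ℝ)),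
      (∀ j, Metric.closedBall (flatChart L (c j) (c j)) (r j) ⊆
        O (c j) ∩ (flatChart L (c j)).target) ∧
      IsParam 𝓘(ℝ, EF) (univ : Set F) (fun j => Metric.ball (flatChart L (c j) (c j)) (r j)) piece
        fun j => (flatChart L (c j)).symm := by
  have hnhds : ∀ f, O f ∩ (flatChart L f).target ∈ 𝓝 (flatChart L f f) := fun f =>
    Filter.inter_mem (hO f) ((isOpen_flatChart_target L f).mem_nhds
      ((flatChart L f).map_source (mem_flatChart_source L f)))
  choose R hR hRO using fun f => Metric.nhds_basis_closedBall.mem_iff.1 (hnhds f)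
  let B : F → Set (Fin k → ℝ) := fun f => Metric.ball (flatChart L f f) (R f)
  have hBt : ∀ f, B f ⊆ (flatChart L f).target := fun f =>
    Metric.ball_subset_closedBall.trans ((hRO f).trans inter_subset_right)
  let V : F → Set F := fun f => (flatChart L f).source ∩ flatChart L f ⁻¹' B f
  have hV : ∀ f, IsOpen (V f) := fun f =>
    (contMDiffOn_flatChart L f).continuousOn.isOpen_inter_preimage (isOpen_flatChart_source L f)
      Metric.isOpen_ball
  obtain ⟨t, ht⟩ := CompactSpace.elim_nhds_subcover V fun f =>
    (hV f).mem_nhds ⟨mem_flatChart_source L f, Metric.mem_ball_self (hR f)⟩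
  let c : Fin t.card → F := fun j => t.equivFin.symm j
  have hc : ∀ x, ∃ j, x ∈ V (c j) := fun x => by
    have hx : x ∈ ⋃ f ∈ t, V f := by rw [ht]; trivial
    obtain ⟨f, hf, hxf⟩ := mem_iUnion₂.1 hx
    exact ⟨t.equivFin ⟨f, hf⟩, by simpa [c] using hxf⟩
  have hVB : ∀ f, ∀ u ∈ B f, (flatChart L f).symm u ∈ V f ∧ flatChart L f ((flatChart L f).symm u) = u :=
    fun f u hu => by
      have h1 := (flatChart L f).right_inv (hBt f hu)
      refine ⟨⟨(flatChart L f).map_target (hBt f hu), ?_⟩, h1⟩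
      rw [mem_preimage, h1]; exact hu
  -- Each piece drops the points covered by earlier balls. This makes the images disjoint, and a
  -- point is caught by the first ball containing it.
  refine ⟨t.card, c, fun j => R (c j), fun j => B (c j) \ (B (c j) ∩ (flatChart L (c j)).symm ⁻¹'
    ⋃ i < j, V (c i)), fun j => hRO (c j), ?_⟩
  exact {
    isOpen_dom := fun j => Metric.isOpen_ball
    piece_subset := fun j => sdiff_subset
    measurableSet_piece := fun j => by
      refine Metric.isOpen_ball.measurableSet.diff (IsOpen.measurableSet ?_)
      exact ((contMDiffOn_flatChart_symm L (c j)).continuousOn.mono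
        (hBt (c j))).isOpen_inter_preimage Metric.isOpen_ball
          (isOpen_iUnion fun i => isOpen_iUnion fun _ => hV _)
    contMDiffOn := fun j => (contMDiffOn_flatChart_symm L (c j)).mono (hBt (c j))
    exists_chart := fun j => ⟨V (c j), flatChart L (c j), hV _,
      (contMDiffOn_flatChart L (c j)).mono inter_subset_left,
      fun u hu => ⟨⟨trivial, (hVB _ u hu).1⟩, (hVB _ u hu).2⟩,
      fun x hx => ⟨hx.2.2, (flatChart L (c j)).left_inv hx.2.1⟩⟩
    disjoint := by
      have key : ∀ i j, i < j → Disjoint ((flatChart L (c i)).symm '' (B (c i) \ (B (c i) ∩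
          (flatChart L (c i)).symm ⁻¹' ⋃ l < i, V (c l)))) ((flatChart L (c j)).symm '' (B (c j) \
          (B (c j) ∩ (flatChart L (c j)).symm ⁻¹' ⋃ l < j, V (c l)))) := by
        intro i j hij
        rw [Set.disjoint_left]
        rintro _ ⟨u, hu, rfl⟩ ⟨v, hv, huv⟩
        refine hv.2 ⟨hv.1, ?_⟩
        rw [mem_preimage, huv]
        exact mem_iUnion₂.2 ⟨i, hij, (hVB _ u hu.1).1⟩
      intro i j hij
      rcases lt_or_gt_of_ne hij with h | h
      · exact key i j h
      · exact (key j i h).symm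
    cover := by
      refine eq_univ_of_forall fun x => ?_
      obtain ⟨j, hj, hmin⟩ := WellFounded.has_min (wellFounded_lt (α := Fin t.card))
        {j | x ∈ V (c j)} (hc x)
      have hx := (flatChart L (c j)).left_inv hj.1
      refine mem_iUnion.2 ⟨j, flatChart L (c j) x, ⟨hj.2, fun h => ?_⟩, hx⟩
      have h2 := h.2
      rw [mem_preimage, hx] at h2
      obtain ⟨i, hi, hxi⟩ := mem_iUnion₂.1 h2
      exact hmin i hxi hi }

end Cells

/-! ### Smoothness of bundle projections. -/

section FiberBundle

variable {E : Type*} [NormedAddCommGroup E] [NormedSpace ℝ E] {H : Type*} [TopologicalSpace H]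
  {I : ModelWithCorners ℝ E H} {X : Type*} [TopologicalSpace X] [ChartedSpace H X]
  {E' : Type*} [NormedAddCommGroup E'] [NormedSpace ℝ E'] {H' : Type*} [TopologicalSpace H']
  {J : ModelWithCorners ℝ E' H'} {Y : Type*} [TopologicalSpace Y] [ChartedSpace H' Y]
  {E'' : Type*} [NormedAddCommGroup E''] [NormedSpace ℝ E''] {H'' : Type*} [TopologicalSpace H'']
  {K : ModelWithCorners ℝ E'' H''} {F : Type*} [TopologicalSpace F] [ChartedSpace H'' F]

theorem IsSmoothFiberBundle.contMDiff {p : X → Y} (h : IsSmoothFiberBundle I J K F p) :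
    ContMDiff I J ∞ p := by
  intro x
  obtain ⟨e, hx, he, -⟩ := h (p x)
  have hxs : x ∈ e.source := e.mem_source.2 hx
  have h1 : ContMDiffAt I J ∞ (fun x => (e x).1) x :=
    contMDiff_fst.contMDiffAt.comp x (he.contMDiffAt (e.open_source.mem_nhds hxs))
  refine h1.congr_of_eventuallyEq ?_
  filter_upwards [e.open_source.mem_nhds hxs] with x' hx' using (e.coe_fst hx').symm

end FiberBundle

/-! ### Construction of local data for a double fibration. -/

section Existence

variable {EX EY EΓ EF EG : Type*}
  [NormedAddCommGroup EX] [NormedSpace ℝ EX]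
  [NormedAddCommGroup EY] [NormedSpace ℝ EY]
  [NormedAddCommGroup EΓ] [NormedSpace ℝ EΓ] [FiniteDimensional ℝ EΓ]
  [NormedAddCommGroup EF] [NormedSpace ℝ EF]
  [NormedAddCommGroup EG] [NormedSpace ℝ EG]
  {X Y Γ F G : Type*}
  [TopologicalSpace X] [ChartedSpace EX X]
  [TopologicalSpace Y] [ChartedSpace EY Y] [IsManifold 𝓘(ℝ, EY) ∞ Y]
  [TopologicalSpace Γ] [ChartedSpace EΓ Γ] [IsManifold 𝓘(ℝ, EΓ) ∞ Γ]
  [TopologicalSpace F] [ChartedSpace EF F] [IsManifold 𝓘(ℝ, EF) ∞ F]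
  [TopologicalSpace G] [ChartedSpace EG G]
  {p : X → Y} {q : X → Γ} {m k : ℕ}

theorem DensityFamily.congr_point {Φ : DensityFamily 𝓘(ℝ, EΓ) Γ m} {γ γ' : Γ} (h : γ = γ')
    (v : Fin m → EΓ) : (Φ γ v : ℝ) = Φ γ' v := by
  subst h; rfl

/-- A top density in a chart of the manifold. -/
theorem IsDensityOn.eq_mul_absDet {Φ : DensityFamily 𝓘(ℝ, EΓ) Γ m}
    (hΦ : IsDensityOn 𝓘(ℝ, EΓ) Φ) (b : Basis (Fin m) ℝ EΓ) (γ₀ : Γ) {γ : Γ}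
    (hγ : γ ∈ (extChartAt 𝓘(ℝ, EΓ) γ₀).source) (w : Fin m → TangentSpace 𝓘(ℝ, EΓ) γ) :
    Φ γ w = Φ ((extChartAt 𝓘(ℝ, EΓ) γ₀).symm (extChartAt 𝓘(ℝ, EΓ) γ₀ γ))
        (fun i => mfderiv 𝓘(ℝ, EΓ) 𝓘(ℝ, EΓ) (extChartAt 𝓘(ℝ, EΓ) γ₀).symm
          (extChartAt 𝓘(ℝ, EΓ) γ₀ γ) (b i)) *
      absDet (b.equivFunL : EΓ →L[ℝ] (Fin m → ℝ))
        (fun i => mfderiv 𝓘(ℝ, EΓ) 𝓘(ℝ, EΓ) (extChartAt 𝓘(ℝ, EΓ) γ₀) γ (w i)) := by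
  refine ((hΦ.isDensity γ).eq_mul_absDet (V := EΓ) b
    (mfderiv 𝓘(ℝ, EΓ) 𝓘(ℝ, EΓ) (extChartAt 𝓘(ℝ, EΓ) γ₀) γ)
    (mfderiv 𝓘(ℝ, EΓ) 𝓘(ℝ, EΓ) (extChartAt 𝓘(ℝ, EΓ) γ₀).symm (extChartAt 𝓘(ℝ, EΓ) γ₀ γ))
    (mfderiv_symm_apply_mfderiv_extChartAt γ₀ hγ) w).trans ?_
  refine congrArg (· * _) ?_
  exact DensityFamily.congr_point ((extChartAt 𝓘(ℝ, EΓ) γ₀).left_inv hγ).symm _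

/-- A trivialization of p together with charts of Y and F gives coordinates (z, u) on X. Near each
point of the fibre over z₁, q maps into a single chart of Γ. Compactness of F leaves finitely many
such charts, valid over one neighbourhood of z₁. -/
theorem exists_localData (h : IsDoubleFibration EX EY EΓ EF EG F G p q)
    (L : EF ≃L[ℝ] (Fin k → ℝ)) (b : Basis (Fin m) ℝ EΓ) {Φ : DensityFamily 𝓘(ℝ, EΓ) Γ m}
    (hΦ : IsDensityOn 𝓘(ℝ, EΓ) Φ) (y₀ : Y) {z₁ : EY}
    (hz₁ : z₁ ∈ (extChartAt 𝓘(ℝ, EY) y₀).target) :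
    ∃ (N : ℕ) (U : Set EY), U ∈ 𝓝 z₁ ∧ U ⊆ (extChartAt 𝓘(ℝ, EY) y₀).target ∧
      Nonempty (LocalData 𝓘(ℝ, EX) 𝓘(ℝ, EY) 𝓘(ℝ, EΓ) p q Φ (extChartAt 𝓘(ℝ, EY) y₀).symm k
        (b.equivFunL : EΓ →L[ℝ] (Fin m → ℝ)) U (Fin N)) := by
  have hp := h.fiberBundle_left.contMDiff
  have hq := h.fiberBundle_right.contMDiff
  have := h.compact_fiber
  set φ := extChartAt 𝓘(ℝ, EY) y₀ with hφ
  obtain ⟨e, hy₁, he, hes⟩ := h.fiberBundle_left (φ.symm z₁)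
  have hφs : ContMDiffOn 𝓘(ℝ, EY) 𝓘(ℝ, EY) ∞ φ.symm φ.target := contMDiffOn_extChartAt_symm y₀
  let ψ : F → EY × (Fin k → ℝ) → X := fun f x =>
    e.toOpenPartialHomeomorph.symm (φ.symm x.1, (flatChart L f).symm x.2)
  let B₀ : Set EY := φ.target ∩ φ.symm ⁻¹' e.baseSet
  have hB₀ : IsOpen B₀ := hφs.continuousOn.isOpen_inter_preimage (isOpen_extChartAt_target y₀)
    e.open_baseSet
  have hD₀ : ∀ f : F, IsOpen (B₀ ×ˢ (flatChart L f).target) := fun f =>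
    hB₀.prod (isOpen_flatChart_target L f)
  have hψ : ∀ f : F, ContMDiffOn 𝓘(ℝ, EY × (Fin k → ℝ)) 𝓘(ℝ, EX) ∞ (ψ f)
      (B₀ ×ˢ (flatChart L f).target) := fun f => by
    refine hes.comp (t := e.target) (ContMDiffOn.prodMk ?_ ?_) fun x hx => ?_
    · exact hφs.comp contDiff_fst.contMDiff.contMDiffOn fun x hx => hx.1.1
    · exact (contMDiffOn_flatChart_symm L f).comp contDiff_snd.contMDiff.contMDiffOn
        fun x hx => hx.2
    · rw [mem_preimage, e.target_eq]
      exact ⟨hx.1.2, trivial⟩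
  have hpψ : ∀ f : F, ∀ z ∈ B₀, ∀ u, ψ f (z, u) ∈ e.source ∧ p (ψ f (z, u)) = φ.symm z ∧
      e (ψ f (z, u)) = (φ.symm z, (flatChart L f).symm u) := fun f z hz u => by
    have ht : (φ.symm z, (flatChart L f).symm u) ∈ e.target := by
      rw [e.target_eq]; exact ⟨hz.2, trivial⟩
    exact ⟨e.map_target ht, e.proj_symm_apply ht, e.apply_symm_apply ht⟩
  let χ : F → PartialEquiv Γ EΓ := fun f =>
    extChartAt 𝓘(ℝ, EΓ) (q (ψ f (z₁, flatChart L f f)))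
  let Q : F → EY × (Fin k → ℝ) → EΓ := fun f => χ f ∘ q ∘ ψ f
  -- The open set where the coordinates are defined and q lands in the chart of Γ selected at f. It
  -- contains the product neighbourhoods chosen below.
  let good : F → Set (EY × (Fin k → ℝ)) := fun f =>
    (B₀ ×ˢ (flatChart L f).target) ∩ (q ∘ ψ f) ⁻¹' (χ f).source
  have hgood : ∀ f : F, IsOpen (good f) := fun f =>
    (hq.continuous.comp_continuousOn (hψ f).continuousOn).isOpen_inter_preimage (hD₀ f)
      (isOpen_extChartAt_source _)
  have hQ : ∀ f : F, ContDiffOn ℝ ∞ (Q f) (good f) := fun f => by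
    rw [← contMDiffOn_iff_contDiffOn]
    have hχ : ContMDiffOn 𝓘(ℝ, EΓ) 𝓘(ℝ, EΓ) ∞ (χ f) (χ f).source := by
      rw [extChartAt_source]; exact contMDiffOn_extChartAt
    exact hχ.comp (hq.comp_contMDiffOn ((hψ f).mono inter_subset_left)) fun x hx => hx.2
  have hz₁B : z₁ ∈ B₀ := ⟨hz₁, hy₁⟩
  have hcenter : ∀ f : F, good f ∈ 𝓝 (z₁, flatChart L f f) := fun f =>
    (hgood f).mem_nhds ⟨⟨hz₁B, (flatChart L f).map_source (mem_flatChart_source L f)⟩,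
      mem_extChartAt_source _⟩
  choose U hU O hO hUO using fun f : F => mem_nhds_prod_iff.1 (hcenter f)
  obtain ⟨N, c, r, piece, hr, hF⟩ := exists_isParam_univ L hO
  -- Only finitely many cells occur, so the intersection is still a neighbourhood of z₁, and over it
  -- every closed cell stays in its good set.
  let U₀ : Set EY := B₀ ∩ ⋂ j, U (c j)
  have hU₀ : U₀ ∈ 𝓝 z₁ := Filter.inter_mem (hB₀.mem_nhds hz₁B)
    (Filter.iInter_mem.2 fun j => hU (c j))
  have hcell : ∀ j, U₀ ×ˢ Metric.closedBall (flatChart L (c j) (c j)) (r j) ⊆ good (c j) :=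
    fun j x hx => hUO (c j) ⟨mem_iInter.1 hx.1.2 j, (hr j hx.2).1⟩
  have hpiece : ∀ j, piece j ⊆ Metric.closedBall (flatChart L (c j) (c j)) (r j) := fun j =>
    (hF.piece_subset j).trans Metric.ball_subset_closedBall
  have hmem : ∀ j, ∀ z ∈ U₀, ∀ u ∈ piece j, (z, u) ∈ good (c j) := fun j z hz u hu =>
    hcell j ⟨hz, hpiece j hu⟩
  have hψd : ∀ j, ∀ z ∈ U₀, ∀ u ∈ piece j, MDifferentiableAt 𝓘(ℝ, EY × (Fin k → ℝ)) 𝓘(ℝ, EX)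
      (ψ (c j)) (z, u) := fun j z hz u hu =>
    ((hψ (c j)).contMDiffAt ((hD₀ (c j)).mem_nhds (hmem j z hz u hu).1)).mdifferentiableAt (by simp)
  have hχd : ∀ j, ∀ z ∈ U₀, ∀ u ∈ piece j, MDifferentiableAt 𝓘(ℝ, EΓ) 𝓘(ℝ, EΓ) (χ (c j))
      (q (ψ (c j) (z, u))) := fun j z hz u hu => by
    have h1 := (hmem j z hz u hu).2
    rw [mem_preimage, extChartAt_source] at h1
    have : IsManifold 𝓘(ℝ, EΓ) 1 Γ := IsManifold.of_le (n := ∞) (by simp)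
    exact mdifferentiableAt_extChartAt h1
  have hqd : ∀ x, MDifferentiableAt 𝓘(ℝ, EX) 𝓘(ℝ, EΓ) q x := fun x =>
    hq.contMDiffAt.mdifferentiableAt (by simp)
  have hpd : ∀ x, MDifferentiableAt 𝓘(ℝ, EX) 𝓘(ℝ, EY) p x := fun x =>
    hp.contMDiffAt.mdifferentiableAt (by simp)
  have hfd : ∀ j, ContinuousOn (fderiv ℝ (Q (c j)))
      (U₀ ×ˢ Metric.closedBall (flatChart L (c j) (c j)) (r j)) := fun j =>
    ((hQ (c j)).continuousOn_fderiv_of_isOpen (hgood (c j)) (by simp)).mono (hcell j)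
  refine ⟨N, U₀, hU₀, fun z hz => hz.1.1, ⟨{
    dom := fun j => Metric.ball (flatChart L (c j) (c j)) (r j)
    piece := piece
    cell := fun j => Metric.closedBall (flatChart L (c j) (c j)) (r j)
    param := fun j z u => ψ (c j) (z, u)
    coef := fun j x => Φ ((χ (c j)).symm (Q (c j) x)) fun i =>
      mfderiv 𝓘(ℝ, EΓ) 𝓘(ℝ, EΓ) (χ (c j)).symm (Q (c j) x) (b i)
    C := fun j x => mfderiv 𝓘(ℝ, EΓ) 𝓘(ℝ, EΓ) (χ (c j)) (q (ψ (c j) x))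
    A := fun j x => fderiv ℝ (Q (c j)) x ∘L ContinuousLinearMap.inl ℝ EY (Fin k → ℝ)
    F := fun j x => fderiv ℝ (Q (c j)) x ∘L ContinuousLinearMap.inr ℝ EY (Fin k → ℝ)
    isParam := ?_
    measurableSet_piece := hF.measurableSet_piece
    piece_subset_cell := hpiece
    isCompact_cell := fun j => isCompact_closedBall _ _
    continuousOn_coef := ?_
    continuousOn_A := fun j => (hfd j).clm_comp continuousOn_const
    continuousOn_F := fun j => (hfd j).clm_comp continuousOn_const
    density_eq := ?_
    fiber_eq := ?_
    lift_eq := ?_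
    surjective := ?_ }⟩⟩
  · intro z hz
    have hzB := hz.1
    have hs : ContMDiff 𝓘(ℝ, EF) 𝓘(ℝ, EX) ∞
        fun f : F => e.toOpenPartialHomeomorph.symm (φ.symm z, f) := by
      rw [← contMDiffOn_univ]
      refine hes.comp (t := e.target) (contMDiff_const.prodMk contMDiff_id).contMDiffOn
        fun f _ => ?_
      rw [mem_preimage, e.target_eq]
      exact ⟨hzB.2, trivial⟩
    have hsg : ∀ f : F, e.toOpenPartialHomeomorph.symm (φ.symm z, f) ∈ e.source ∧
        (e (e.toOpenPartialHomeomorph.symm (φ.symm z, f))).2 = f ∧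
        p (e.toOpenPartialHomeomorph.symm (φ.symm z, f)) = φ.symm z := fun f => by
      have ht : (φ.symm z, f) ∈ e.target := by
        rw [e.target_eq]; exact ⟨hzB.2, trivial⟩
      exact ⟨e.map_target ht, congrArg Prod.snd (e.apply_symm_apply ht), e.proj_symm_apply ht⟩
    have hrange : p ⁻¹' {φ.symm z} =
        range fun f : F => e.toOpenPartialHomeomorph.symm (φ.symm z, f) := by
      refine Subset.antisymm (fun x hx => ⟨(e x).2, ?_⟩) (range_subset_iff.2 fun f => (hsg f).2.2)
      have hpx : p x = φ.symm z := hx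
      have hxs : x ∈ e.source := e.mem_source.2 (hpx ▸ hzB.2)
      refine Eq.trans ?_ (e.left_inv hxs)
      refine congrArg e.toOpenPartialHomeomorph.symm (Prod.ext ?_ rfl)
      exact hpx.symm.trans (e.coe_fst hxs).symm
    rw [hrange]
    exact hF.embed hs e.open_source (contMDiff_snd.comp_contMDiffOn he) fun f =>
      ⟨(hsg f).1, (hsg f).2.1⟩
  · intro j
    have h1 := hΦ.continuous (q (ψ (c j) (z₁, flatChart L (c j) (c j))))
    have h2 : ContinuousOn (fun x => (Q (c j) x, fun i => b i))
        (U₀ ×ˢ Metric.closedBall (flatChart L (c j) (c j)) (r j)) :=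
      ((hQ (c j)).continuousOn.mono (hcell j)).prodMk continuousOn_const
    exact h1.comp h2 fun x hx => ⟨(χ (c j)).map_source (hcell j hx).2, trivial⟩
  · intro j z hz u hu w
    exact hΦ.eq_mul_absDet b _ (hmem j z hz u hu).2 w
  · intro j z hz u hu v
    exact mfderiv_fiber (hψd j z hz u hu) (hqd _) (hχd j z hz u hu) v
  · intro j z hz u hu ξ ζ hξ
    have hx := hpψ (c j) z hz.1 u
    have ht : u ∈ (flatChart L (c j)).target := (hmem j z hz u hu).1.2
    have hpx : p (ψ (c j) (z, u)) ∈ φ.source := by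
      rw [hx.2.1]; exact φ.map_target hz.1.1
    have hfx : (e (ψ (c j) (z, u))).2 ∈ (flatChart L (c j)).source := by
      rw [hx.2.2]; exact (flatChart L (c j)).map_target ht
    have he₂ : ContMDiffOn 𝓘(ℝ, EX) 𝓘(ℝ, EF) ∞ (fun x => (e x).2) e.source :=
      contMDiff_snd.comp_contMDiffOn he
    have hN : IsOpen (e.source ∩ (fun x => (e x).2) ⁻¹' (flatChart L (c j)).source) :=
      he₂.continuousOn.isOpen_inter_preimage e.open_source (isOpen_flatChart_source L (c j))
    have hg₂ : MDifferentiableAt 𝓘(ℝ, EX) 𝓘(ℝ, Fin k → ℝ) (fun x => flatChart L (c j) (e x).2)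
        (ψ (c j) (z, u)) := by
      have h1 := (contMDiffOn_flatChart L (c j)).comp (he₂.mono inter_subset_left)
        (fun x (hx : x ∈ e.source ∩ (fun x => (e x).2) ⁻¹' (flatChart L (c j)).source) => hx.2)
      exact (h1.contMDiffAt (hN.mem_nhds ⟨hx.1, hfx⟩)).mdifferentiableAt (by simp)
    have hg₁ : MDifferentiableAt 𝓘(ℝ, EY) 𝓘(ℝ, EY) φ (p (ψ (c j) (z, u))) := by
      rw [hφ, extChartAt_source] at hpx
      exact mdifferentiableAt_extChartAt hpx
    obtain ⟨t, h2⟩ := mfderiv_lift (g₁ := φ) (g₂ := fun x => flatChart L (c j) (e x).2)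
      (hψd j z hz u hu) (hqd _) (hχd j z hz u hu) (hpd _) hg₁ hg₂
      (Prod.ext ((congrArg φ hx.2.1).trans (φ.right_inv hz.1.1))
        ((congrArg (fun x => flatChart L (c j) x.2) hx.2.2).trans
          ((flatChart L (c j)).right_inv ht))) (by
        filter_upwards [hN.mem_nhds ⟨hx.1, hfx⟩,
          (isOpen_extChartAt_source (I := 𝓘(ℝ, EY)) y₀).preimage hp.continuous |>.mem_nhds hpx]
          with x hxs hxφ
        refine Eq.trans ?_ (e.left_inv hxs.1)
        refine congrArg e.toOpenPartialHomeomorph.symm (Prod.ext ?_ ?_)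
        · exact (φ.left_inv hxφ).trans (e.coe_fst hxs.1).symm
        · exact (flatChart L (c j)).left_inv hxs.2) ξ
    refine ⟨t, h2.trans ?_⟩
    have h3 : mfderiv 𝓘(ℝ, EY) 𝓘(ℝ, EY) φ (p (ψ (c j) (z, u)))
        (mfderiv 𝓘(ℝ, EX) 𝓘(ℝ, EY) p (ψ (c j) (z, u)) ξ) = ζ := by
      refine Eq.trans ?_ (mfderiv_extChartAt_apply_mfderiv_symm y₀ hz.1.1 ζ)
      have h4 : ∀ (y : Y) (_ : p (ψ (c j) (z, u)) = y) (w : EY),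
          (mfderiv 𝓘(ℝ, EY) 𝓘(ℝ, EY) φ (p (ψ (c j) (z, u))) w : EY) =
            mfderiv 𝓘(ℝ, EY) 𝓘(ℝ, EY) φ y w := by
        rintro _ rfl w; rfl
      exact (h4 _ hx.2.1 _).trans (congrArg (mfderiv 𝓘(ℝ, EY) 𝓘(ℝ, EY) φ (φ.symm z)) hξ)
    have h5 : ((ζ, t) : EY × (Fin k → ℝ)) = (ζ, 0) + (0, t) := by simp
    refine (congrArg (fun w : EY => fderiv ℝ (Q (c j)) (z, u) (w, t)) h3).trans ?_
    exact (congrArg (fderiv ℝ (Q (c j)) (z, u)) h5).trans (map_add _ _ _)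
  · intro j z hz u hu v
    have hx := hpψ (c j) z hz.1 u
    have hy : φ.symm z ∈ φ.source := φ.map_target hz.1.1
    have h1 : HasMFDerivAt 𝓘(ℝ, EY) 𝓘(ℝ, EY × (Fin k → ℝ)) (fun z : EY => (z, u)) z
        (ContinuousLinearMap.inl ℝ EY (Fin k → ℝ)) :=
      (hasFDerivAt_prodMk_left z u).hasMFDerivAt
    have h2 := (hpd (ψ (c j) (z, u))).hasMFDerivAt.comp z
      ((hψd j z hz u hu).hasMFDerivAt.comp z h1)
    have h3 : HasMFDerivAt 𝓘(ℝ, EY) 𝓘(ℝ, EY) φ.symm z (mfderiv 𝓘(ℝ, EY) 𝓘(ℝ, EY) φ.symm z) :=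
      (mdifferentiableAt_extChartAt_symm y₀ hz.1.1).hasMFDerivAt
    have h4 : (fun z => p (ψ (c j) (z, u))) =ᶠ[𝓝 z] φ.symm := by
      filter_upwards [hB₀.mem_nhds hz.1] with z' hz' using (hpψ (c j) z' hz' u).2.1
    -- The map z ↦ ψ(z, u) covers the inverse chart of Y, whose derivative is onto, so dp is onto as
    -- well.
    have h5 := hasMFDerivAt_unique h3 (h2.congr_of_eventuallyEq h4.symm)
    have h6 := mfderiv_symm_apply_mfderiv_extChartAt y₀ hy v
    rw [φ.right_inv hz.1.1] at h6
    have h7 := congrArg (fun L : EY →L[ℝ] EY =>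
      L (mfderiv 𝓘(ℝ, EY) 𝓘(ℝ, EY) φ (φ.symm z) v)) h5
    exact ⟨_, h7.symm.trans h6⟩

end Existence

/-! ### Normality of a transform that admits local data. -/

section GelfandNormal

variable {E : Type*} [NormedAddCommGroup E] [NormedSpace ℝ E] {H : Type*} [TopologicalSpace H]
  {I : ModelWithCorners ℝ E H}
  {E' : Type*} [NormedAddCommGroup E'] [NormedSpace ℝ E'] [FiniteDimensional ℝ E']
  {H' : Type*} [TopologicalSpace H'] {J : ModelWithCorners ℝ E' H'}
  {E'' : Type*} [NormedAddCommGroup E''] [NormedSpace ℝ E'']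
  {H'' : Type*} [TopologicalSpace H''] {K : ModelWithCorners ℝ E'' H''}
  {X : Type*} [TopologicalSpace X] [ChartedSpace H X]
  {Y : Type*} [TopologicalSpace Y] [ChartedSpace H' Y]
  {Γ : Type*} [TopologicalSpace Γ] [ChartedSpace H'' Γ]
  {d k m : ℕ} {p : X → Y} {q : X → Γ} {Φ : DensityFamily K Γ m}
  {W : Type*} [NormedAddCommGroup W] [NormedSpace ℝ W] {T : W →L[ℝ] (Fin m → ℝ)}

theorem gelfandTransform_eq_at_center {ι : Type} [Fintype ι] (h : d + k = m) (y : Y)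
    (hid : ∀ v : E', (mfderiv 𝓘(ℝ, E') J (extChartAt J y).symm (extChartAt J y y) v : E') = v)
    {U : Set E'} (hU : extChartAt J y y ∈ U)
    (D : LocalData I J K p q Φ (extChartAt J y).symm k T U ι) (η : Fin d → E') :
    gelfandTransform I J K p q h Φ y η =
      ∑ j, ∫ u in D.piece j, D.integrand h j (extChartAt J y y) η u := by
  rw [← D.gelfandTransform_eq h hU η]
  have h1 : ∀ (y' : Y) (_ : y = y') (v : Fin d → E'),
      gelfandTransform I J K p q h Φ y v = gelfandTransform I J K p q h Φ y' v := by
    rintro _ rfl v; rfl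
  refine (h1 _ (extChartAt_to_inv (I := J) y).symm η).trans ?_
  refine congrArg (gelfandTransform I J K p q h Φ ((extChartAt J y).symm (extChartAt J y y))) ?_
  exact funext fun l => (hid (η l)).symm

/-- Stated for abstract local data so that it covers both a single factor and the product. Normality
at y uses the chart centred at y, where by `hid` tangent vectors are their own coordinates.
Continuity is checked at every point of every chart by dominated convergence. -/
theorem isNormalOn_gelfandTransform (h : d + k = m)
    (hid : ∀ (y : Y) (v : E'),
      (mfderiv 𝓘(ℝ, E') J (extChartAt J y).symm (extChartAt J y y) v : E') = v)
    (htarget : ∀ y : Y, extChartAt J y y ∈ (extChartAt J y).target)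
    (hloc : ∀ y₀ : Y, ∀ z₁ ∈ (extChartAt J y₀).target, ∃ (ι : Type) (_ : Fintype ι)
      (_ : MeasurableSpace ι) (_ : MeasurableSingletonClass ι) (U : Set E'), U ∈ 𝓝 z₁ ∧
      Nonempty (LocalData I J K p q Φ (extChartAt J y₀).symm k T U ι)) :
    IsNormalOn J (gelfandTransform I J K p q h Φ) := by
  have key : ∀ y : Y, ∃ (ι : Type) (_ : MeasurableSpace ι)
      (Q : CosineData E' (ι × (Fin k → ℝ)) d), gelfandTransform I J K p q h Φ y = Q.density :=
    fun y => by
      obtain ⟨ι, _, _, _, U, hU, ⟨D⟩⟩ := hloc y _ (htarget y)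
      obtain ⟨Q, -, -, -, hQ⟩ := D.exists_density_eq h (mem_of_mem_nhds hU)
      refine ⟨ι, inferInstance, Q, funext fun η => ?_⟩
      exact (gelfandTransform_eq_at_center h y (hid y) (mem_of_mem_nhds hU) D η).trans (hQ η).symm
  refine ⟨⟨fun y => ?_, fun y₀ => ?_⟩, fun y => ?_⟩
  · obtain ⟨ι, _, Q, hQ⟩ := key y
    rw [hQ]
    exact Q.isDensity_density
  · rintro ⟨z₁, η₁⟩ hz
    obtain ⟨ι, _, _, _, U, hU, ⟨D⟩⟩ := hloc y₀ z₁ hz.1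
    refine ((D.continuousAt_integral h hU η₁).congr ?_).continuousWithinAt
    filter_upwards [prod_mem_nhds hU univ_mem] with x hx
    exact (D.gelfandTransform_eq h hx.1 x.2).symm
  · obtain ⟨ι, _, Q, hQ⟩ := key y
    rw [hQ]
    exact Q.isNormal_density

end GelfandNormal

/-! ### The product formula. -/

section Product

variable {n : ℕ} {EX EY EΓ EF EG : Fin n → Type*}
  [∀ i, NormedAddCommGroup (EX i)] [∀ i, NormedSpace ℝ (EX i)]
  [∀ i, NormedAddCommGroup (EY i)] [∀ i, NormedSpace ℝ (EY i)] [∀ i, FiniteDimensional ℝ (EY i)]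
  [∀ i, NormedAddCommGroup (EΓ i)] [∀ i, NormedSpace ℝ (EΓ i)] [∀ i, FiniteDimensional ℝ (EΓ i)]
  [∀ i, NormedAddCommGroup (EF i)] [∀ i, NormedSpace ℝ (EF i)] [∀ i, FiniteDimensional ℝ (EF i)]
  [∀ i, NormedAddCommGroup (EG i)] [∀ i, NormedSpace ℝ (EG i)]
  {X Y Γ F G : Fin n → Type*}
  [∀ i, TopologicalSpace (X i)] [∀ i, ChartedSpace (EX i) (X i)]
  [∀ i, TopologicalSpace (Y i)] [∀ i, ChartedSpace (EY i) (Y i)]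
  [∀ i, IsManifold 𝓘(ℝ, EY i) ∞ (Y i)]
  [∀ i, TopologicalSpace (Γ i)] [∀ i, ChartedSpace (EΓ i) (Γ i)]
  [∀ i, IsManifold 𝓘(ℝ, EΓ i) ∞ (Γ i)]
  [∀ i, TopologicalSpace (F i)] [∀ i, ChartedSpace (EF i) (F i)]
  [∀ i, IsManifold 𝓘(ℝ, EF i) ∞ (F i)]
  [∀ i, TopologicalSpace (G i)] [∀ i, ChartedSpace (EG i) (G i)]
  {p : ∀ i, X i → Y i} {q : ∀ i, X i → Γ i} {m k d : Fin n → ℕ}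

theorem mfderiv_extChartAt_modelPi_symm_self (y : ∀ i, Y i) (v : ∀ i, EY i) :
    (mfderiv 𝓘(ℝ, ∀ i, EY i) (modelPi EY) (extChartAt (modelPi EY) y).symm
      (extChartAt (modelPi EY) y y) v : ∀ i, EY i) = v := by
  have h := hasMFDerivAt_pi_param (EX := EY) (u := extChartAt (modelPi EY) y y)
    (f := fun i => (extChartAt 𝓘(ℝ, EY i) (y i)).symm)
    (fun i => (ContinuousLinearMap.proj i : (∀ i, EY i) →L[ℝ] EY i)) fun i =>
      mdifferentiableAt_extChartAt_symm (y i) (mem_extChartAt_target (y i))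
  refine (congrArg (fun L : (∀ i, EY i) →L[ℝ] ∀ i, EY i => L v) h.mfderiv).trans ?_
  exact funext fun i => mfderiv_extChartAt_symm_self (y i) (v i)

theorem exists_localData_family
    (hpq : ∀ i, IsDoubleFibration (EX i) (EY i) (EΓ i) (EF i) (EG i) (F i) (G i) (p i) (q i))
    (b : ∀ i, Basis (Fin (m i)) ℝ (EΓ i))
    (hk : ∀ i, finrank ℝ (EF i) = k i)
    {Φ : ∀ i, DensityFamily 𝓘(ℝ, EΓ i) (Γ i) (m i)} (hΦ : ∀ i, IsDensityOn 𝓘(ℝ, EΓ i) (Φ i))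
    (y₀ : ∀ i, Y i) {z₁ : ∀ i, EY i}
    (hz₁ : ∀ i, z₁ i ∈ (extChartAt 𝓘(ℝ, EY i) (y₀ i)).target) :
    ∃ (N : Fin n → ℕ) (U : ∀ i, Set (EY i)), (∀ i, U i ∈ 𝓝 (z₁ i)) ∧
      (∀ i, U i ⊆ (extChartAt 𝓘(ℝ, EY i) (y₀ i)).target) ∧
      Nonempty (∀ i, LocalData 𝓘(ℝ, EX i) 𝓘(ℝ, EY i) 𝓘(ℝ, EΓ i) (p i) (q i) (Φ i)
        (extChartAt 𝓘(ℝ, EY i) (y₀ i)).symm (k i)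
        ((b i).equivFunL : EΓ i →L[ℝ] (Fin (m i) → ℝ)) (U i) (Fin (N i))) := by
  have hL : ∀ i, Nonempty (EF i ≃L[ℝ] (Fin (k i) → ℝ)) := fun i =>
    FiniteDimensional.nonempty_continuousLinearEquiv_of_finrank_eq (by simp [hk i])
  choose N U hU hUt D using fun i =>
    exists_localData (hpq i) (hL i).some (b i) (hΦ i) (y₀ i) (hz₁ i)
  exact ⟨N, U, hU, hUt, ⟨fun i => (D i).some⟩⟩

theorem isNormalOn_gelfandTransform_factor
    (hpq : ∀ i, IsDoubleFibration (EX i) (EY i) (EΓ i) (EF i) (EG i) (F i) (G i) (p i) (q i))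
    (hm : ∀ i, finrank ℝ (EΓ i) = m i)
    (hk : ∀ i, finrank ℝ (EF i) = k i)
    (hd : ∀ i, d i + k i = m i)
    {Φ : ∀ i, DensityFamily 𝓘(ℝ, EΓ i) (Γ i) (m i)} (hΦ : ∀ i, IsDensityOn 𝓘(ℝ, EΓ i) (Φ i))
    (i : Fin n) : IsNormalOn 𝓘(ℝ, EY i)
      (gelfandTransform 𝓘(ℝ, EX i) 𝓘(ℝ, EY i) 𝓘(ℝ, EΓ i) (p i) (q i) (hd i) (Φ i)) := by
  let b := finBasisOfFinrankEq ℝ (EΓ i) (hm i)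
  obtain ⟨L⟩ : Nonempty (EF i ≃L[ℝ] (Fin (k i) → ℝ)) :=
    FiniteDimensional.nonempty_continuousLinearEquiv_of_finrank_eq (by simp [hk i])
  refine isNormalOn_gelfandTransform (T := (b.equivFunL : EΓ i →L[ℝ] (Fin (m i) → ℝ))) (hd i)
    mfderiv_extChartAt_symm_self mem_extChartAt_target fun y₀ z₁ hz₁ => ?_
  obtain ⟨N, U, hU, -, D⟩ := exists_localData (hpq i) L b (hΦ i) y₀ hz₁
  exact ⟨Fin N, inferInstance, inferInstance, inferInstance, U, hU, D⟩

theorem isNormalOn_gelfandTransform_pi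
    (hpq : ∀ i, IsDoubleFibration (EX i) (EY i) (EΓ i) (EF i) (EG i) (F i) (G i) (p i) (q i))
    (hm : ∀ i, finrank ℝ (EΓ i) = m i)
    (hk : ∀ i, finrank ℝ (EF i) = k i)
    (hd : ∀ i, d i + k i = m i)
    {Φ : ∀ i, DensityFamily 𝓘(ℝ, EΓ i) (Γ i) (m i)} (hΦ : ∀ i, IsDensityOn 𝓘(ℝ, EΓ i) (Φ i))
    : IsNormalOn (modelPi EY) (gelfandTransform (modelPi EX) (modelPi EY) (modelPi EΓ)
      (fun (x : ∀ i, X i) i => p i (x i)) (fun (x : ∀ i, X i) i => q i (x i))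
      (sum_degrees hd) (externalProd Φ)) := by
  let b := fun i => finBasisOfFinrankEq ℝ (EΓ i) (hm i)
  refine isNormalOn_gelfandTransform (T := stackMap fun i =>
    ((b i).equivFunL : EΓ i →L[ℝ] (Fin (m i) → ℝ)) ∘L
      (ContinuousLinearMap.proj i : (∀ i, EΓ i) →L[ℝ] EΓ i)) (sum_degrees hd)
    mfderiv_extChartAt_modelPi_symm_self mem_extChartAt_target fun y₀ z₁ hz₁ => ?_
  rw [extChartAt_modelPi_target] at hz₁
  obtain ⟨N, U, hU, hUt, ⟨D⟩⟩ := exists_localData_family hpq b hk hΦ y₀ fun i => hz₁ i trivial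
  exact ⟨∀ i, Fin (N i), inferInstance, inferInstance, inferInstance, univ.pi U,
    set_pi_mem_nhds finite_univ fun i _ => hU i, ⟨LocalData.pi D
      (fun i x => (hpq i).fiberBundle_left.contMDiff.contMDiffAt.mdifferentiableAt (by simp))
      (fun i x => (hpq i).fiberBundle_right.contMDiff.contMDiffAt.mdifferentiableAt (by simp))
      fun i z hz => mdifferentiableAt_extChartAt_symm (y₀ i) (hUt i hz)⟩⟩

/-- Both sides are compared at one point y with the same local data of the factors. There, pulling
back under the projection to Y_i just takes the i-th component of each tangent vector, as in
`LocalData.exists_pi_density_eq`. -/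
theorem gelfandTransform_externalProd
    (hpq : ∀ i, IsDoubleFibration (EX i) (EY i) (EΓ i) (EF i) (EG i) (F i) (G i) (p i) (q i))
    (hm : ∀ i, finrank ℝ (EΓ i) = m i)
    (hk : ∀ i, finrank ℝ (EF i) = k i)
    (hd : ∀ i, d i + k i = m i)
    {Φ : ∀ i, DensityFamily 𝓘(ℝ, EΓ i) (Γ i) (m i)} (hΦ : ∀ i, IsDensityOn 𝓘(ℝ, EΓ i) (Φ i))
    : gelfandTransform (modelPi EX) (modelPi EY) (modelPi EΓ)
      (fun (x : ∀ i, X i) i => p i (x i)) (fun (x : ∀ i, X i) i => q i (x i))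
      (sum_degrees hd) (externalProd Φ) = externalProd fun i =>
        gelfandTransform 𝓘(ℝ, EX i) 𝓘(ℝ, EY i) 𝓘(ℝ, EΓ i) (p i) (q i) (hd i) (Φ i) := by
  funext y
  let b := fun i => finBasisOfFinrankEq ℝ (EΓ i) (hm i)
  obtain ⟨N, U, hU, hUt, ⟨D⟩⟩ := exists_localData_family hpq b hk hΦ y fun i =>
    mem_extChartAt_target (y i)
  have hUy : ∀ i, extChartAt 𝓘(ℝ, EY i) (y i) (y i) ∈ U i := fun i => mem_of_mem_nhds (hU i)
  have hp : ∀ i x, MDifferentiableAt 𝓘(ℝ, EX i) 𝓘(ℝ, EY i) (p i) x := fun i x =>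
    (hpq i).fiberBundle_left.contMDiff.contMDiffAt.mdifferentiableAt (by simp)
  have hq : ∀ i x, MDifferentiableAt 𝓘(ℝ, EX i) 𝓘(ℝ, EΓ i) (q i) x := fun i x =>
    (hpq i).fiberBundle_right.contMDiff.contMDiffAt.mdifferentiableAt (by simp)
  have hφ := fun i z (hz : z ∈ U i) => mdifferentiableAt_extChartAt_symm (y i) (hUt i hz)
  obtain ⟨Q, hQ, hprod⟩ := LocalData.exists_pi_density_eq D hp hq hφ hd hUy
  have h1 : gelfandTransform (modelPi EX) (modelPi EY) (modelPi EΓ)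
      (fun (x : ∀ i, X i) i => p i (x i)) (fun (x : ∀ i, X i) i => q i (x i))
      (sum_degrees hd) (externalProd Φ) y = Q.density := funext fun η =>
    (gelfandTransform_eq_at_center (sum_degrees hd) y (mfderiv_extChartAt_modelPi_symm_self y)
      (U := univ.pi U) (fun i _ => hUy i) (LocalData.pi D hp hq hφ) η).trans (hQ η).symm
  refine (h1.trans hprod).trans (congrArg prodDensity (funext fun i => funext fun w => ?_))
  refine (gelfandTransform_eq_at_center (hd i) (y i) (mfderiv_extChartAt_symm_self (y i)) (hUy i)
    (D i) _).symm.trans ?_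
  refine congrArg (gelfandTransform 𝓘(ℝ, EX i) 𝓘(ℝ, EY i) 𝓘(ℝ, EΓ i) (p i) (q i) (hd i) (Φ i)
    (y i)) (funext fun l => ?_)
  exact (congrArg (fun L : (∀ i, EY i) →L[ℝ] EY i => L (w l))
    (hasMFDerivAt_apply i y).mfderiv).symm

end Product

end NormalDensity

end

theorem mainTheorem1 {n : ℕ}
    {EX EY EΓ EF EG : Fin n → Type*}
    [∀ i, NormedAddCommGroup (EX i)] [∀ i, NormedSpace ℝ (EX i)] [∀ i, FiniteDimensional ℝ (EX i)]
    [∀ i, NormedAddCommGroup (EY i)] [∀ i, NormedSpace ℝ (EY i)] [∀ i, FiniteDimensional ℝ (EY i)]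
    [∀ i, NormedAddCommGroup (EΓ i)] [∀ i, NormedSpace ℝ (EΓ i)] [∀ i, FiniteDimensional ℝ (EΓ i)]
    [∀ i, NormedAddCommGroup (EF i)] [∀ i, NormedSpace ℝ (EF i)] [∀ i, FiniteDimensional ℝ (EF i)]
    [∀ i, NormedAddCommGroup (EG i)] [∀ i, NormedSpace ℝ (EG i)] [∀ i, FiniteDimensional ℝ (EG i)]
    {X Y Γ F G : Fin n → Type*}
    [∀ i, TopologicalSpace (X i)] [∀ i, ChartedSpace (EX i) (X i)]
    [∀ i, IsManifold 𝓘(ℝ, EX i) ∞ (X i)] [∀ i, T2Space (X i)]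
    [∀ i, SecondCountableTopology (X i)]
    [∀ i, TopologicalSpace (Y i)] [∀ i, ChartedSpace (EY i) (Y i)]
    [∀ i, IsManifold 𝓘(ℝ, EY i) ∞ (Y i)] [∀ i, T2Space (Y i)]
    [∀ i, SecondCountableTopology (Y i)]
    [∀ i, TopologicalSpace (Γ i)] [∀ i, ChartedSpace (EΓ i) (Γ i)]
    [∀ i, IsManifold 𝓘(ℝ, EΓ i) ∞ (Γ i)] [∀ i, T2Space (Γ i)]
    [∀ i, SecondCountableTopology (Γ i)]
    [∀ i, TopologicalSpace (F i)] [∀ i, ChartedSpace (EF i) (F i)]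
    [∀ i, IsManifold 𝓘(ℝ, EF i) ∞ (F i)] [∀ i, T2Space (F i)]
    [∀ i, SecondCountableTopology (F i)]
    [∀ i, TopologicalSpace (G i)] [∀ i, ChartedSpace (EG i) (G i)]
    [∀ i, IsManifold 𝓘(ℝ, EG i) ∞ (G i)] [∀ i, T2Space (G i)]
    [∀ i, SecondCountableTopology (G i)]
    (p : ∀ i, X i → Y i) (q : ∀ i, X i → Γ i)
    (hpq : ∀ i, NormalDensity.IsDoubleFibration (EX i) (EY i) (EΓ i) (EF i) (EG i) (F i) (G i) (p i) (q i))
    (m k d : Fin n → ℕ)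
    (hm : ∀ i, Module.finrank ℝ (EΓ i) = m i)
    (hk : ∀ i, Module.finrank ℝ (EF i) = k i)
    (hd : ∀ i, d i + k i = m i)
    (Φ : ∀ i, NormalDensity.DensityFamily 𝓘(ℝ, EΓ i) (Γ i) (m i))
    (hΦ : ∀ i, NormalDensity.IsDensityOn 𝓘(ℝ, EΓ i) (Φ i))
    (Ωi : ∀ i, NormalDensity.DensityFamily 𝓘(ℝ, EY i) (Y i) (d i))
    (hΩi : ∀ i, Ωi i =
      NormalDensity.gelfandTransform 𝓘(ℝ, EX i) 𝓘(ℝ, EY i) 𝓘(ℝ, EΓ i) (p i) (q i) (hd i) (Φ i))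
    (Ω : NormalDensity.DensityFamily (NormalDensity.modelPi EY) (∀ i, Y i) (∑ i, d i))
    (hΩ : Ω =
      NormalDensity.gelfandTransform
        (NormalDensity.modelPi EX) (NormalDensity.modelPi EY) (NormalDensity.modelPi EΓ)
        (fun (x : ∀ i, X i) i => p i (x i)) (fun (x : ∀ i, X i) i => q i (x i))
        (NormalDensity.sum_degrees hd) (NormalDensity.externalProd Φ)) :
    NormalDensity.IsNormalOn (NormalDensity.modelPi EY) Ω ∧
      (∀ i, NormalDensity.IsNormalOn 𝓘(ℝ, EY i) (Ωi i)) ∧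
      Ω = NormalDensity.externalProd Ωi := by
  obtain rfl : Ωi = fun i => NormalDensity.gelfandTransform 𝓘(ℝ, EX i) 𝓘(ℝ, EY i) 𝓘(ℝ, EΓ i)
      (p i) (q i) (hd i) (Φ i) := funext hΩi
  subst hΩ
  exact ⟨NormalDensity.isNormalOn_gelfandTransform_pi hpq hm hk hd hΦ,
    NormalDensity.isNormalOn_gelfandTransform_factor hpq hm hk hd hΦ,
    NormalDensity.gelfandTransform_externalProd hpq hm hk hd hΦ⟩
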